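/- **Setting.** Let $\theta = z\,\frac{d}{dz}$ and consider equations $a_r(z)\theta^r y + \dots + a_1(z)\theta y + a_0(z) y = 0$, $a_k(z)=\sum_{j=0}^{s} a_{k,j}z^j \in \mathbb Z[i][z]$, $1\le r \le s$, for which $0$ is an ordinary point, and evaluation points $\zeta=\hat\zeta/\check\zeta$ ($\hat\zeta\in\mathbb Z[i]$, $\check\zeta\in\mathbb Z_{>0}$). Let $\rho\in(0,\infty]$ be the smallest modulus of a root of $a_r$ ($\infty$ if there is none). The bit size of $(x+iy)/w$ is $\lceil\lg w\rceil+\lceil\lg |x|\rceil+\lceil\lg |y|\rceil+1$ (with $\lceil \lg 0\rceil := 0$), where $\lg$ is the binary logarithm; $h_1$ is the maximum bit size of the $a_{k,j}$, $h_2$ that of $\zeta$, and $h=h_1+h_2$. The equation and the point may vary, subject to the standing assumptions, for fixed constants $S, A, Z$ and $\delta>0$: $s\le S$ (so that also $r \le S$), $|a_{k,j}|\le A\,|a_r(0)|$ for all $k, j$, $|\zeta|\le Z$ and $|\zeta|+\delta\le\rho$. Put $b_j(n)=\sum_{k=0}^r a_{k,j}(n+r-j)^k$ and $B(n)=\begin{pmatrix}\zeta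 C(n)&0\\R&1\end{pmatrix}$, of size $(s+1)\times(s+1)$, where $C(n)$ is the $s \times s$ companion matrix with ones above the diagonal and last row $(-b_s(n)/b_0(n),\dots,-b_1(n)/b_0(n))$, and $R$ is the row of length $s$ with a single $1$, preceded by $s-r$ zeros. Let $P(a,b)=B(b-1)\cdots B(a)$ and $\hat B(n)=b_0(n)\check\zeta B(n)$. BinSplit$(a,b)$ computes $\hat B(b-1)\cdots\hat B(a)$ directly if $b-a\le T$ (a fixed threshold $T\ge1$), and otherwise as BinSplit$(m,b)\cdot$BinSplit$(a,m)$ with $m=\lfloor (a+b)/2\rfloor$. Let $\operatorname{Trunc}(a,\varepsilon)=\operatorname{sgn}(a)\lfloor 2^e|a|\rfloor2^{-e}$ with $e=\lceil\lg\varepsilon^{-1}\rceil$ for real $a$; for a complex $k\times k$ matrix, $\operatorname{Trunc}(\cdot,\varepsilon)$ applies $\operatorname{Trunc}(\cdot,\varepsilon/(\sqrt2\,k))$ to the real and imaginary parts of the entries. $\|\cdot\|$ is the matrix norm induced by the vector $1$-norm. **Algorithm TruncBinSplit$(p)$**, where the truncation order $N$ has already been computed: (1) let $\varepsilon=2^{-p}$;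 (2) $\Delta=\lceil \frac Np(h+r\lceil\lg N\rceil)\rceil$; (3) compute $M$ with $\max_{0\le q<\Delta}\|P(\lfloor \frac q\Delta N\rfloor,\lfloor\frac{q+1}\Delta N\rfloor)\|+\varepsilon\le M\le C^{N/\Delta}$, where $C$ does not depend on $p,h,r,N$; (4) $\tilde P^{(0)}=\mathrm{id}$; (5) for $q=0,\dots,\Delta-1$: $\hat Q=\mathrm{BinSplit}(\lfloor \frac q\Delta N\rfloor,\lfloor\frac{q+1}\Delta N\rfloor)$, $\tilde Q^{(q)}=\operatorname{Trunc}(\hat Q_{s+1,s+1}^{-1}\hat Q,\frac1{2\Delta}M^{-\Delta+1}\varepsilon)$, $\tilde P^{(q+1)}=\operatorname{Trunc}(\tilde Q^{(q)}\tilde P^{(q)},\frac1{2\Delta}M^{-\Delta+q+1}\varepsilon)$; (6) return $\tilde P^{(\Delta)}$. All numbers are stored as binary integers; additions, subtractions, shifts and comparisons of integers take linear time, quotients are computed by Newton's method from these operations and multiplications, and in step (3) $M$ is a power of $2$ computed from an explicit upper bound for the $\|B(n)\|$. **Cost of multiplication.** $\mathrm M(n)\ge1$ bounds the time of multiplying two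 integers of at most $n$ bits; $\mathrm M(n)/n$ is nondecreasing, $\mathrm M(2n)=O(\mathrm M(n))$, and multiplication uses linear space. **Proposition.** Let $\kappa,\kappa'$ be constants. There are constants $C, K$, depending only on $S,A,Z,\delta,\kappa,\kappa',T$ and on the multiplication algorithm, such that for all equations and points as above and all integers $p\ge2$, $N\ge1$ with $h\le\kappa p$, and with $N\le\kappa' p$ if $\rho<\infty$, $N\le\kappa' p/\lg p$ if $\rho=\infty$, the algorithm (not counting the computation of $N$) performs the steps above correctly, with the constant $C$ in step (3), in time at most $$K\,\mathrm M(p)\,(h+r\lg p)\,\lg p\ \text{ if }\rho<\infty,\qquad K\,\mathrm M(p)\,(h+r\lg p)\ \text{ if }\rho=\infty,$$ and in both cases it uses at most $K\,p$ bits of memory, the input included. In particular the hidden constants are independent of $h$ and $r$. -/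

import Mathlib

/-! # A bit-cost model of computation with integers

A computation is described by a term of type `Run α`, built from the elementary operations below
and from `Run.bind`. It records the value computed, the number of bit operations, and the peak
number of bits of memory allocated. All data are integers (and tuples and arrays of integers),
stored in binary. -/

/-- Number of bits occupied by a value in memory. -/
class BitSize (α : Type) where
  bits : α → ℕ

open BitSize (bits)

/-- Binary digits of `|x|`, and one bit for the sign. -/
instance : BitSize ℤ := ⟨fun x => Nat.size x.natAbs + 1⟩

instance : BitSize Bool := ⟨fun _ => 1⟩

instance : BitSize GaussianInt := ⟨fun z => bits z.re + bits z.im⟩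

instance {α β : Type} [BitSize α] [BitSize β] : BitSize (α × β) := ⟨fun x => bits x.1 + bits x.2⟩

instance {α : Type} [BitSize α] {n : ℕ} : BitSize (Fin n → α) := ⟨fun v => ∑ i, bits (v i)⟩

/-- Square matrices of Gaussian integers. -/
abbrev GMat (k : ℕ) : Type := Matrix (Fin k) (Fin k) GaussianInt

instance {k : ℕ} : BitSize (GMat k) := ⟨fun A => ∑ i, ∑ j, bits (A i j)⟩

/-- The result of a computation: its value, the number of bit operations performed, and the peak
number of bits of memory allocated by it (its result and its temporary storage, but not its
arguments, which belong to the caller). -/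
structure Run (α : Type) where
  val : α
  time : ℕ
  peak : ℕ

namespace Run

variable {α β : Type}

/-- `let x := c; f x`. The variable `x` occupies memory until the end of the block `f x`. -/
def bind [BitSize α] (c : Run α) (f : α → Run β) : Run β where
  val := (f c.val).val
  time := c.time + (f c.val).time
  peak := max c.peak (bits c.val + (f c.val).peak)

/-- Write a copy of a value. It is also used to write literal constants. -/
def copy [BitSize α] (x : α) : Run α := ⟨x, bits x, bits x⟩

/-- Addition of integers, in linear time. -/
def add (x y : ℤ) : Run ℤ := ⟨x + y, bits x + bits y, bits (x + y)⟩

/-- Subtraction of integers, in linear time. -/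
def sub (x y : ℤ) : Run ℤ := ⟨x - y, bits x + bits y, bits (x - y)⟩

/-- Opposite of an integer. -/
def neg (x : ℤ) : Run ℤ := ⟨-x, bits x, bits (-x)⟩

/-- Absolute value of an integer. -/
def absVal (x : ℤ) : Run ℤ := ⟨|x|, bits x, bits |x|⟩

/-- Comparison of integers. -/
def lt (x y : ℤ) : Run Bool := ⟨decide (x < y), bits x + bits y, 1⟩

/-- The number of binary digits of `|x|`. -/
def bitLen (x : ℤ) : Run ℤ :=
  ⟨(Nat.size x.natAbs : ℤ), bits x, bits (Nat.size x.natAbs : ℤ)⟩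

/-- Left shift `x * 2 ^ k`, for `k ≥ 0`. -/
def shl (x k : ℤ) : Run ℤ :=
  ⟨x * 2 ^ k.toNat, bits x + bits k + k.toNat, bits (x * 2 ^ k.toNat)⟩

/-- Right shift `⌊x / 2 ^ k⌋`, for `k ≥ 0`. -/
def shr (x k : ℤ) : Run ℤ :=
  ⟨x / 2 ^ k.toNat, bits x + bits k, bits (x / 2 ^ k.toNat)⟩

/-- Sequential computation of the entries of an array. Nothing is assumed about the reuse of
temporary storage from one entry to the next. -/
def vec {n : ℕ} (f : Fin n → Run α) : Run (Fin n → α) where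
  val := fun i => (f i).val
  time := ∑ i, (f i).time
  peak := ∑ i, (f i).peak

/-- Sequential computation of the entries of a matrix. -/
def mat {k : ℕ} (f : Fin k → Fin k → Run GaussianInt) : Run (GMat k) where
  val := Matrix.of fun i j => (f i j).val
  time := ∑ i, ∑ j, (f i j).time
  peak := ∑ i, ∑ j, (f i j).peak

/-- Accumulation of the values of `f 0, …, f (n - 1)` with the operation `op`, starting at `z`. -/
def fold [BitSize α] (z : Run α) (op : α → α → Run α) : (n : ℕ) → (Fin n → Run α) → Run α
  | 0, _ => z
  | n + 1, f => (fold z op n fun i => f i.castSucc).bind fun acc =>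
      (f (Fin.last n)).bind fun t => op acc t

/-- `n` iterations of a loop with counter `i` (which takes the values `i, i + 1, …`) and state `st`.
The local variables of an iteration and the old state are released at the end of the iteration.
The update of the counter and the test for the end of the loop are charged `2 * (bits i + bits lim)`,
where `lim` is the final value of the counter. -/
def loop [BitSize α] (lim : ℤ) (body : ℤ → α → Run α) : ℕ → ℤ → α → Run α
  | 0, _, st => ⟨st, 0, bits st⟩
  | n + 1, i, st =>
    let c := body i st
    let d := loop lim body n (i + 1) c.val
    { val := d.val
      time := c.time + 2 * (bits i + bits lim) + d.time
      peak := max (bits i + bits lim + bits st + c.peak) d.peak }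

end Run

/-- The multiplication algorithm: `M n` is the time needed to multiply two integers of at most
`n` bits, and the multiplication of `x` and `y` uses `spaceConst * (bits x + bits y)` bits of
temporary storage. -/
structure MulAlgo where
  M : ℕ → ℕ
  spaceConst : ℕ

namespace MulAlgo

open Run

variable (μ : MulAlgo)

/-- Multiplication of integers. -/
def mul (x y : ℤ) : Run ℤ :=
  ⟨x * y, μ.M (max (bits x) (bits y)), bits (x * y) + μ.spaceConst * (bits x + bits y)⟩

/-- `x ^ k`, by repeated multiplication. -/
def pow (x : ℤ) : ℕ → Run ℤ
  | 0 => copy 1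
  | k + 1 => (pow x k).bind fun y => μ.mul y x

/-! ## Integer division by Newton's method -/

/-- At most `n` corrections by `± 1` of an approximate quotient `q` by `D`, of remainder `R`. -/
def adjust (D : ℤ) : ℕ → ℤ → ℤ → Run ℤ
  | 0, q, _ => copy q
  | n + 1, q, R =>
    (lt R 0).bind fun isNeg =>
    if isNeg then
      (sub q 1).bind fun q' => (add R D).bind fun R' => adjust D n q' R'
    else
      (lt R D).bind fun done =>
      if done then copy q
      else (add q 1).bind fun q' => (sub R D).bind fun R' => adjust D n q' R'

/-- Turns an approximation `q` of `X / D`, off by at most `n`, into `⌊X / D⌋`. -/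
def correct (n : ℕ) (X D q : ℤ) : Run ℤ :=
  (μ.mul q D).bind fun t => (sub X t).bind fun R => adjust D n q R

/-- Newton's iteration for `⌊2 ^ (2 * k) / D⌋`, where `D` has exactly `k` binary digits. The
reciprocal of the integer made of the `⌈k / 2⌉` leading digits of `D` is computed first.
(The first argument, at least `k`, bounds the depth of the recursion.) -/
def recip : ℕ → ℤ → ℤ → Run ℤ
  | 0, _, _ => copy 4
  | fuel + 1, k, D =>
    (lt k 2).bind fun small =>
    if small then copy 4
    else
      (add k 1).bind fun k₁ =>
      (shr k₁ 1).bind fun j =>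
      (sub k j).bind fun i =>
      (shr D i).bind fun D' =>
      (recip fuel j D').bind fun v =>
      (shl v i).bind fun u =>
      (μ.mul u u).bind fun u₂ =>
      (μ.mul u₂ D).bind fun w =>
      (shl k 1).bind fun k₂ =>
      (shr w k₂).bind fun w' =>
      (shl u 1).bind fun u' =>
      (sub u' w').bind fun q =>
      (shl 1 k₂).bind fun X =>
      μ.correct 9 X D q

/-- `⌊X / D⌋` for `X ≥ 0` and `D > 0`. -/
def div (X D : ℤ) : Run ℤ :=
  (bitLen X).bind fun x =>
  (bitLen D).bind fun d =>
  (lt x d).bind fun b =>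
  (copy (if b then d else x)).bind fun k =>
  (sub k d).bind fun i =>
  (shl D i).bind fun D' =>
  (μ.recip k.toNat k D').bind fun v =>
  (μ.mul X v).bind fun w =>
  (add k d).bind fun kd =>
  (shr w kd).bind fun q =>
  μ.correct 2 X D q

/-- `sgn X * ⌊|X| / D⌋` for `D > 0`. -/
def truncDiv (X D : ℤ) : Run ℤ :=
  (lt X 0).bind fun isNeg =>
  if isNeg then (neg X).bind fun Y => (μ.div Y D).bind fun q => neg q else μ.div X D

/-! ## Gaussian integers and matrices -/

/-- A Gaussian integer from its real and imaginary parts. -/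
def gpair (x y : Run ℤ) : Run GaussianInt :=
  x.bind fun a => y.bind fun b => copy ⟨a, b⟩

def gadd (z w : GaussianInt) : Run GaussianInt := gpair (add z.re w.re) (add z.im w.im)

def gneg (z : GaussianInt) : Run GaussianInt := gpair (neg z.re) (neg z.im)

/-- The product of an integer and a Gaussian integer. -/
def gscale (x : ℤ) (z : GaussianInt) : Run GaussianInt := gpair (μ.mul x z.re) (μ.mul x z.im)

def gmul (z w : GaussianInt) : Run GaussianInt :=
  gpair
    ((μ.mul z.re w.re).bind fun a => (μ.mul z.im w.im).bind fun b => sub a b)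
    ((μ.mul z.re w.im).bind fun a => (μ.mul z.im w.re).bind fun b => add a b)

/-- The identity matrix. -/
def matOne (k : ℕ) : Run (GMat k) := mat fun i j => copy (if i = j then 1 else 0)

/-- Schoolbook product of matrices. -/
def matMul {k : ℕ} (A B : GMat k) : Run (GMat k) :=
  mat fun i j => fold (copy 0) gadd k fun l => μ.gmul (A i l) (B l j)

/-- The entries `sgn x * ⌊|x| / 2 ^ e⌋` of a matrix truncated to a lower precision. -/
def truncShift {k : ℕ} (e : ℤ) (A : GMat k) : Run (GMat k) :=
  mat fun i j => gpair (tr (A i j).re) (tr (A i j).im)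
where
  tr (x : ℤ) : Run ℤ :=
    (lt x 0).bind fun isNeg =>
    if isNeg then (neg x).bind fun y => (shr y e).bind fun q => neg q else shr x e

/-- The matrix `2 ^ e * Q / w`, with the real and imaginary parts of the entries rounded to integers
toward zero. -/
def truncQuot {k : ℕ} (e : ℤ) (Q : GMat k) (w : GaussianInt) : Run (GMat k) :=
  (μ.mul w.re w.re).bind fun x =>
  (μ.mul w.im w.im).bind fun y =>
  (add x y).bind fun D =>
  (neg w.im).bind fun im' =>
  mat fun i j =>
    (μ.gmul (Q i j) ⟨w.re, im'⟩).bind fun u =>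
    gpair ((shl u.re e).bind fun X => μ.truncDiv X D) ((shl u.im e).bind fun X => μ.truncDiv X D)

end MulAlgo

/-! # Differential equations, evaluation points and the associated recurrence -/

/-- The differential equation `a_r(z) θ^r y + ⋯ + a_1(z) θ y + a_0(z) y = 0` with `θ = z d/dz`,
where `a_k(z) = ∑ j ≤ s, a k j * z ^ j` has Gaussian integer coefficients. Only the values `a k j`
with `k ≤ r` and `j ≤ s` are used. -/
structure DiffEq where
  r : ℕ
  s : ℕ
  a : ℕ → ℕ → GaussianInt

/-- The evaluation point `ζ = num / den ∈ ℚ(i)`. -/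
structure EvalPoint where
  num : GaussianInt
  den : ℤ

/-- The bit size `⌈lg w⌉ + ⌈lg |x|⌉ + ⌈lg |y|⌉ + 1` of `(x + i y) / w`
(with `⌈lg 0⌉` read as `0`). -/
def bitSize (z : GaussianInt) (w : ℤ) : ℕ :=
  Nat.clog 2 w.natAbs + Nat.clog 2 z.re.natAbs + Nat.clog 2 z.im.natAbs + 1

namespace DiffEq

open Finset Polynomial

variable (E : DiffEq)

/-- The polynomial `a_k(z)`. -/
noncomputable def poly (k : ℕ) : GaussianInt[X] := ∑ j ∈ range (E.s + 1), C (E.a k j) * X ^ j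

/-- The maximum bit size of the coefficients of the `a_k`. -/
def h₁ : ℕ := (range (E.r + 1)).sup fun k => (range (E.s + 1)).sup fun j => bitSize (E.a k j) 1

/-- `0` is an ordinary point: up to the factor `z ^ r`, the operator is
`q_r(z) D ^ r + ⋯ + q_1(z) D + q_0(z)` with `D = d/dz`, polynomial `q_i` and `q_r(0) ≠ 0`.
Recall that `z ^ i D ^ i = θ (θ - 1) ⋯ (θ - i + 1)`. -/
def IsOrdinary : Prop :=
  ∃ q : ℕ → GaussianInt[X], (q E.r).eval 0 ≠ 0 ∧
    ∑ k ∈ range (E.r + 1), C (E.poly k) * X ^ k =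
      ∑ i ∈ range (E.r + 1), C (X ^ (E.r - i) * q i) * descPochhammer GaussianInt[X] i

/-- The smallest modulus of a root of `a_r`, or `∞` if there is none. -/
noncomputable def ρ : ENNReal :=
  ⨅ z ∈ {z : ℂ | (E.poly E.r).eval₂ GaussianInt.toComplex z = 0}, ENNReal.ofReal ‖z‖

/-- The coefficients `b_j(n) = ∑ k ≤ r, a_{k,j} (n + r - j) ^ k` of the recurrence. -/
def b (j : ℕ) (n : ℤ) : GaussianInt :=
  ∑ k ∈ range (E.r + 1), E.a k j * (((n + E.r - j) ^ k : ℤ) : GaussianInt)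

end DiffEq

/-- The value of `ζ`. -/
noncomputable def EvalPoint.value (ζ : EvalPoint) : ℂ := GaussianInt.toComplex ζ.num / (ζ.den : ℂ)

/-- The bit size of `ζ`. -/
def EvalPoint.h₂ (ζ : EvalPoint) : ℕ := bitSize ζ.num ζ.den

namespace DiffEq

variable (E : DiffEq) (ζ : EvalPoint)

/-- The matrix `B(n)`, whose diagonal blocks are `ζ C(n)` (a companion matrix) and `1`. -/
noncomputable def B (n : ℕ) : Matrix (Fin (E.s + 1)) (Fin (E.s + 1)) ℂ :=
  Matrix.of fun i j =>
    if i.val = E.s then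
      if j.val = E.s ∨ j.val = E.s - E.r then 1 else 0
    else if j.val = E.s then 0
    else if i.val = E.s - 1 then
      ζ.value * -(GaussianInt.toComplex (E.b (E.s - j.val) n) / GaussianInt.toComplex (E.b 0 n))
    else if j.val = i.val + 1 then ζ.value else 0

/-- The matrix `B̂(n) = b_0(n) * den * B(n)`. -/
def hatB (n : ℤ) : GMat (E.s + 1) :=
  Matrix.of fun i j =>
    if i.val = E.s then
      if j.val = E.s ∨ j.val = E.s - E.r then (ζ.den : GaussianInt) * E.b 0 n else 0
    else if j.val = E.s then 0
    else if i.val = E.s - 1 then -(ζ.num * E.b (E.s - j.val) n)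
    else if j.val = i.val + 1 then ζ.num * E.b 0 n else 0

end DiffEq

/-- The product `F (b - 1) * ⋯ * F (a + 1) * F a`. -/
def prodDesc {R : Type} [Semiring R] {k : ℕ} (F : ℕ → Matrix (Fin k) (Fin k) R) (a b : ℕ) :
    Matrix (Fin k) (Fin k) R :=
  go (b - a)
where
  go : ℕ → Matrix (Fin k) (Fin k) R
    | 0 => 1
    | n + 1 => F (a + n) * go n

/-! # What the algorithm computes -/

/-- The binary logarithm. -/
noncomputable def lg (x : ℝ) : ℝ := Real.logb 2 x

/-- The matrix norm induced by the vector `1`-norm: the largest sum of a column. -/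
noncomputable def normOne {k : ℕ} (A : Matrix (Fin k) (Fin k) ℂ) : ℝ := ⨆ j, ∑ i, ‖A i j‖

/-- `Trunc(a, ε) = sgn(a) ⌊2 ^ e |a|⌋ 2 ^ (-e)` with `e = ⌈lg (1 / ε)⌉`. -/
noncomputable def truncReal (a ε : ℝ) : ℝ :=
  (SignType.sign a : ℝ) * (⌊(2 : ℝ) ^ ⌈lg ε⁻¹⌉ * |a|⌋ : ℝ) * (2 : ℝ) ^ (-⌈lg ε⁻¹⌉)

/-- The truncation of a matrix: the real and imaginary parts of the entries are truncated with the
parameter `ε / β_k`, where `β_k = √2 * k`. -/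
noncomputable def truncMat {k : ℕ} (A : Matrix (Fin k) (Fin k) ℂ) (ε : ℝ) :
    Matrix (Fin k) (Fin k) ℂ :=
  Matrix.of fun i j =>
    ⟨truncReal (A i j).re ((Real.sqrt 2 * k)⁻¹ * ε), truncReal (A i j).im ((Real.sqrt 2 * k)⁻¹ * ε)⟩

namespace DiffEq

variable (E : DiffEq) (ζ : EvalPoint)

/-- `h = h₁ + h₂`. -/
def h : ℕ := E.h₁ + ζ.h₂

/-- The number of blocks `Δ = ⌈(N / p) (h + r ⌈lg N⌉)⌉`. -/
def numBlocks (p N : ℕ) : ℕ :=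
  ⌈(N : ℚ) / p * ((E.h ζ : ℚ) + E.r * (Nat.clog 2 N : ℚ))⌉₊

/-- `P(a, b) = B(b - 1) ⋯ B(a)`. -/
noncomputable def P (a b : ℕ) : Matrix (Fin (E.s + 1)) (Fin (E.s + 1)) ℂ := prodDesc (E.B ζ) a b

/-- The matrix `B̂(b - 1) ⋯ B̂(a)` computed by binary splitting. -/
def hatP (a b : ℕ) : GMat (E.s + 1) := prodDesc (fun n : ℕ => E.hatB ζ n) a b

/-- The matrix `Q̃^(q)`. -/
noncomputable def tildeQ (p N Δ : ℕ) (M : ℝ) (q : ℕ) : Matrix (Fin (E.s + 1)) (Fin (E.s + 1)) ℂ :=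
  let Q := (E.hatP ζ (q * N / Δ) ((q + 1) * N / Δ)).map GaussianInt.toComplex
  truncMat ((Q (Fin.last E.s) (Fin.last E.s))⁻¹ • Q)
    (1 / (2 * Δ) * M ^ (-(Δ : ℤ) + 1) * (2 : ℝ) ^ (-(p : ℤ)))

/-- The matrix `P̃^(q)`. The output of the algorithm is `P̃^(Δ)`. -/
noncomputable def tildeP (p N Δ : ℕ) (M : ℝ) : ℕ → Matrix (Fin (E.s + 1)) (Fin (E.s + 1)) ℂ
  | 0 => 1
  | q + 1 => truncMat (E.tildeQ ζ p N Δ M q * tildeP p N Δ M q)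
      (1 / (2 * Δ) * M ^ (-(Δ : ℤ) + q + 1) * (2 : ℝ) ^ (-(p : ℤ)))

end DiffEq

/-! # The algorithm -/

namespace MulAlgo

open Run

variable (μ : MulAlgo) (E : DiffEq) (ζ : EvalPoint)

/-- Computes `b_j(n)`. -/
def coeffB (n : ℤ) (j : ℕ) : Run GaussianInt :=
  (add n E.r).bind fun t =>
  (sub t j).bind fun x =>
  fold (copy 0) gadd (E.r + 1) fun k => (μ.pow x k).bind fun y => μ.gscale y (E.a k j)

/-- Computes `B̂(n)`. -/
def evalHatB (n : ℤ) : Run (GMat (E.s + 1)) :=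
  (vec fun j : Fin (E.s + 1) => μ.coeffB E n j).bind fun b =>
  mat fun i j =>
    if i.val = E.s then
      if j.val = E.s ∨ j.val = E.s - E.r then μ.gscale ζ.den (b 0) else copy 0
    else if j.val = E.s then copy 0
    else if i.val = E.s - 1 then (μ.gmul ζ.num (b (Fin.ofNat _ (E.s - j.val)))).bind gneg
    else if j.val = i.val + 1 then μ.gmul ζ.num (b 0) else copy 0

/-- Computes `B̂(a + n - 1) ⋯ B̂(a)` by successive multiplications. -/
def directProd (a : ℤ) : ℕ → Run (GMat (E.s + 1))
  | 0 => matOne _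
  | n + 1 =>
    (directProd a n).bind fun A =>
    (add a n).bind fun t =>
    (μ.evalHatB E ζ t).bind fun B => μ.matMul B A

/-- Algorithm BinSplit, with the threshold `T`. (The first argument, at least `b - a`, bounds the
depth of the recursion.) -/
def binSplit (T : ℕ) : ℕ → ℤ → ℤ → Run (GMat (E.s + 1))
  | 0, a, b => (sub b a).bind fun d => μ.directProd E ζ a d.toNat
  | fuel + 1, a, b =>
    (sub b a).bind fun d =>
    (lt T d).bind fun large =>
    if large then
      (add a b).bind fun t =>
      (shr t 1).bind fun m =>
      (binSplit T fuel m b).bind fun R =>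
      (binSplit T fuel a m).bind fun L => μ.matMul R L
    else μ.directProd E ζ a d.toNat

/-- Computes `Δ = ⌈N (h + r ⌈lg N⌉) / p⌉`. The integer `h` is a part of the input. -/
def evalNumBlocks (p N : ℕ) : Run ℤ :=
  (sub N 1).bind fun x =>
  (bitLen x).bind fun L =>
  (μ.mul E.r L).bind fun y =>
  (add (E.h ζ) y).bind fun z =>
  (μ.mul N z).bind fun w =>
  (add w p).bind fun w₁ =>
  (sub w₁ 1).bind fun w₂ => μ.div w₂ p

/-- Computes `⌊(|x| + |y|) / w⌋ + 1`, an upper bound for `|x + i y| / w`. -/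
def ratioBound (z : GaussianInt) (w : ℤ) : Run ℤ :=
  (absVal z.re).bind fun x =>
  (absVal z.im).bind fun y =>
  (add x y).bind fun t =>
  (μ.div t w).bind fun q => add q 1

/-- Computes an upper bound for `1 + |ζ| + |ζ| max_{j, n} |b_j(n) / b_0(n)|`, namely
`1 + c (1 + (r + s) ^ r S)` where `c ≥ |ζ|` and `S` is a sum of upper bounds for the
`|a_{k,j} / a_{r,0}|`. -/
def evalNormBound : Run ℤ :=
  (absVal (E.a E.r 0).re).bind fun x =>
  (absVal (E.a E.r 0).im).bind fun y =>
  (lt x y).bind fun c =>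
  (copy (if c then y else x)).bind fun d =>
  (fold (copy 0) add (E.r + 1) fun k =>
    fold (copy 0) add (E.s + 1) fun j => μ.ratioBound (E.a k j) d).bind fun S =>
  (add E.r E.s).bind fun t =>
  (μ.pow t E.r).bind fun t' =>
  (μ.mul t' S).bind fun u =>
  (add u 1).bind fun u' =>
  (μ.ratioBound ζ.num ζ.den).bind fun z =>
  (μ.mul z u').bind fun v => add v 1

/-- Computes `lg M = m ⌈N / Δ⌉`, where `2 ^ m` exceeds the bound `evalNormBound` for the norms of
the matrices `B(n)`. -/
def evalLgM (N : ℕ) (Δ : ℤ) : Run ℤ :=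
  (μ.evalNormBound E ζ).bind fun β =>
  (bitLen β).bind fun m =>
  (add N Δ).bind fun x =>
  (sub x 1).bind fun x' =>
  (μ.div x' Δ).bind fun l => μ.mul m l

/-- Computes `⌈lg (√2 k * 2 Δ)⌉ = ⌈lg (8 k² Δ²) / 2⌉`, for `k = s + 1`. -/
def evalGuard (Δ : ℤ) : Run ℤ :=
  (add E.s 1).bind fun k =>
  (μ.mul k Δ).bind fun x =>
  (μ.mul x x).bind fun y =>
  (shl y 3).bind fun z =>
  (sub z 1).bind fun z' =>
  (bitLen z').bind fun e =>
  (add e 1).bind fun e' => shr e' 1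

/-- One iteration of the main loop. The matrix `P̃^(q)` is represented as `2 ^ (-e) * A`, where `A` is
a matrix of Gaussian integers. The precisions of the truncations are
`eQ = ⌈lg (√2 (s + 1) * 2 Δ * M ^ (Δ - 1) * 2 ^ p)⌉ = e₀ + (Δ - 1) lg M` and
`e' = e₀ + (Δ - 1 - q) lg M`. -/
def mainStep (T N : ℕ) (Δ lgM e₀ eQ : ℤ) (q : ℤ) (st : GMat (E.s + 1) × ℤ) :
    Run (GMat (E.s + 1) × ℤ) :=
  (μ.mul q N).bind fun x =>
  (μ.div x Δ).bind fun a =>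
  (add q 1).bind fun q' =>
  (μ.mul q' N).bind fun y =>
  (μ.div y Δ).bind fun b =>
  (μ.binSplit E ζ T (b - a).toNat a b).bind fun Q =>
  (μ.truncQuot eQ Q (Q (Fin.last E.s) (Fin.last E.s))).bind fun Q' =>
  (μ.matMul Q' st.1).bind fun A =>
  (sub Δ q').bind fun t =>
  (μ.mul t lgM).bind fun t' =>
  (add e₀ t').bind fun e' =>
  (add eQ st.2).bind fun f =>
  (sub f e').bind fun g =>
  (truncShift g A).bind fun A' => copy (A', e')

/-- Algorithm TruncBinSplit, run with the truncation order `N` and the threshold `T` for BinSplit.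
The result `(A, e)` represents the matrix `2 ^ (-e) * A`. -/
def truncBinSplit (T p N : ℕ) : Run (GMat (E.s + 1) × ℤ) :=
  (μ.evalNumBlocks E ζ p N).bind fun Δ =>
  (μ.evalLgM E ζ N Δ).bind fun lgM =>
  (μ.evalGuard E Δ).bind fun c =>
  (add p c).bind fun e₀ =>
  (sub Δ 1).bind fun x =>
  (μ.mul x lgM).bind fun y =>
  (add e₀ y).bind fun eQ =>
  (matOne (E.s + 1)).bind fun A =>
  loop Δ (μ.mainStep E ζ T N Δ lgM e₀ eQ) Δ.toNat 0 (A, 0)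

end MulAlgo

/-- The number of bits of the input: the equation, the point, `r`, `s`, `h`, `p` and `N`. -/
def inputBits (E : DiffEq) (ζ : EvalPoint) (p N : ℕ) : ℕ :=
  (∑ k ∈ Finset.range (E.r + 1), ∑ j ∈ Finset.range (E.s + 1), bits (E.a k j)) +
    bits ζ.num + bits ζ.den + bits (E.r : ℤ) + bits (E.s : ℤ) + bits (E.h ζ : ℤ) +
    bits (p : ℤ) + bits (N : ℤ)

/-- The assumptions on the multiplication algorithm: positive cost, `M n / n` nondecreasing, and
`M (2 n) = O(M n)`. -/
structure MulAlgo.Regular (μ : MulAlgo) : Prop where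
  pos : 1 ≤ μ.M 1
  mono : ∀ m n : ℕ, 1 ≤ m → m ≤ n → (μ.M m : ℝ) / m ≤ (μ.M n : ℝ) / n
  doubling : ∃ D : ℕ, ∀ n, 1 ≤ n → μ.M (2 * n) ≤ D * μ.M n

/-- The equation `E` and the point `ζ` vary only in ways controlled by the constants: `s ≤ S`, the
coefficients of the `a_k(z) / a_r(0)` have modulus at most `A`, and `|ζ|` is bounded by `Z` and
bounded away from `ρ`. -/
structure Admissible (S : ℕ) (A Z δ : ℝ) (E : DiffEq) (ζ : EvalPoint) : Prop where
  one_le_r : 1 ≤ E.r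
  r_le_s : E.r ≤ E.s
  s_le : E.s ≤ S
  ordinary : E.IsOrdinary
  coeff_le : ∀ k ≤ E.r, ∀ j ≤ E.s,
    ‖GaussianInt.toComplex (E.a k j)‖ ≤ A * ‖GaussianInt.toComplex (E.a E.r 0)‖
  den_pos : 0 < ζ.den
  value_le : ‖ζ.value‖ ≤ Z
  away : ENNReal.ofReal (‖ζ.value‖ + δ) ≤ E.ρ

/-!
`M` is a power of `2`, so the number of binary digits kept by each truncation is an integer that
differs from `e₀ = p + ⌈lg (√2 (s + 1) · 2 Δ)⌉` by a multiple of `lg M` (`ceil_lg_precision`), and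
the truncations are exact integer operations (divisions rounded toward zero and shifts) on
matrices of Gaussian integers (`MulAlgo.LoopState.step`). The bound used for the norms of the
matrices `B(n)` comes from `|b_0(n)| ≥ |a_{r,0}| (n + 1) ^ r` (`0` is an ordinary point, so that
the indicial polynomial is `a_{r,0} x (x - 1) ⋯ (x - r + 1)`) and
`|b_j(n)| ≤ ∑ |a_{k,j}| ((r + s) (n + 1)) ^ r`. It does not exceed a constant, hence
`M = 2 ^ O(N / Δ)` (`Inst.normOne_block_le`, `Inst.exists_two_pow_lgM_le`).

Costs are estimated for families of computations, up to factors that do not depend on the index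
(`IsO`, `CostO`). The predicate `MulAlgo.Budget μ t w` says that a time `t` pays for a bounded
number of operations on integers of size `O(w)`. The regularity of the cost `μ.M` of
multiplications makes `φ w`, with `φ = μ.M p / p + 1`, such a budget for all sizes `w = O(p)`
(`MulAlgo.Regular.budget`). Divisions cost no more than multiplications, since the sizes of the
integers in Newton's iteration double from one step to the next (`MulAlgo.recip_val_fits`).

Let `H = h + r ⌈lg N⌉`. The matrices `B̂(n)` have size `O(H)`, so a node of the recursion tree of
`binSplit` that covers `d` of them works with integers of size `O(H d)`. The sizes at one level of
the tree add up to the size at the root: the time is `O(φ H d lg d)`, while the memory, which is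
reused, decreases geometrically with the depth and stays `O(H d)`
(`Inst.Range.exists_binSplit_bound`). The number of blocks is chosen such that `H d = O(p)`
(`Inst.isO_H_mul_blockLen`). The matrices `P̃^(q)` have norm at most `M ^ q` and are stored with
the precision `p + O(lg Δ) + (Δ - q) lg M`, hence with `O(p + Δ lg M) = O(p + N + Δ) = O(p)` bits
(`Inst.bits_state_le`). So an iteration of the main loop takes the time
`O(φ p lg p) = O(μ.M p · lg p)` and the memory `O(p)`.

There are `Δ ≤ N H / p + 1` iterations. If `N = O(p)`, then `Δ = O(H) = O(h + r lg p)`. If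
`N = O(p / lg p)`, then `Δ lg p = O(H + lg p) = O(h + r lg p)` (`Inst.exists_Δ_mul_lg_le`).
-/

/-! ### Sizes of integers -/

theorem bits_int (x : ℤ) : bits x = Nat.size x.natAbs + 1 := rfl

theorem one_le_bits (x : ℤ) : 1 ≤ bits x := by rw [bits_int]; omega

theorem bits_le_succ_iff {x : ℤ} {n : ℕ} : bits x ≤ n + 1 ↔ x.natAbs < 2 ^ n := by
  rw [bits_int, Nat.add_le_add_iff_right, Nat.size_le]

theorem bits_le_bits {x y : ℤ} (h : x.natAbs ≤ y.natAbs) : bits x ≤ bits y := by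
  have := Nat.size_le_size h
  rw [bits_int, bits_int]; omega

theorem bits_neg (x : ℤ) : bits (-x) = bits x := by rw [bits_int, bits_int, Int.natAbs_neg]

theorem bits_abs (x : ℤ) : bits |x| = bits x := by rw [bits_int, bits_int, Int.natAbs_abs]

theorem natAbs_lt_two_pow (x : ℤ) : x.natAbs < 2 ^ (bits x - 1) := by
  rw [bits_int]; exact Nat.lt_size_self _

theorem bits_add_le_max (x y : ℤ) : bits (x + y) ≤ max (bits x) (bits y) + 1 := by
  have hx := natAbs_lt_two_pow x
  have hy := natAbs_lt_two_pow y
  have h1 := one_le_bits x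
  have h2 := one_le_bits y
  rw [bits_le_succ_iff]
  obtain ⟨m, hm⟩ : ∃ m, max (bits x) (bits y) = m + 1 := ⟨max (bits x) (bits y) - 1, by omega⟩
  rw [hm, pow_succ]
  have := Nat.pow_le_pow_right (n := 2) (by norm_num) (show bits x - 1 ≤ m by omega)
  have := Nat.pow_le_pow_right (n := 2) (by norm_num) (show bits y - 1 ≤ m by omega)
  have := Int.natAbs_add_le x y
  omega

theorem bits_add_le (x y : ℤ) : bits (x + y) ≤ bits x + bits y := by
  have := bits_add_le_max x y
  have h1 := one_le_bits x
  have h2 := one_le_bits y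
  omega

theorem bits_sub_le (x y : ℤ) : bits (x - y) ≤ bits x + bits y := by
  rw [sub_eq_add_neg, ← bits_neg y]; exact bits_add_le _ _

theorem bits_sub_le_max (x y : ℤ) : bits (x - y) ≤ max (bits x) (bits y) + 1 := by
  rw [sub_eq_add_neg, ← bits_neg y]; exact bits_add_le_max _ _

theorem bits_mul_le (x y : ℤ) : bits (x * y) ≤ bits x + bits y := by
  have hx := natAbs_lt_two_pow x
  have hy := natAbs_lt_two_pow y
  have h1 := one_le_bits x
  have h2 := one_le_bits y
  obtain ⟨a, ha⟩ := Nat.exists_eq_add_of_le' h1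
  obtain ⟨b, hb⟩ := Nat.exists_eq_add_of_le' h2
  refine le_trans (bits_le_succ_iff (n := a + b).2 ?_) (by omega)
  rw [Int.natAbs_mul, pow_add]
  rw [ha] at hx
  rw [hb] at hy
  exact Nat.mul_lt_mul'' hx hy

theorem bits_ediv_le (x y : ℤ) : bits (x / y) ≤ bits x :=
  bits_le_bits (Int.natAbs_ediv_le_natAbs _ _)

theorem bits_two_pow (k : ℕ) : bits ((2 : ℤ) ^ k) = k + 2 := by
  rw [bits_int, Int.natAbs_pow]
  change Nat.size (2 ^ k) + 1 = _
  rw [Nat.size_pow]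

theorem bits_shl_le (x : ℤ) (k : ℕ) : bits (x * 2 ^ k) ≤ bits x + k := by
  have hx := natAbs_lt_two_pow x
  obtain ⟨a, ha⟩ := Nat.exists_eq_add_of_le' (one_le_bits x)
  refine le_trans (bits_le_succ_iff (n := a + k).2 ?_) (by omega)
  rw [ha] at hx
  rw [Int.natAbs_mul, pow_add, Int.natAbs_pow]
  exact Nat.mul_lt_mul_of_pos_right hx (by positivity)

theorem bits_natCast_le (n : ℕ) : bits (n : ℤ) ≤ n + 1 := by
  rw [bits_le_succ_iff, Int.natAbs_natCast]
  exact Nat.lt_two_pow_self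

theorem bits_zero : bits (0 : ℤ) = 1 := rfl
theorem bits_one : bits (1 : ℤ) = 2 := rfl
theorem bits_four : bits (4 : ℤ) = 4 := by decide

/-! ### Explicit bounds for the cost of a computation -/

namespace Run

variable {α β : Type}

theorem val_bind [BitSize α] (c : Run α) (f : α → Run β) : (c.bind f).val = (f c.val).val := (rfl)
theorem val_copy [BitSize α] (x : α) : (copy x).val = x := (rfl)
theorem val_add (x y : ℤ) : (add x y).val = x + y := (rfl)
theorem val_sub (x y : ℤ) : (sub x y).val = x - y := (rfl)
theorem val_neg (x : ℤ) : (neg x).val = -x := (rfl)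
theorem val_absVal (x : ℤ) : (absVal x).val = |x| := (rfl)
theorem val_lt (x y : ℤ) : (lt x y).val = decide (x < y) := (rfl)
theorem val_bitLen (x : ℤ) : (bitLen x).val = (Nat.size x.natAbs : ℤ) := (rfl)
theorem val_shl (x k : ℤ) : (shl x k).val = x * 2 ^ k.toNat := (rfl)
theorem val_shr (x k : ℤ) : (shr x k).val = x / 2 ^ k.toNat := (rfl)
theorem val_mul (μ : MulAlgo) (x y : ℤ) : (μ.mul x y).val = x * y := (rfl)

/-- The value of `c` has at most `b` bits, its time is at most `φ * t` and its memory at most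
`σ * s`. -/
structure Fits [BitSize α] (φ σ : ℕ) (c : Run α) (b t s : ℕ) : Prop where
  bits_le : bits c.val ≤ b
  time_le : c.time ≤ φ * t
  peak_le : c.peak ≤ σ * s

variable {φ σ : ℕ}

theorem Fits.mono [BitSize α] {c : Run α} {b t s b' t' s' : ℕ} (h : Fits φ σ c b t s)
    (hb : b ≤ b') (ht : t ≤ t') (hs : s ≤ s') : Fits φ σ c b' t' s' :=
  ⟨h.1.trans hb, h.2.trans (Nat.mul_le_mul_left _ ht), h.3.trans (Nat.mul_le_mul_left _ hs)⟩

end Run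

/-- `φ` is an amortized cost per bit of the multiplications of integers of at most `X` bits, and
`σ` exceeds the constant of the memory used by a multiplication. -/
structure MulAlgo.Rate (μ : MulAlgo) (φ σ X : ℕ) : Prop where
  one_le : 1 ≤ φ
  space_lt : μ.spaceConst < σ
  M_le : ∀ m, 1 ≤ m → m ≤ X → μ.M m ≤ φ * m

namespace MulAlgo

open Run

variable {μ : MulAlgo} {φ σ X : ℕ} {α β : Type}

theorem Rate.one_le_space (hr : μ.Rate φ σ X) : 1 ≤ σ := by have := hr.space_lt; omega

theorem Rate.bind [BitSize α] [BitSize β] (hr : μ.Rate φ σ X) {c : Run α} {f : α → Run β}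
    {b t s b' t' s' : ℕ} (hc : Fits φ σ c b t s)
    (hf : bits c.val ≤ b → Fits φ σ (f c.val) b' t' s') :
    Fits φ σ (c.bind f) b' (t + t') (s + b + s') := by
  have hf := hf hc.1
  have h1 := hr.one_le_space
  refine ⟨hf.1, ?_, ?_⟩
  · change c.time + (f c.val).time ≤ _
    rw [mul_add]
    exact add_le_add hc.2 hf.2
  · change max c.peak (bits c.val + (f c.val).peak) ≤ _
    have h2 := hc.1
    have h3 := hc.3
    have h4 := hf.3
    have h5 : b ≤ σ * b := Nat.le_mul_of_pos_left _ h1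
    rw [mul_add, mul_add]
    omega

theorem Rate.of_linear [BitSize α] (hr : μ.Rate φ σ X) {c : Run α} {b t s : ℕ}
    (hb : bits c.val ≤ b) (ht : c.time ≤ t) (hs : c.peak ≤ s) : Fits φ σ c b t s :=
  ⟨hb, ht.trans (Nat.le_mul_of_pos_left _ hr.one_le),
    hs.trans (Nat.le_mul_of_pos_left _ hr.one_le_space)⟩

theorem Rate.copy [BitSize α] (hr : μ.Rate φ σ X) {x : α} {b : ℕ} (hx : bits x ≤ b) :
    Fits φ σ (copy x) b b b := hr.of_linear hx hx hx

theorem Rate.add (hr : μ.Rate φ σ X) {x y : ℤ} {b c : ℕ} (hx : bits x ≤ b) (hy : bits y ≤ c) :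
    Fits φ σ (add x y) (b + c) (b + c) (b + c) := by
  have := bits_add_le x y
  exact hr.of_linear (this.trans (by omega)) (add_le_add hx hy) (this.trans (by omega))

theorem Rate.sub (hr : μ.Rate φ σ X) {x y : ℤ} {b c : ℕ} (hx : bits x ≤ b) (hy : bits y ≤ c) :
    Fits φ σ (sub x y) (b + c) (b + c) (b + c) := by
  have := bits_sub_le x y
  exact hr.of_linear (this.trans (by omega)) (add_le_add hx hy) (this.trans (by omega))

theorem Rate.lt (hr : μ.Rate φ σ X) {x y : ℤ} {b c : ℕ} (hx : bits x ≤ b) (hy : bits y ≤ c) :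
    Fits φ σ (lt x y) 1 (b + c) 1 :=
  hr.of_linear le_rfl (add_le_add hx hy) le_rfl

theorem Rate.neg (hr : μ.Rate φ σ X) {x : ℤ} {b : ℕ} (hx : bits x ≤ b) :
    Fits φ σ (neg x) b b b := by
  have := bits_neg x
  exact hr.of_linear (this.trans_le hx) hx (this.trans_le hx)

theorem Rate.bitLen (hr : μ.Rate φ σ X) {x : ℤ} {b : ℕ} (hx : bits x ≤ b) :
    Fits φ σ (bitLen x) b b b := by
  have h : bits ((Nat.size x.natAbs : ℕ) : ℤ) ≤ b :=
    (bits_natCast_le _).trans (by rwa [bits_int] at hx)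
  exact hr.of_linear h hx h

theorem Rate.shl (hr : μ.Rate φ σ X) {x k : ℤ} {b c d : ℕ} (hx : bits x ≤ b) (hk : bits k ≤ c)
    (hd : k.toNat ≤ d) : Fits φ σ (shl x k) (b + d) (b + c + d) (b + d) := by
  have := bits_shl_le x k.toNat
  exact hr.of_linear (this.trans (by omega)) (add_le_add (add_le_add hx hk) hd)
    (this.trans (by omega))

theorem Rate.shr (hr : μ.Rate φ σ X) {x k : ℤ} {b c : ℕ} (hx : bits x ≤ b) (hk : bits k ≤ c) :
    Fits φ σ (shr x k) b (b + c) b := by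
  have := bits_ediv_le x (2 ^ k.toNat)
  exact hr.of_linear (this.trans (by omega)) (add_le_add hx hk) (this.trans (by omega))

theorem Rate.mul (hr : μ.Rate φ σ X) {x y : ℤ} {b c : ℕ} (hx : bits x ≤ b) (hy : bits y ≤ c)
    (hb : b ≤ X) (hc : c ≤ X) : Fits φ σ (μ.mul x y) (b + c) (b + c) (b + c) := by
  have h := bits_mul_le x y
  have h1 := one_le_bits x
  refine ⟨h.trans (by omega), ?_, ?_⟩
  · refine (hr.M_le _ ?_ ?_).trans (Nat.mul_le_mul_left _ ?_) <;> omega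
  · change bits (x * y) + μ.spaceConst * (bits x + bits y) ≤ _
    calc _ ≤ (μ.spaceConst + 1) * (bits x + bits y) := by rw [add_mul]; omega
      _ ≤ _ := Nat.mul_le_mul hr.space_lt (by omega)

/-! ### Integer division -/

theorem adjust_val {D X : ℤ} (hD : 0 < D) : ∀ (n : ℕ) (q R : ℤ), q * D + R = X →
    |q - X / D| ≤ n → (adjust D n q R).val = X / D := by
  intro n
  induction n with
  | zero =>
    intro q R _ h
    change q = _
    have : |q - X / D| = 0 := le_antisymm (by simpa using h) (abs_nonneg _)
    rw [abs_eq_zero] at this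
    omega
  | succ n ih =>
    intro q R hX h
    push_cast at h
    rw [abs_le] at h
    rw [adjust, val_bind]
    have hlt : ∀ a b : ℤ, (Run.lt a b).val = decide (a < b) := fun _ _ => rfl
    rw [hlt]
    by_cases hR : R < 0
    · rw [if_pos (by simpa using hR), val_bind, val_bind]
      have hq : X / D < q := by
        rw [Int.ediv_lt_iff_lt_mul hD]; linarith
      refine ih _ _ ?_ ?_
      · change (q - 1) * D + (R + D) = X
        linarith
      · change |q - 1 - X / D| ≤ _
        rw [abs_le]; omega
    · rw [if_neg (by simpa using hR), val_bind, hlt]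
      by_cases hR' : R < D
      · rw [if_pos (by simpa using hR')]
        change q = _
        refine le_antisymm ?_ ?_
        · rw [Int.le_ediv_iff_mul_le hD]; linarith
        · rw [← Int.lt_add_one_iff, Int.ediv_lt_iff_lt_mul hD]; linarith
      · rw [if_neg (by simpa using hR'), val_bind, val_bind]
        have hq : q + 1 ≤ X / D := by
          rw [Int.le_ediv_iff_mul_le hD]; linarith
        refine ih _ _ ?_ ?_
        · change (q + 1) * D + (R - D) = X
          linarith
        · change |q + 1 - X / D| ≤ _
          rw [abs_le]; omega

theorem correct_val {n : ℕ} {D X q : ℤ} (hD : 0 < D) (h : |q - X / D| ≤ n) :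
    (μ.correct n X D q).val = X / D :=
  adjust_val hD n q (X - q * D) (by ring) h

theorem adjust_fits (hr : μ.Rate φ σ X) {D : ℤ} : ∀ (n b : ℕ) (q R : ℤ), bits q ≤ b →
    bits R ≤ b → bits D ≤ b →
    Fits φ σ (adjust D n q R) (b + 2 * n) (20 * (n + 1) * (b + 2 * n)) (20 * (n + 1) * (b + 2 * n)) := by
  intro n
  induction n with
  | zero =>
    intro b q R hq hR hD
    rw [adjust]
    exact (hr.copy hq).mono (by omega) (by omega) (by omega)
  | succ n ih =>
    intro b q R hq hR hD
    have h0 := one_le_bits q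
    have e : 20 * (n + 1 + 1) * (b + 2 * (n + 1)) =
        20 * (n + 1) * (b + 2 + 2 * n) + 20 * (b + 2 * (n + 1)) := by ring
    rw [adjust, e]
    have hlast : ∀ q' R' : ℤ, bits q' ≤ b + 2 → bits R' ≤ b + 2 →
        Fits φ σ (adjust D n q' R') (b + 2 * (n + 1)) (20 * (n + 1) * (b + 2 + 2 * n))
          (20 * (n + 1) * (b + 2 + 2 * n)) := fun q' R' h1 h2 =>
      (ih (b + 2) q' R' h1 h2 (by omega)).mono (by omega) le_rfl le_rfl
    have bs := bits_sub_le_max q 1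
    have ba := bits_add_le_max q 1
    have bs' := bits_sub_le_max R D
    have ba' := bits_add_le_max R D
    rw [bits_one] at bs ba
    have b0 := bits_zero
    have b1 := bits_one
    refine (hr.bind (hr.lt hR b0.le) (fun _ => (?_ : Fits φ σ _ (b + 2 * (n + 1))
      (20 * (n + 1) * (b + 2 + 2 * n) + (16 * b + 6)) (20 * (n + 1) * (b + 2 + 2 * n) + (16 * b + 6))))).mono
      le_rfl (by omega) (by omega)
    split_ifs
    · exact (hr.bind (hr.sub hq b1.le) fun _ => hr.bind (hr.add hR hD) fun _ =>
        hlast _ _ (bs.trans (by omega)) (ba'.trans (by omega))).mono le_rfl (by omega) (by omega)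
    · refine (hr.bind (hr.lt hR hD) (fun _ => (?_ : Fits φ σ _ (b + 2 * (n + 1))
      (20 * (n + 1) * (b + 2 + 2 * n) + (12 * b + 4)) (20 * (n + 1) * (b + 2 + 2 * n) + (12 * b + 4))))).mono
        le_rfl (by omega) (by omega)
      split_ifs
      · exact (hr.copy hq).mono (by omega) (by omega) (by omega)
      · exact (hr.bind (hr.add hq b1.le) fun _ => hr.bind (hr.sub hR hD) fun _ =>
          hlast _ _ (ba.trans (by omega)) (bs'.trans (by omega))).mono le_rfl (by omega) (by omega)

theorem correct_fits (hr : μ.Rate φ σ X) {n b : ℕ} {Y D q : ℤ} (hY : bits Y ≤ b) (hD : bits D ≤ b)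
    (hq : bits q ≤ b) (hb : b ≤ X) :
    Fits φ σ (μ.correct n Y D q) (3 * b + 2 * n) (20 * (n + 1) * (3 * b + 2 * n) + 5 * b)
      (20 * (n + 1) * (3 * b + 2 * n) + 10 * b) := by
  refine (hr.bind (hr.mul hq hD hb hb) fun h1 => hr.bind (hr.sub hY h1) fun h2 =>
    adjust_fits hr n (3 * b) _ _ (by omega) (h2.trans (by omega)) (by omega)).mono
    (by omega) (by omega) (by omega)

end MulAlgo

namespace MulAlgo

open Run

variable {μ : MulAlgo} {φ σ X : ℕ} {α β : Type}

theorem two_pow_le_two_mul_shift {j i : ℕ} {D : ℤ} (hj : 1 ≤ j) (hD : 2 ^ (j + i) ≤ 2 * D) :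
    2 ^ j ≤ 2 * (D / 2 ^ i) := by
  obtain ⟨j, rfl⟩ := Nat.exists_eq_add_of_le' hj
  have : (2 : ℤ) ^ j ≤ D / 2 ^ i := by
    rw [Int.le_ediv_iff_mul_le (by positivity)]
    have : (2 : ℤ) ^ (j + 1 + i) = 2 * (2 ^ j * 2 ^ i) := by ring
    omega
  rw [pow_succ]; omega

theorem shift_lt_two_pow {j i : ℕ} {D : ℤ} (hD : D < 2 ^ (j + i)) : D / 2 ^ i < 2 ^ j := by
  rw [Int.ediv_lt_iff_lt_mul (by positivity), ← pow_add]; exact hD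

theorem sub_reciprocal_bounds {a c D E v u : ℤ} (ha : 0 < a) (hc : 0 < c) (hEa : E ≤ a)
    (haE : a ≤ 2 * E) (hD : E * c ≤ D) (hD' : D < E * c + c) (hv : v * E ≤ a ^ 2)
    (hv' : a ^ 2 < v * E + E) (hu : u = v * c) :
    (a ^ 2 * c ^ 2 - u * D) ^ 2 ≤ 4 * c ^ 2 * (a ^ 2 * c ^ 2) := by
  have hE0 : 0 < E := by linarith
  have hv0 : 0 ≤ v := by
    by_contra h
    have : v ≤ -1 := by omega
    nlinarith [sq_nonneg a]
  have hva : v ≤ 2 * a := by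
    have h1 : v * a ≤ 2 * a * a := by
      calc v * a ≤ v * (2 * E) := mul_le_mul_of_nonneg_left haE hv0
        _ = 2 * (v * E) := by ring
        _ ≤ 2 * a ^ 2 := by linarith
        _ = _ := by ring
    exact le_of_mul_le_mul_right h1 ha
  have hc2 : 0 ≤ c ^ 2 := sq_nonneg c
  have hvc : 0 ≤ v * c := mul_nonneg hv0 hc.le
  have hL : v * E * c ^ 2 ≤ u * D := by
    calc v * E * c ^ 2 = v * c * (E * c) := by ring
      _ ≤ v * c * D := mul_le_mul_of_nonneg_left hD hvc
      _ = u * D := by rw [hu]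
  have hU : u * D ≤ v * E * c ^ 2 + v * c ^ 2 := by
    calc u * D = v * c * D := by rw [hu]
      _ ≤ v * c * (E * c + c) := mul_le_mul_of_nonneg_left hD'.le hvc
      _ = _ := by ring
  have h1 : (a ^ 2 - v * E) * c ^ 2 ≤ a * c ^ 2 := mul_le_mul_of_nonneg_right (by linarith) hc2
  have h2 : v * c ^ 2 ≤ 2 * a * c ^ 2 := mul_le_mul_of_nonneg_right hva hc2
  have h3 : v * E * c ^ 2 ≤ a ^ 2 * c ^ 2 := mul_le_mul_of_nonneg_right hv hc2
  have h4 : 0 ≤ a * c ^ 2 := mul_nonneg ha.le hc2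
  calc _ ≤ (2 * a * c ^ 2) ^ 2 := sq_le_sq' (by linarith) (by linarith)
    _ = _ := by ring

/-- A step `u ↦ 2 u - u² D / P` of Newton's iteration for the reciprocal `P / D`: the residue
`P - u D` is squared and divided by `P`, up to rounding. -/
theorem newton_residue {P D u : ℤ} (hP : 0 < P) (hD : 0 < D) (h : (P - u * D) ^ 2 ≤ 8 * D * P) :
    |2 * u - u * u * D / P - P / D| ≤ 9 := by
  set w := u * u * D / P with hw
  have hwP : w * P ≤ u * u * D := Int.ediv_mul_le _ hP.ne'
  have hwP' : u * u * D < w * P + P := Int.lt_ediv_add_one_mul_self _ hP |>.trans_eq (by ring)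
  have h6 : D * (w * P) ≤ D * (u * u * D) := mul_le_mul_of_nonneg_left hwP hD.le
  have h7 : D * (u * u * D) < D * (w * P + P) := mul_lt_mul_of_pos_left hwP' hD
  have e1 : (P - u * D) ^ 2 = P ^ 2 - 2 * (u * D * P) + D * (u * u * D) := by ring
  set q := 2 * u - w with hq
  have e2 : D * q * P = 2 * (u * D * P) - D * (w * P) := by rw [hq]; ring
  have s1 : P - 8 * D ≤ D * q := by
    refine le_of_mul_le_mul_right ?_ hP
    have : (P - 8 * D) * P = P ^ 2 - 8 * D * P := by ring
    linarith
  have s2 : D * q < P + D := by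
    refine lt_of_mul_lt_mul_right ?_ hP.le
    have : (P + D) * P = P ^ 2 + D * P := by ring
    have := sq_nonneg (P - u * D)
    have : D * (w * P + P) = D * (w * P) + D * P := by ring
    linarith
  have t1 : P / D * D ≤ P := Int.ediv_mul_le _ hD.ne'
  have t2 : P < P / D * D + D := Int.lt_ediv_add_one_mul_self _ hD |>.trans_eq (by ring)
  set f := P / D
  rw [abs_le]
  constructor
  · by_contra hcon
    have h8 : q ≤ f - 10 := by omega
    have := mul_le_mul_of_nonneg_left h8 hD.le
    have e3 : D * (f - 10) = f * D - 10 * D := by ring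
    linarith
  · by_contra hcon
    have h8 : f + 10 ≤ q := by omega
    have := mul_le_mul_of_nonneg_left h8 hD.le
    have e3 : D * (f + 10) = f * D + 10 * D := by ring
    linarith

/-- Newton's step starting from the reciprocal of the `j` leading digits of `D`, whose relative
error is `O(2 ^ (-j))`: the step squares the error, which leaves an absolute error `O(1)` for
`i + j ≤ 2 j` digits. -/
theorem newton_step {j i : ℕ} {D : ℤ} (hj : 1 ≤ j) (hij : i ≤ j) (h1 : 2 ^ (j + i) ≤ 2 * D)
    (h2 : D < 2 ^ (j + i)) {u : ℤ} (hu : u = 2 ^ (2 * j) / (D / 2 ^ i) * 2 ^ i) :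
    |2 * u - u * u * D / 2 ^ (2 * (j + i)) - 2 ^ (2 * (j + i)) / D| ≤ 9 := by
  have ha0 : (0 : ℤ) < 2 ^ j := by positivity
  have hc0 : (0 : ℤ) < 2 ^ i := by positivity
  have hca : (2 : ℤ) ^ i ≤ 2 ^ j := pow_le_pow_right₀ (by norm_num) hij
  have hP : (2 : ℤ) ^ (2 * (j + i)) = (2 ^ j) ^ 2 * (2 ^ i) ^ 2 := by ring
  have hE := two_pow_le_two_mul_shift hj h1
  have hE' := shift_lt_two_pow h2
  have hE0 : 0 < D / 2 ^ i := by linarith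
  have hD0 : 0 < D := by
    have : (0 : ℤ) < 2 ^ (j + i) := by positivity
    linarith
  have hJ : (2 : ℤ) ^ (2 * j) = (2 ^ j) ^ 2 := by ring
  rw [hJ] at hu
  refine newton_residue (by positivity) hD0 ?_
  rw [hP]
  refine (sub_reciprocal_bounds ha0 hc0 hE'.le hE (Int.ediv_mul_le _ hc0.ne')
    ((Int.lt_ediv_add_one_mul_self D hc0).trans_eq (by ring)) (Int.ediv_mul_le _ hE0.ne')
    ((Int.lt_ediv_add_one_mul_self _ hE0).trans_eq (by ring)) hu).trans ?_
  refine mul_le_mul_of_nonneg_right ?_ (by positivity)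
  have : (2 : ℤ) ^ i * 2 ^ i ≤ 2 ^ j * 2 ^ i := mul_le_mul_of_nonneg_right hca hc0.le
  rw [pow_add] at h1
  linarith [sq ((2 : ℤ) ^ i)]

variable (μ) in
/-- The body of the recursion in `recip`, for `k ≥ 2`; `r` computes the reciprocal of the leading
digits. -/
def recipStep (r : ℤ → ℤ → Run ℤ) (k D : ℤ) : Run ℤ :=
  (Run.add k 1).bind fun k₁ =>
  (Run.shr k₁ 1).bind fun j =>
  (Run.sub k j).bind fun i =>
  (Run.shr D i).bind fun D' =>
  (r j D').bind fun v =>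
  (Run.shl v i).bind fun u =>
  (μ.mul u u).bind fun u₂ =>
  (μ.mul u₂ D).bind fun w =>
  (Run.shl k 1).bind fun k₂ =>
  (Run.shr w k₂).bind fun w' =>
  (Run.shl u 1).bind fun u' =>
  (Run.sub u' w').bind fun q =>
  (Run.shl 1 k₂).bind fun Y =>
  μ.correct 9 Y D q

theorem recip_succ (fuel : ℕ) (k D : ℤ) : μ.recip (fuel + 1) k D =
    (Run.lt k 2).bind fun small =>
      if small then Run.copy 4 else μ.recipStep (μ.recip fuel) k D := by
  rw [recip]; rfl

theorem toNat_one_pow : (2 : ℤ) ^ (1 : ℤ).toNat = 2 := by norm_num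

section

variable {j i : ℕ} {r : ℤ → ℤ → Run ℤ} {D : ℤ}

theorem half_succ_eq (hij : i ≤ j) (hji : j ≤ i + 1) :
    (((j + i : ℕ) : ℤ) + 1) / 2 ^ (1 : ℤ).toNat = (j : ℤ) := by
  rw [toNat_one_pow]; omega

theorem sub_half_eq : ((j + i : ℕ) : ℤ) - (j : ℤ) = (i : ℤ) := by push_cast; ring

theorem shl_one_eq : ((j + i : ℕ) : ℤ) * 2 ^ (1 : ℤ).toNat = ((2 * (j + i) : ℕ) : ℤ) := by
  rw [toNat_one_pow]; push_cast; ring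

theorem recipStep_val (hij : i ≤ j) (hji : j ≤ i + 1) (hj : 1 ≤ j)
    (hD1 : 2 ^ (j + i) ≤ 2 * D) (hD2 : D < 2 ^ (j + i))
    (hr : (r j (D / 2 ^ i)).val = 2 ^ (2 * j) / (D / 2 ^ i)) :
    (μ.recipStep r ((j + i : ℕ) : ℤ) D).val = 2 ^ (2 * (j + i)) / D := by
  unfold recipStep
  simp only [val_bind, val_add, val_shr, val_sub, val_shl, val_mul]
  rw [half_succ_eq hij hji, sub_half_eq, shl_one_eq, Int.toNat_natCast, Int.toNat_natCast, hr,
    one_mul, toNat_one_pow, mul_comm _ (2 : ℤ)]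
  apply correct_val
  · have : (0 : ℤ) < 2 ^ (j + i) := by positivity
    omega
  · exact newton_step hj hij hD1 hD2 rfl

theorem recipStep_fits (hr : μ.Rate φ σ X) (hij : i ≤ j) (hji : j ≤ i + 1) (hj : 1 ≤ j)
    (hD : bits D ≤ j + i + 1) {t : ℕ} (hX : 100 * (j + i + 1) ≤ X)
    (hf : Fits φ σ (r j (D / 2 ^ i)) (j + 4) t t) :
    Fits φ σ (μ.recipStep r ((j + i : ℕ) : ℤ) D) (10000 * (j + i)) (t + 50000 * (j + i))
      (t + 50000 * (j + i)) := by
  have hk : bits ((j + i : ℕ) : ℤ) ≤ j + i + 1 := bits_natCast_le _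
  have b1 : bits (1 : ℤ) ≤ 2 := bits_one.le
  have bj : bits (j : ℤ) ≤ j + 1 := bits_natCast_le j
  have bi : bits (i : ℤ) ≤ i + 1 := bits_natCast_le i
  have bk : bits ((2 * (j + i) : ℕ) : ℤ) ≤ j + i + 3 := by
    rw [← shl_one_eq]
    exact (bits_shl_le _ _).trans (by rw [Int.toNat_one]; omega)
  have e1 : (Run.shr (Run.add ((j + i : ℕ) : ℤ) 1).val 1).val = (j : ℤ) := half_succ_eq hij hji
  have e2 : (Run.sub ((j + i : ℕ) : ℤ) (j : ℤ)).val = (i : ℤ) := sub_half_eq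
  have e3 : (Run.shl ((j + i : ℕ) : ℤ) 1).val = ((2 * (j + i) : ℕ) : ℤ) := shl_one_eq
  have e4 : (Run.shr D (i : ℤ)).val = D / 2 ^ i := by rw [Run.shr, Int.toNat_natCast]
  unfold recipStep
  refine (hr.bind (hr.add hk b1) fun g1 => hr.bind (hr.shr g1 b1) fun g2 => ?_ :
    Fits φ σ _ (10000 * (j + i)) (_ + (_ + (t + 45000 * (j + i))))
      (_ + _ + (_ + _ + (t + 45000 * (j + i))))).mono le_rfl (by omega) (by omega)
  rw [e1]
  refine (hr.bind (hr.sub hk bj) fun g3 => ?_ :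
    Fits φ σ _ (10000 * (j + i)) (_ + (t + 40000 * (j + i)))
      (_ + _ + (t + 40000 * (j + i)))).mono le_rfl (by omega) (by omega)
  rw [e2]
  refine (hr.bind (hr.shr hD bi) fun g4 => ?_ :
    Fits φ σ _ (10000 * (j + i)) (_ + (t + 35000 * (j + i)))
      (_ + _ + (t + 35000 * (j + i)))).mono le_rfl (by omega) (by omega)
  rw [e4]
  refine (hr.bind hf fun g5 => hr.bind (hr.shl g5 bi (d := i) (by rw [Int.toNat_natCast])) fun g6 =>
    hr.bind (hr.mul g6 g6 (by omega) (by omega)) fun g7 =>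
    hr.bind (hr.mul g7 hD (by omega) (by omega)) fun g8 =>
    hr.bind (hr.shl hk b1 (d := 1) (by rw [Int.toNat_one])) fun g9 => ?_ :
    Fits φ σ _ (10000 * (j + i)) (_ + (_ + (_ + (_ + (_ + 25000 * (j + i))))))
      (_ + _ + (_ + _ + (_ + _ + (_ + _ + (_ + _ + 25000 * (j + i))))))).mono
    le_rfl (by omega) (by omega)
  rw [e3] at g9 ⊢
  refine (hr.bind (hr.shr g8 g9) fun g10 =>
    hr.bind (hr.shl g6 b1 (d := 1) (by rw [Int.toNat_one])) fun g11 =>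
    hr.bind (hr.sub g11 g10) fun g12 =>
    hr.bind (hr.shl b1 bk (d := 2 * (j + i)) (by rw [Int.toNat_natCast])) fun g13 => ?_ :
    Fits φ σ _ (10000 * (j + i)) (_ + (_ + (_ + (_ + 24000 * (j + i)))))
      (_ + _ + (_ + _ + (_ + _ + (_ + _ + 24000 * (j + i)))))).mono
    le_rfl (by omega) (by omega)
  exact (correct_fits hr (n := 9) (b := 16 * (j + i) + 16) (by omega) (by omega) (by omega)
    (by omega)).mono (by omega) (by omega) (by omega)

end

theorem bits_le_of_lt_two_pow {x : ℤ} {n : ℕ} (h0 : 0 ≤ x) (h : x < 2 ^ n) : bits x ≤ n + 1 := by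
  rw [bits_le_succ_iff]; zify; rwa [abs_of_nonneg h0]

theorem bits_reciprocal_le {k : ℕ} {D : ℤ} (hD : 2 ^ k ≤ 2 * D) :
    bits ((2 : ℤ) ^ (2 * k) / D) ≤ k + 4 := by
  have h4 : (0 : ℤ) < 2 ^ k := by positivity
  have hD0 : 0 < D := by linarith
  refine bits_le_of_lt_two_pow (n := k + 3) (Int.ediv_nonneg (by positivity) hD0.le) ?_
  rw [Int.ediv_lt_iff_lt_mul hD0]
  have : (2 : ℤ) ^ (2 * k) = 2 ^ k * 2 ^ k := by ring
  rw [this, pow_add]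
  nlinarith

theorem recip_val_fits (hr : μ.Rate φ σ X) : ∀ (fuel k : ℕ) (D : ℤ), 1 ≤ k → k ≤ fuel →
    2 ^ k ≤ 2 * D → D < 2 ^ k → 100 * (k + 1) ≤ X →
    (μ.recip fuel k D).val = 2 ^ (2 * k) / D ∧
    Fits φ σ (μ.recip fuel k D) (k + 4) (200000 * k) (200000 * k) := by
  intro fuel
  induction fuel with
  | zero => intro k D h1 h2; omega
  | succ fuel ih =>
    intro k D hk hkf hD1 hD2 hX
    have bk : bits (k : ℤ) ≤ k + 1 := bits_natCast_le k
    have b2 : bits (2 : ℤ) ≤ 3 := (bits_two_pow 1).le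
    rw [recip_succ, val_bind]
    have hlt : (Run.lt (k : ℤ) 2).val = decide ((k : ℤ) < 2) := rfl
    by_cases hk2 : k < 2
    · obtain rfl : k = 1 := by omega
      obtain rfl : D = 1 := by omega
      have h1 : (Run.lt ((1 : ℕ) : ℤ) 2).val = true := rfl
      rw [h1, if_pos rfl]
      refine ⟨rfl, (hr.bind (hr.lt bk b2) fun _ => (?_ : Fits φ σ _ 5 100 100)).mono
        (by omega) (by omega) (by omega)⟩
      rw [h1, if_pos rfl]
      exact (hr.copy bits_four.le).mono (by omega) (by omega) (by omega)
    · have h1 : (Run.lt (k : ℤ) 2).val = false := hlt.trans (decide_eq_false (by omega))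
      have h2 : ¬ (Run.lt (k : ℤ) 2).val = true := by rw [h1]; exact Bool.false_ne_true
      rw [if_neg h2]
      obtain ⟨j, i, rfl, hij, hji⟩ : ∃ j i : ℕ, k = j + i ∧ i ≤ j ∧ j ≤ i + 1 :=
        ⟨(k + 1) / 2, k - (k + 1) / 2, by omega, by omega, by omega⟩
      have hj1 : 1 ≤ j := by omega
      obtain ⟨v1, v2⟩ := ih j (D / 2 ^ i) hj1 (by omega) (two_pow_le_two_mul_shift hj1 hD1)
        (shift_lt_two_pow hD2) (by omega)
      have hv := recipStep_val (μ := μ) hij hji hj1 hD1 hD2 v1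
      refine ⟨hv, ?_⟩
      have h4 : (0 : ℤ) < 2 ^ (j + i) := by positivity
      have hf := recipStep_fits hr hij hji hj1 (bits_le_of_lt_two_pow (by linarith) hD2) hX v2
      refine (hr.bind (hr.lt bk b2) fun _ => (?_ : Fits φ σ _ (j + i + 4)
        (200000 * j + 50000 * (j + i)) (200000 * j + 50000 * (j + i)))).mono
        le_rfl (by omega) (by omega)
      rw [if_neg h2]
      exact ⟨hv ▸ bits_reciprocal_le hD1, hf.2, hf.3⟩

end MulAlgo

namespace MulAlgo

open Run

variable {μ : MulAlgo} {φ σ X : ℕ} {α β : Type}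

/-- The quotient obtained from the rounded reciprocal of the divisor is off by at most `2`. -/
theorem quotient_of_reciprocal {Y D P : ℤ} (hD : 0 < D) (hP : 0 < P) (hY : 0 ≤ Y) (hYP : Y ≤ P) :
    |Y * (P / D) / P - Y / D| ≤ 2 := by
  set v := P / D with hv
  have t1 : v * D ≤ P := Int.ediv_mul_le _ hD.ne'
  have t2 : P < v * D + D := Int.lt_ediv_add_one_mul_self _ hD |>.trans_eq (by ring)
  set q := Y * v / P with hq
  have s1 : q * P ≤ Y * v := Int.ediv_mul_le _ hP.ne'
  have s2 : Y * v < q * P + P := Int.lt_ediv_add_one_mul_self _ hP |>.trans_eq (by ring)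
  have u1 : q ≤ Y / D := by
    rw [Int.le_ediv_iff_mul_le hD]
    refine le_of_mul_le_mul_right ?_ hP
    calc q * D * P = D * (q * P) := by ring
      _ ≤ D * (Y * v) := mul_le_mul_of_nonneg_left s1 hD.le
      _ = Y * (v * D) := by ring
      _ ≤ Y * P := mul_le_mul_of_nonneg_left t1 hY
  have u2 : Y / D < q + 2 := by
    rw [Int.ediv_lt_iff_lt_mul hD]
    refine lt_of_mul_lt_mul_right ?_ hP.le
    calc Y * P ≤ Y * (v * D + D) := mul_le_mul_of_nonneg_left t2.le hY
      _ = D * (Y * v) + Y * D := by ring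
      _ < D * (q * P + P) + Y * D := by
        have := mul_lt_mul_of_pos_left s2 hD
        linarith
      _ ≤ D * (q * P + P) + P * D := by
        have := mul_le_mul_of_nonneg_right hYP hD.le
        linarith
      _ = _ := by ring
  rw [abs_le]; omega

theorem two_pow_size_le {D : ℤ} (hD : 0 < D) : 2 ^ Nat.size D.natAbs ≤ 2 * D := by
  obtain ⟨n, rfl⟩ := Int.eq_ofNat_of_zero_le hD.le
  obtain ⟨m, hm⟩ : ∃ m, Nat.size n = m + 1 :=
    Nat.exists_eq_succ_of_ne_zero (by rw [Ne, Nat.size_eq_zero]; omega)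
  have h1 := Nat.lt_size.1 (show m < Nat.size n by omega)
  simp only [Int.natAbs_natCast, hm]
  have : (2 ^ m : ℤ) ≤ n := by exact_mod_cast h1
  rw [pow_succ]; linarith

theorem lt_two_pow_size {Y : ℤ} (hY : 0 ≤ Y) : Y < 2 ^ Nat.size Y.natAbs := by
  obtain ⟨n, rfl⟩ := Int.eq_ofNat_of_zero_le hY
  exact_mod_cast Nat.lt_size_self n

variable (μ) in
/-- The part of `div` that follows the normalization of the divisor: `d` is the number of digits
of `D`, and `k` is the precision of the reciprocal. -/
def divStep (Y D d k : ℤ) : Run ℤ :=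
  (Run.sub k d).bind fun i =>
  (Run.shl D i).bind fun D' =>
  (μ.recip k.toNat k D').bind fun v =>
  (μ.mul Y v).bind fun w =>
  (Run.add k d).bind fun kd =>
  (Run.shr w kd).bind fun q =>
  μ.correct 2 Y D q

theorem div_eq (Y D : ℤ) : μ.div Y D =
    (Run.bitLen Y).bind fun x => (Run.bitLen D).bind fun d => (Run.lt x d).bind fun b =>
      (Run.copy (if b then d else x)).bind fun k => μ.divStep Y D d k := rfl

theorem divStep_val_fits {Y D : ℤ} {d i n : ℕ} (hD : 0 < D) (hd : d = Nat.size D.natAbs)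
    (hY : 0 ≤ Y) (hYk : Y < 2 ^ (d + i)) (hr : μ.Rate φ σ X) (hn : d + i + 1 ≤ n)
    (hYn : bits Y ≤ n) (hX : 100 * n ≤ X) :
    (μ.divStep Y D d ((d + i : ℕ) : ℤ)).val = Y / D ∧
    Fits φ σ (μ.divStep Y D d ((d + i : ℕ) : ℤ)) (1000 * n) (300000 * n) (300000 * n) := by
  have hD1 := two_pow_size_le hD
  have hD2 := lt_two_pow_size hD.le
  rw [← hd] at hD1 hD2
  have hd1 : 1 ≤ d := by
    rw [hd, Nat.one_le_iff_ne_zero, Ne, Nat.size_eq_zero]; omega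
  have hi0 : (0 : ℤ) < 2 ^ i := by positivity
  have hE1 : (2 : ℤ) ^ (d + i) ≤ 2 * (D * 2 ^ i) := by
    rw [pow_add]
    have := mul_le_mul_of_nonneg_right hD1 hi0.le
    linarith
  have hE2 : D * 2 ^ i < 2 ^ (d + i) := by
    rw [pow_add]; exact mul_lt_mul_of_pos_right hD2 hi0
  obtain ⟨v1, v2⟩ := recip_val_fits hr (d + i) (d + i) (D * 2 ^ i) (by omega) le_rfl hE1 hE2
    (by omega)
  have e1 : ((d + i : ℕ) : ℤ) - (d : ℤ) = (i : ℤ) := by push_cast; ring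
  have e2 : ((d + i : ℕ) : ℤ) + (d : ℤ) = ((d + i + d : ℕ) : ℤ) := by push_cast; ring
  unfold divStep
  constructor
  · simp only [val_bind, val_add, val_shr, val_sub, val_shl, val_mul]
    rw [e1, e2, Int.toNat_natCast, Int.toNat_natCast, Int.toNat_natCast, v1]
    apply correct_val hD
    have e3 : (2 : ℤ) ^ (2 * (d + i)) / (D * 2 ^ i) = 2 ^ (d + i + d) / D := by
      have : (2 : ℤ) ^ (2 * (d + i)) = 2 ^ (d + i + d) * 2 ^ i := by ring
      rw [this, Int.mul_ediv_mul_of_pos_left _ _ hi0]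
    rw [e3]
    refine quotient_of_reciprocal hD (by positivity) hY ?_
    refine hYk.le.trans (pow_le_pow_right₀ (by norm_num) (by omega))
  · have bk : bits ((d + i : ℕ) : ℤ) ≤ n := (bits_natCast_le _).trans hn
    have bd : bits (d : ℤ) ≤ n := (bits_natCast_le _).trans (by omega)
    have bi : bits (i : ℤ) ≤ n := (bits_natCast_le _).trans (by omega)
    have bD : bits D ≤ n := by rw [bits_int, ← hd]; omega
    refine (hr.bind (hr.sub bk bd) fun g1 => ?_ : Fits φ σ _ (1000 * n) (_ + 290000 * n)
      (_ + _ + 290000 * n)).mono le_rfl (by omega) (by omega)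
    rw [val_sub, e1]
    refine (hr.bind (hr.shl bD bi (d := i) (by rw [Int.toNat_natCast])) fun g2 => ?_ :
      Fits φ σ _ (1000 * n) (_ + 280000 * n) (_ + _ + 280000 * n)).mono le_rfl (by omega) (by omega)
    rw [val_shl, Int.toNat_natCast, Int.toNat_natCast]
    refine (hr.bind v2 fun g3 => hr.bind (hr.mul hYn g3 (by omega) (by omega)) fun g4 =>
      hr.bind (hr.add bk bd) fun g5 => hr.bind (hr.shr g4 g5) fun g6 => ?_ :
      Fits φ σ _ (1000 * n) (_ + (_ + (_ + (_ + 20000 * n))))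
        (_ + _ + (_ + _ + (_ + _ + (_ + _ + 20000 * n))))).mono le_rfl (by omega) (by omega)
    exact (correct_fits hr (n := 2) (b := 20 * n) (by omega) (by omega) (by omega)
      (by omega)).mono (by omega) (by omega) (by omega)

theorem div_val_fits {Y D : ℤ} {n : ℕ} (hD : 0 < D) (hY : 0 ≤ Y) (hr : μ.Rate φ σ X)
    (hYn : bits Y ≤ n) (hDn : bits D ≤ n) (hX : 100 * n ≤ X) :
    (μ.div Y D).val = Y / D ∧ Fits φ σ (μ.div Y D) n (310000 * n) (310000 * n) := by
  obtain ⟨i, hi⟩ : ∃ i, max (Nat.size Y.natAbs) (Nat.size D.natAbs) = Nat.size D.natAbs + i :=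
    ⟨_, (Nat.add_sub_cancel' (le_max_right _ _)).symm⟩
  have hk : (if decide ((Nat.size Y.natAbs : ℤ) < (Nat.size D.natAbs : ℤ)) = true
      then (Nat.size D.natAbs : ℤ) else (Nat.size Y.natAbs : ℤ)) =
      ((Nat.size D.natAbs + i : ℕ) : ℤ) := by
    simp only [decide_eq_true_eq]
    split_ifs <;> omega
  have hYs := bits_int Y
  have hDs := bits_int D
  obtain ⟨v, f⟩ := divStep_val_fits (i := i) (n := n) hD rfl hY ((lt_two_pow_size hY).trans_le
    (pow_le_pow_right₀ (by norm_num) (by omega))) hr (by omega) hYn hX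
  have hV : (μ.div Y D).val = Y / D := by
    rw [div_eq]
    simp only [val_bind, val_bitLen, val_lt, val_copy]
    rw [hk, v]
  refine ⟨hV, ?_⟩
  suffices h : Fits φ σ (μ.div Y D) (1000 * n) (310000 * n) (310000 * n) from
    ⟨hV ▸ (bits_ediv_le _ _).trans hYn, h.2, h.3⟩
  rw [div_eq]
  refine (hr.bind (hr.bitLen hYn) fun g1 => hr.bind (hr.bitLen hDn) fun g2 =>
    hr.bind (hr.lt g1 g2) fun _ => hr.bind (hr.copy (b := n) ?_) fun _ => ?_ : Fits φ σ _ (1000 * n)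
    (_ + (_ + (_ + (_ + 300000 * n)))) (_ + _ + (_ + _ + (_ + _ + (_ + _ + 300000 * n))))).mono
    le_rfl (by omega) ?_
  · split_ifs <;> assumption
  · simp only [val_bitLen, val_lt, val_copy]
    rw [hk]
    exact f
  · have := one_le_bits Y
    omega

theorem truncDiv_val_fits {Y D : ℤ} {n : ℕ} (hD : 0 < D) (hr : μ.Rate φ σ X)
    (hYn : bits Y ≤ n) (hDn : bits D ≤ n) (hX : 100 * n ≤ X) :
    (μ.truncDiv Y D).val = Y.tdiv D ∧ Fits φ σ (μ.truncDiv Y D) n (320000 * n) (320000 * n) := by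
  have h1 := one_le_bits Y
  have hlt := hr.lt hYn bits_zero.le
  unfold truncDiv
  rw [val_bind, val_lt]
  by_cases h : Y < 0
  · have hd : decide (Y < 0) = true := decide_eq_true h
    obtain ⟨v, f⟩ := div_val_fits (Y := (Run.neg Y).val) hD (by rw [val_neg]; omega) hr
      (by rwa [val_neg, bits_neg]) hDn hX
    rw [hd, if_pos rfl]
    constructor
    · rw [val_bind, val_bind, v, val_neg, val_neg, ← Int.tdiv_eq_ediv_of_nonneg (by omega),
        Int.neg_tdiv, neg_neg]
    · refine (hr.bind hlt fun _ => (?_ : Fits φ σ _ n (316000 * n) (316000 * n))).mono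
        le_rfl (by omega) (by omega)
      rw [val_lt, hd, if_pos rfl]
      exact Fits.mono (hr.bind (hr.neg hYn) fun _ => hr.bind f fun g => hr.neg g)
        le_rfl (by omega) (by omega)
  · have hd : decide (Y < 0) = false := decide_eq_false h
    obtain ⟨v, f⟩ := div_val_fits (Y := Y) hD (by omega) hr hYn hDn hX
    rw [hd, if_neg Bool.false_ne_true]
    constructor
    · rw [v, Int.tdiv_eq_ediv_of_nonneg (by omega)]
    · refine (hr.bind hlt fun _ => (?_ : Fits φ σ _ n (316000 * n) (316000 * n))).mono
        le_rfl (by omega) (by omega)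
      rw [val_lt, hd, if_neg Bool.false_ne_true]
      exact f.mono le_rfl (by omega) (by omega)

end MulAlgo

/-! ### Uniform bounds for families of computations -/

/-- `f = O(g)`, with a constant that does not depend on the index. -/
def IsO {I : Type} (f g : I → ℕ) : Prop := ∃ c, ∀ i, f i ≤ c * g i

namespace IsO

variable {I J : Type} {f f₁ f₂ g g₁ g₂ h : I → ℕ}

theorem of_le (hfg : ∀ i, f i ≤ g i) : IsO f g := ⟨1, fun i => by rw [one_mul]; exact hfg i⟩

theorem refl (f : I → ℕ) : IsO f f := of_le fun _ => le_rfl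

theorem trans (h₁ : IsO f g) (h₂ : IsO g h) : IsO f h := by
  obtain ⟨c, hc⟩ := h₁
  obtain ⟨d, hd⟩ := h₂
  refine ⟨c * d, fun i => (hc i).trans ?_⟩
  rw [mul_assoc]
  exact Nat.mul_le_mul_left _ (hd i)

theorem of_le_of (h₁ : ∀ i, f i ≤ g i) (h₂ : IsO g h) : IsO f h := (of_le h₁).trans h₂

theorem add (h₁ : IsO f₁ g) (h₂ : IsO f₂ g) : IsO (fun i => f₁ i + f₂ i) g := by
  obtain ⟨c, hc⟩ := h₁
  obtain ⟨d, hd⟩ := h₂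
  refine ⟨c + d, fun i => ?_⟩
  rw [add_mul]
  exact add_le_add (hc i) (hd i)

theorem mul (h₁ : IsO f₁ g₁) (h₂ : IsO f₂ g₂) : IsO (fun i => f₁ i * f₂ i) (fun i => g₁ i * g₂ i) := by
  obtain ⟨c, hc⟩ := h₁
  obtain ⟨d, hd⟩ := h₂
  refine ⟨c * d, fun i => (Nat.mul_le_mul (hc i) (hd i)).trans_eq (by ring)⟩

theorem comp (h₁ : IsO f g) (π : J → I) : IsO (fun j => f (π j)) (fun j => g (π j)) := by
  obtain ⟨c, hc⟩ := h₁
  exact ⟨c, fun j => hc _⟩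

theorem const {c : ℕ} (hg : ∀ i, 1 ≤ g i) : IsO (fun _ => c) g :=
  ⟨c, fun i => Nat.le_mul_of_pos_right _ (hg i)⟩

/-- A bounded quantity times `O(g)`. -/
theorem bounded_mul (h₁ : IsO f₁ fun _ => 1) (h₂ : IsO f₂ g) : IsO (fun i => f₁ i * f₂ i) g := by
  simpa using h₁.mul h₂

theorem const_mul (c : ℕ) (h₂ : IsO f₂ g) : IsO (fun i => c * f₂ i) g :=
  bounded_mul (const fun _ => le_rfl) h₂

theorem of_bounded (h₁ : IsO f fun _ => 1) (hg : ∀ i, 1 ≤ g i) : IsO f g :=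
  h₁.trans (of_le hg)

end IsO

/-- The computations `R i` have values of `O(w i)` bits, and use a time `O(t i)` and a memory
`O(w i)`, with constants that do not depend on `i`. -/
structure CostO {I : Type} {α : I → Type} [∀ i, BitSize (α i)] (R : ∀ i, Run (α i)) (t w : I → ℕ) :
    Prop where
  bits : IsO (fun i => bits (R i).val) w
  time : IsO (fun i => (R i).time) t
  peak : IsO (fun i => (R i).peak) w

namespace CostO

variable {I J : Type} {α β : I → Type} [∀ i, BitSize (α i)] [∀ i, BitSize (β i)] {t w : I → ℕ}

/-- The continuation is bounded for every name `v` of the intermediate value, of which only the size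
and the equation with the value of the first computation are known. -/
theorem bind {c : ∀ i, Run (α i)} {f : ∀ i, α i → Run (β i)} (hc : CostO c t w)
    (hf : ∀ v : ∀ i, α i, (∀ i, v i = (c i).val) → IsO (fun i => BitSize.bits (v i)) w →
      CostO (fun i => f i (v i)) t w) :
    CostO (fun i => (c i).bind (f i)) t w := by
  have h := hf (fun i => (c i).val) (fun _ => rfl) hc.bits
  refine ⟨h.bits, hc.time.add h.time, ?_⟩
  refine IsO.of_le_of (fun i => ?_) (hc.peak.add (hc.bits.add h.peak))
  exact max_le_add_of_nonneg (Nat.zero_le _) (Nat.zero_le _)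

theorem ite {p : I → Prop} [∀ i, Decidable (p i)] {R R' : ∀ i, Run (α i)} (h : CostO R t w)
    (h' : CostO R' t w) : CostO (fun i => if p i then R i else R' i) t w := by
  refine ⟨IsO.of_le_of (fun i => ?_) (h.bits.add h'.bits),
    IsO.of_le_of (fun i => ?_) (h.time.add h'.time), IsO.of_le_of (fun i => ?_) (h.peak.add h'.peak)⟩ <;>
  · split_ifs
    · exact Nat.le_add_right _ _
    · exact Nat.le_add_left _ _

/-- A computation with a bounded parameter `n` obeys the bounds that hold for each fixed value of
the parameter. -/
theorem of_bounded_param {R : ∀ i, ℕ → Run (α i)} (h : ∀ n, CostO (fun i => R i n) t w)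
    {n : I → ℕ} (hn : IsO n fun _ => 1) : CostO (fun i => R i (n i)) t w := by
  obtain ⟨K, hK⟩ := hn
  simp only [mul_one] at hK
  have key : ∀ (F : I → ℕ → ℕ) (g : I → ℕ), (∀ n, IsO (fun i => F i n) g) →
      IsO (fun i => F i (n i)) g := by
    intro F g hF
    choose c hc using hF
    refine ⟨∑ m ∈ Finset.range (K + 1), c m, fun i => (hc (n i) i).trans ?_⟩
    exact Nat.mul_le_mul_right _ (Finset.single_le_sum (f := c) (fun _ _ => Nat.zero_le _)
      (Finset.mem_range.2 (Nat.lt_succ_of_le (hK i))))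
  exact ⟨key (fun i n => BitSize.bits (R i n).val) w fun n => (h n).bits,
    key (fun i n => (R i n).time) t fun n => (h n).time,
    key (fun i n => (R i n).peak) w fun n => (h n).peak⟩

end CostO

theorem bits_pair {α β : Type} [BitSize α] [BitSize β] (x : α × β) : bits x = bits x.1 + bits x.2 :=
  rfl

theorem bits_gaussianInt (z : GaussianInt) : bits z = bits z.re + bits z.im := rfl

theorem bits_gMat {k : ℕ} (A : GMat k) : bits A = ∑ i, ∑ j, bits (A i j) := rfl

theorem bits_pi {α : Type} [BitSize α] {n : ℕ} (v : Fin n → α) : bits v = ∑ i, bits (v i) := rfl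

theorem bits_entry_le {k : ℕ} (A : GMat k) (i j : Fin k) : bits (A i j) ≤ bits A := by
  rw [bits_gMat]
  exact (Finset.single_le_sum (f := fun j => bits (A i j)) (fun _ _ => Nat.zero_le _)
    (Finset.mem_univ j)).trans (Finset.single_le_sum (f := fun i => ∑ j, bits (A i j))
    (fun _ _ => Nat.zero_le _) (Finset.mem_univ i))

theorem bits_coord_le {α : Type} [BitSize α] {n : ℕ} (v : Fin n → α) (i : Fin n) :
    bits (v i) ≤ bits v := by
  rw [bits_pi]
  exact Finset.single_le_sum (f := fun i => bits (v i)) (fun _ _ => Nat.zero_le _)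
    (Finset.mem_univ i)

section Arrays

variable {I : Type} {t w : I → ℕ} {k : I → ℕ}

theorem IsO.sum_fin {g : I → ℕ} (hk : IsO k fun _ => 1) {f : ∀ i, Fin (k i) → ℕ}
    (h : IsO (fun x : Σ i, Fin (k i) => f x.1 x.2) fun x => g x.1) :
    IsO (fun i => ∑ a, f i a) g := by
  obtain ⟨c, hc⟩ := h
  refine IsO.of_le_of (g := fun i => k i * (c * g i)) (fun i => ?_)
    (hk.bounded_mul ((IsO.refl g).const_mul c))
  calc ∑ a, f i a ≤ ∑ _a : Fin (k i), c * g i := Finset.sum_le_sum fun a _ => hc ⟨i, a⟩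
    _ = _ := by simp

theorem IsO.sum_fin₂ {g : I → ℕ} (hk : IsO k fun _ => 1) {f : ∀ i, Fin (k i) → Fin (k i) → ℕ}
    (h : IsO (fun x : Σ i, Fin (k i) × Fin (k i) => f x.1 x.2.1 x.2.2) fun x => g x.1) :
    IsO (fun i => ∑ a, ∑ b, f i a b) g := by
  obtain ⟨c, hc⟩ := h
  exact IsO.sum_fin hk (IsO.sum_fin (k := fun x : Σ i, Fin (k i) => k x.1) (f := fun x b => f x.1 x.2 b)
    (hk.comp Sigma.fst) ⟨c, fun x => hc ⟨x.1.1, x.1.2, x.2⟩⟩)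

theorem CostO.vec {α : Type} [BitSize α] (hk : IsO k fun _ => 1) {f : ∀ i, Fin (k i) → Run α}
    (h : CostO (fun x : Σ i, Fin (k i) => f x.1 x.2) (fun x => t x.1) fun x => w x.1) :
    CostO (fun i => Run.vec (f i)) t w :=
  ⟨IsO.sum_fin hk h.bits, IsO.sum_fin hk h.time, IsO.sum_fin hk h.peak⟩

theorem CostO.mat (hk : IsO k fun _ => 1) {f : ∀ i, Fin (k i) → Fin (k i) → Run GaussianInt}
    (h : CostO (fun x : Σ i, Fin (k i) × Fin (k i) => f x.1 x.2.1 x.2.2) (fun x => t x.1)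
      fun x => w x.1) :
    CostO (fun i => Run.mat (f i)) t w :=
  ⟨IsO.sum_fin₂ hk h.bits, IsO.sum_fin₂ hk h.time, IsO.sum_fin₂ hk h.peak⟩

theorem fold_bounds {α : Type} [BitSize α] {z : Run α} {op : α → α → Run α}
    (hop : ∀ x y, bits (op x y).val ≤ bits x + bits y ∧ (op x y).time ≤ 4 * (bits x + bits y) ∧
      (op x y).peak ≤ 4 * (bits x + bits y)) {B τ P : ℕ} (hz : bits z.val ≤ B ∧ z.time ≤ τ ∧ z.peak ≤ P) :
    ∀ (n : ℕ) (f : Fin n → Run α), (∀ j, bits (f j).val ≤ B ∧ (f j).time ≤ τ ∧ (f j).peak ≤ P) →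
    bits (Run.fold z op n f).val ≤ (n + 1) * B ∧
    (Run.fold z op n f).time ≤ (n + 1) * (τ + 4 * ((n + 1) * B)) ∧
    (Run.fold z op n f).peak ≤ P + 8 * ((n + 1) * B) := by
  intro n
  induction n with
  | zero =>
    intro f _
    rw [Run.fold]
    refine ⟨by omega, by omega, by omega⟩
  | succ n ih =>
    intro f hf
    obtain ⟨h1, h2, h3⟩ := ih (fun i => f i.castSucc) fun j => hf _
    obtain ⟨g1, g2, g3⟩ := hf (Fin.last n)
    obtain ⟨o1, o2, o3⟩ := hop (Run.fold z op n fun i => f i.castSucc).val (f (Fin.last n)).val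
    rw [Run.fold]
    have e : (n + 1 + 1) * B = (n + 1) * B + B := by ring
    refine ⟨?_, ?_, ?_⟩
    · rw [Run.val_bind, Run.val_bind, e]; omega
    · change (Run.fold z op n _).time + ((f (Fin.last n)).time + (op _ _).time) ≤ _
      have e2 : (n + 1 + 1) * (τ + 4 * ((n + 1 + 1) * B)) =
        (n + 1) * (τ + 4 * ((n + 1) * B)) + τ + 4 * ((n + 1) * B + B) + 4 * ((n + 1) * B) := by ring
      rw [e2]; omega
    · change max (Run.fold z op n _).peak (bits (Run.fold z op n _).val + max (f (Fin.last n)).peak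
        (bits (f (Fin.last n)).val + (op _ _).peak)) ≤ _
      rw [e]; omega

theorem costO_fold {α : Type} [BitSize α] {z : Run α} {op : α → α → Run α}
    (hop : ∀ x y, bits (op x y).val ≤ bits x + bits y ∧ (op x y).time ≤ 4 * (bits x + bits y) ∧
      (op x y).peak ≤ 4 * (bits x + bits y)) (hk : IsO k fun _ => 1) (hw : ∀ i, 1 ≤ w i)
    (hwt : IsO w t) {f : ∀ i, Fin (k i) → Run α}
    (h : CostO (fun x : Σ i, Fin (k i) => f x.1 x.2) (fun x => t x.1) fun x => w x.1) :
    CostO (fun i => Run.fold z op (k i) (f i)) t w := by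
  obtain ⟨b, hb⟩ := h.bits
  obtain ⟨τ, hτ⟩ := h.time
  obtain ⟨P, hP⟩ := h.peak
  have key := fun i => fold_bounds hop (B := bits z.val * w i + b * w i)
    (τ := z.time * w i + τ * t i) (P := z.peak * w i + P * w i)
    (z := z) ⟨(Nat.le_mul_of_pos_right _ (hw i)).trans (Nat.le_add_right _ _),
      (Nat.le_mul_of_pos_right _ (hw i)).trans (Nat.le_add_right _ _),
      (Nat.le_mul_of_pos_right _ (hw i)).trans (Nat.le_add_right _ _)⟩ (k i) (f i)
    fun j => ⟨(hb ⟨i, j⟩).trans (Nat.le_add_left _ _), (hτ ⟨i, j⟩).trans (Nat.le_add_left _ _),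
      (hP ⟨i, j⟩).trans (Nat.le_add_left _ _)⟩
  have hk1 : IsO (fun i => k i + 1) fun _ => 1 := hk.add (IsO.refl _)
  have hB : IsO (fun i => bits z.val * w i + b * w i) w :=
    ((IsO.refl w).const_mul _).add ((IsO.refl w).const_mul _)
  have hkB := hk1.bounded_mul hB
  refine ⟨IsO.of_le_of (fun i => (key i).1) hkB, IsO.of_le_of (fun i => (key i).2.1) ?_,
    IsO.of_le_of (fun i => (key i).2.2) ?_⟩
  · exact hk1.bounded_mul (((hwt.const_mul _).add ((IsO.refl t).const_mul _)).add
      ((hkB.const_mul _).trans hwt))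
  · exact (((IsO.refl w).const_mul _).add ((IsO.refl w).const_mul _)).add (hkB.const_mul _)

end Arrays

/-! ### Costs of the elementary routines -/

theorem MulAlgo.Regular.mul_le_mul {μ : MulAlgo} (hμ : μ.Regular) {m n : ℕ} (hm : 1 ≤ m)
    (hmn : m ≤ n) : μ.M m * n ≤ μ.M n * m := by
  have h := hμ.mono m n hm hmn
  have h1 : (0 : ℝ) < m := by exact_mod_cast hm
  have h2 : (0 : ℝ) < n := by exact_mod_cast hm.trans hmn
  rw [div_le_div_iff₀ h1 h2] at h
  exact_mod_cast h

theorem MulAlgo.Regular.le_M {μ : MulAlgo} (hμ : μ.Regular) {n : ℕ} (hn : 1 ≤ n) : n ≤ μ.M n := by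
  have h := hμ.mul_le_mul le_rfl hn
  have h1 := Nat.mul_le_mul_right n hμ.pos
  omega

/-- The cost per bit of the multiplication of integers of `X` bits, rounded up, is a cost per bit
for smaller integers. -/
theorem MulAlgo.Regular.rate {μ : MulAlgo} (hμ : μ.Regular) {X : ℕ} (hX : 1 ≤ X) :
    μ.Rate (μ.M X / X + 1) (μ.spaceConst + 1) X := by
  refine ⟨Nat.le_add_left _ _, Nat.lt_succ_self _, fun m hm hmX => ?_⟩
  have h := hμ.mul_le_mul hm hmX
  have h1 : μ.M X < (μ.M X / X + 1) * X := by
    rw [add_mul, one_mul]; exact Nat.lt_div_mul_add hX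
  refine Nat.le_of_mul_le_mul_right ?_ hX
  calc _ ≤ _ := h
    _ ≤ (μ.M X / X + 1) * X * m := Nat.mul_le_mul_right _ h1.le
    _ = _ := by ring

theorem MulAlgo.Regular.rate_mul_le {μ : MulAlgo} (hμ : μ.Regular) {X : ℕ} (hX : 1 ≤ X) :
    (μ.M X / X + 1) * X ≤ 2 * μ.M X := by
  have := hμ.le_M hX
  have := Nat.div_mul_le_self (μ.M X) X
  rw [add_mul, one_mul]; omega

/-- A time `t` pays for linear time operations and for multiplications on integers of size `O(w)`. -/
structure MulAlgo.Budget {I : Type} (μ : MulAlgo) (t w : I → ℕ) : Prop where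
  regular : μ.Regular
  one_le : ∀ i, 1 ≤ w i
  linear : IsO w t
  M_le : ∀ c, ∃ d, ∀ i m, 1 ≤ m → m ≤ c * w i → μ.M m ≤ d * t i

namespace MulAlgo.Budget

open Run

variable {I J : Type} {μ : MulAlgo} {t w : I → ℕ} {α β : I → Type} [∀ i, BitSize (α i)]
  [∀ i, BitSize (β i)]

theorem comp (hB : μ.Budget t w) (π : J → I) : μ.Budget (fun j => t (π j)) (fun j => w (π j)) :=
  ⟨hB.1, fun _ => hB.2 _, hB.3.comp π, fun c => (hB.4 c).imp fun _ hd _ => hd _⟩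

theorem mono {t' : I → ℕ} (hB : μ.Budget t w) (h : IsO t t') : μ.Budget t' w := by
  refine ⟨hB.1, hB.2, hB.3.trans h, fun c => ?_⟩
  obtain ⟨d, hd⟩ := hB.4 c
  obtain ⟨e, he⟩ := h
  refine ⟨d * e, fun i m h1 h2 => (hd i m h1 h2).trans ?_⟩
  rw [mul_assoc]; exact Nat.mul_le_mul_left _ (he i)

theorem of_linear (hB : μ.Budget t w) {R : ∀ i, Run (α i)} (h1 : IsO (fun i => bits (R i).val) w)
    (h2 : IsO (fun i => (R i).time) w) (h3 : IsO (fun i => (R i).peak) w) : CostO R t w :=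
  ⟨h1, h2.trans hB.linear, h3⟩

theorem const (hB : μ.Budget t w) {c : ℕ} : IsO (fun _ => c) w := IsO.const hB.one_le

theorem copy (hB : μ.Budget t w) {x : ∀ i, α i} (hx : IsO (fun i => bits (x i)) w) :
    CostO (fun i => copy (x i)) t w := hB.of_linear hx hx hx

theorem add (hB : μ.Budget t w) {x y : I → ℤ} (hx : IsO (fun i => bits (x i)) w)
    (hy : IsO (fun i => bits (y i)) w) : CostO (fun i => add (x i) (y i)) t w :=
  have h := IsO.of_le_of (fun i => bits_add_le (x i) (y i)) (hx.add hy)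
  hB.of_linear h (hx.add hy) h

theorem sub (hB : μ.Budget t w) {x y : I → ℤ} (hx : IsO (fun i => bits (x i)) w)
    (hy : IsO (fun i => bits (y i)) w) : CostO (fun i => sub (x i) (y i)) t w :=
  have h := IsO.of_le_of (fun i => bits_sub_le (x i) (y i)) (hx.add hy)
  hB.of_linear h (hx.add hy) h

theorem neg (hB : μ.Budget t w) {x : I → ℤ} (hx : IsO (fun i => bits (x i)) w) :
    CostO (fun i => neg (x i)) t w :=
  have h := IsO.of_le_of (fun i => (bits_neg (x i)).le) hx
  hB.of_linear h hx h

theorem absVal (hB : μ.Budget t w) {x : I → ℤ} (hx : IsO (fun i => bits (x i)) w) :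
    CostO (fun i => absVal (x i)) t w :=
  have h := IsO.of_le_of (fun i => (bits_abs (x i)).le) hx
  hB.of_linear h hx h

theorem lt (hB : μ.Budget t w) {x y : I → ℤ} (hx : IsO (fun i => bits (x i)) w)
    (hy : IsO (fun i => bits (y i)) w) : CostO (fun i => lt (x i) (y i)) t w :=
  hB.of_linear (hB.const (c := 1)) (hx.add hy) (hB.const (c := 1))

theorem bitLen (hB : μ.Budget t w) {x : I → ℤ} (hx : IsO (fun i => bits (x i)) w) :
    CostO (fun i => bitLen (x i)) t w :=
  have h : IsO (fun i => bits ((Nat.size (x i).natAbs : ℕ) : ℤ)) w :=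
    IsO.of_le_of (fun _ => bits_natCast_le _) hx
  hB.of_linear h hx h

theorem shl (hB : μ.Budget t w) {x k : I → ℤ} (hx : IsO (fun i => bits (x i)) w)
    (hk : IsO (fun i => bits (k i)) w) (hk' : IsO (fun i => (k i).toNat) w) :
    CostO (fun i => shl (x i) (k i)) t w :=
  have h := IsO.of_le_of (fun i => bits_shl_le (x i) (k i).toNat) (hx.add hk')
  hB.of_linear h ((hx.add hk).add hk') h

theorem shr (hB : μ.Budget t w) {x k : I → ℤ} (hx : IsO (fun i => bits (x i)) w)
    (hk : IsO (fun i => bits (k i)) w) : CostO (fun i => shr (x i) (k i)) t w :=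
  have h := IsO.of_le_of (fun i => bits_ediv_le (x i) (2 ^ (k i).toNat)) hx
  hB.of_linear h (hx.add hk) h

theorem mul (hB : μ.Budget t w) {x y : I → ℤ} (hx : IsO (fun i => bits (x i)) w)
    (hy : IsO (fun i => bits (y i)) w) : CostO (fun i => μ.mul (x i) (y i)) t w := by
  have h := IsO.of_le_of (fun i => bits_mul_le (x i) (y i)) (hx.add hy)
  refine ⟨h, ?_, h.add ((hx.add hy).const_mul _)⟩
  obtain ⟨c, hc⟩ := hx.add hy
  obtain ⟨d, hd⟩ := hB.M_le c
  refine ⟨d, fun i => hd i _ ?_ ?_⟩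
  · exact (one_le_bits _).trans (le_max_left _ _)
  · exact (max_le_add_of_nonneg (Nat.zero_le _) (Nat.zero_le _)).trans (hc i)

/-- Computations whose cost is proportional to the cost of a multiplication of their data. -/
theorem of_fits (hB : μ.Budget t w) {R : ∀ i, Run (α i)} {n : I → ℕ} (hn : IsO n w) (C : ℕ)
    (hR : ∀ i φ σ X, μ.Rate φ σ X → 100 * n i ≤ X → Fits φ σ (R i) (n i) (C * n i) (C * n i)) :
    CostO R t w := by
  obtain ⟨c, hc⟩ := hn
  have h1 : ∀ i, 1 ≤ 100 * (c * w i) + 1 := fun _ => Nat.le_add_left _ _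
  have key := fun i => hR i _ _ _ (hB.regular.rate (h1 i))
    ((Nat.mul_le_mul_left 100 (hc i)).trans (Nat.le_add_right _ _))
  refine ⟨⟨c, fun i => (key i).1.trans (hc i)⟩, ?_, ?_⟩
  · obtain ⟨d, hd⟩ := hB.M_le (100 * c + 1)
    refine ⟨C * (2 * d), fun i => (key i).2.trans ?_⟩
    have h2 := hB.regular.rate_mul_le (h1 i)
    have h3 := hd i (100 * (c * w i) + 1) (h1 i) (by
      have := hB.one_le i
      rw [add_mul, one_mul, mul_assoc]; omega)
    set φ := μ.M (100 * (c * w i) + 1) / (100 * (c * w i) + 1) + 1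
    calc φ * (C * n i) ≤ φ * (C * (100 * (c * w i) + 1)) := by
          refine Nat.mul_le_mul_left _ (Nat.mul_le_mul_left _ ?_)
          have := hc i
          omega
      _ = C * (φ * (100 * (c * w i) + 1)) := by ring
      _ ≤ C * (2 * (d * t i)) := Nat.mul_le_mul_left _ (h2.trans (Nat.mul_le_mul_left _ h3))
      _ = _ := by ring
  · refine ⟨(μ.spaceConst + 1) * (C * c), fun i => (key i).3.trans ?_⟩
    rw [mul_assoc, mul_assoc]
    exact Nat.mul_le_mul_left _ (Nat.mul_le_mul_left _ (hc i))

theorem div (hB : μ.Budget t w) {x y : I → ℤ} (hx0 : ∀ i, 0 ≤ x i) (hy0 : ∀ i, 0 < y i)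
    (hx : IsO (fun i => bits (x i)) w) (hy : IsO (fun i => bits (y i)) w) :
    CostO (fun i => μ.div (x i) (y i)) t w :=
  hB.of_fits (hx.add hy) 310000 fun i _ _ _ hr hX => (div_val_fits (hy0 i) (hx0 i) hr
    (Nat.le_add_right _ _) (Nat.le_add_left _ _) hX).2

theorem truncDiv (hB : μ.Budget t w) {x y : I → ℤ} (hy0 : ∀ i, 0 < y i)
    (hx : IsO (fun i => bits (x i)) w) (hy : IsO (fun i => bits (y i)) w) :
    CostO (fun i => μ.truncDiv (x i) (y i)) t w :=
  hB.of_fits (hx.add hy) 320000 fun i _ _ _ hr hX => (truncDiv_val_fits (hy0 i) hr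
    (Nat.le_add_right _ _) (Nat.le_add_left _ _) hX).2

theorem gpair (hB : μ.Budget t w) {X Y : I → Run ℤ} (hX : CostO X t w) (hY : CostO Y t w) :
    CostO (fun i => gpair (X i) (Y i)) t w :=
  hX.bind fun _ _ ha => hY.bind fun _ _ hb => hB.copy (x := fun _ => (⟨_, _⟩ : GaussianInt)) (ha.add hb)

theorem re {z : I → GaussianInt} (h : IsO (fun i => bits (z i)) w) :
    IsO (fun i => bits (z i).re) w :=
  IsO.of_le_of (fun _ => Nat.le_add_right _ _) h

theorem im {z : I → GaussianInt} (h : IsO (fun i => bits (z i)) w) :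
    IsO (fun i => bits (z i).im) w :=
  IsO.of_le_of (fun _ => Nat.le_add_left _ _) h

theorem gneg (hB : μ.Budget t w) {z : I → GaussianInt} (hz : IsO (fun i => bits (z i)) w) :
    CostO (fun i => gneg (z i)) t w :=
  hB.gpair (hB.neg (re hz)) (hB.neg (im hz))

theorem gscale (hB : μ.Budget t w) {x : I → ℤ} {z : I → GaussianInt}
    (hx : IsO (fun i => bits (x i)) w) (hz : IsO (fun i => bits (z i)) w) :
    CostO (fun i => μ.gscale (x i) (z i)) t w :=
  hB.gpair (hB.mul hx (re hz)) (hB.mul hx (im hz))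

theorem gmul (hB : μ.Budget t w) {x z : I → GaussianInt}
    (hx : IsO (fun i => bits (x i)) w) (hz : IsO (fun i => bits (z i)) w) :
    CostO (fun i => μ.gmul (x i) (z i)) t w :=
  hB.gpair
    ((hB.mul (re hx) (re hz)).bind fun _ _ ha => (hB.mul (im hx) (im hz)).bind fun _ _ hb => hB.sub ha hb)
    ((hB.mul (re hx) (im hz)).bind fun _ _ ha => (hB.mul (im hx) (re hz)).bind fun _ _ hb => hB.add ha hb)

theorem add_op_le (x y : ℤ) : bits (Run.add x y).val ≤ bits x + bits y ∧
    (Run.add x y).time ≤ 4 * (bits x + bits y) ∧ (Run.add x y).peak ≤ 4 * (bits x + bits y) := by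
  have := bits_add_le x y
  refine ⟨this, ?_, ?_⟩
  · change bits x + bits y ≤ _; omega
  · change bits (x + y) ≤ _; omega

theorem gadd_op_le (x y : GaussianInt) : bits (gadd x y).val ≤ bits x + bits y ∧
    (gadd x y).time ≤ 4 * (bits x + bits y) ∧ (gadd x y).peak ≤ 4 * (bits x + bits y) := by
  have h1 := bits_add_le x.re y.re
  have h2 := bits_add_le x.im y.im
  rw [bits_gaussianInt x, bits_gaussianInt y]
  refine ⟨?_, ?_, ?_⟩
  · change bits (x.re + y.re) + bits (x.im + y.im) ≤ _; omega
  · change (bits x.re + bits y.re) + ((bits x.im + bits y.im) +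
      (bits (x.re + y.re) + bits (x.im + y.im))) ≤ _
    omega
  · change max (bits (x.re + y.re)) (bits (x.re + y.re) + (max (bits (x.im + y.im))
      (bits (x.im + y.im) + (bits (x.re + y.re) + bits (x.im + y.im))))) ≤ _
    omega

variable {k : I → ℕ}

theorem fold_add (hB : μ.Budget t w) {z : Run ℤ} (hk : IsO k fun _ => 1)
    {f : ∀ i, Fin (k i) → Run ℤ}
    (h : CostO (fun x : Σ i, Fin (k i) => f x.1 x.2) (fun x => t x.1) fun x => w x.1) :
    CostO (fun i => Run.fold z Run.add (k i) (f i)) t w :=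
  costO_fold add_op_le hk hB.one_le hB.linear h

theorem fold_gadd (hB : μ.Budget t w) {z : Run GaussianInt} (hk : IsO k fun _ => 1)
    {f : ∀ i, Fin (k i) → Run GaussianInt}
    (h : CostO (fun x : Σ i, Fin (k i) => f x.1 x.2) (fun x => t x.1) fun x => w x.1) :
    CostO (fun i => Run.fold z gadd (k i) (f i)) t w :=
  costO_fold gadd_op_le hk hB.one_le hB.linear h

theorem matOne (hB : μ.Budget t w) (hk : IsO k fun _ => 1) : CostO (fun i => matOne (k i)) t w := by
  refine CostO.mat hk ((hB.comp _).copy (IsO.of_le_of (g := fun _ => 10) (fun x => ?_) (hB.comp _).const))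
  split_ifs <;> decide

theorem entry {A : ∀ i, GMat (k i)} (hA : IsO (fun i => bits (A i)) w) :
    IsO (fun x : Σ i, Fin (k i) × Fin (k i) => bits (A x.1 x.2.1 x.2.2)) fun x => w x.1 :=
  IsO.of_le_of (fun _ => bits_entry_le _ _ _) (hA.comp _)

theorem matMul (hB : μ.Budget t w) (hk : IsO k fun _ => 1) {A B : ∀ i, GMat (k i)}
    (hA : IsO (fun i => bits (A i)) w) (hA' : IsO (fun i => bits (B i)) w) :
    CostO (fun i => μ.matMul (A i) (B i)) t w := by
  refine CostO.mat hk (fold_gadd (hB.comp _) (hk.comp _) (gmul ((hB.comp _).comp _) ?_ ?_))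
  · exact IsO.of_le_of (fun x => bits_entry_le (A x.1.1) x.1.2.1 x.2) (hA.comp _)
  · exact IsO.of_le_of (fun x => bits_entry_le (B x.1.1) x.2 x.1.2.2) (hA'.comp _)

theorem pow (hB : μ.Budget t w) {x : I → ℤ} (hx : IsO (fun i => bits (x i)) w)
    (hk : IsO k fun _ => 1) : CostO (fun i => μ.pow (x i) (k i)) t w := by
  refine CostO.of_bounded_param (R := fun i n => μ.pow (x i) n) (fun n => ?_) hk
  induction n with
  | zero => exact hB.copy (hB.const (c := bits (1 : ℤ)))
  | succ n ih => exact ih.bind fun y _ hy => hB.mul hy hx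

theorem truncShift (hB : μ.Budget t w) (hk : IsO k fun _ => 1) {e : I → ℤ} {A : ∀ i, GMat (k i)}
    (he : IsO (fun i => bits (e i)) w) (hA : IsO (fun i => bits (A i)) w) :
    CostO (fun i => truncShift (e i) (A i)) t w := by
  have htr : ∀ {J : Type} {t w : J → ℕ} {e x : J → ℤ}, μ.Budget t w → IsO (fun i => bits (e i)) w →
      IsO (fun i => bits (x i)) w → CostO (fun i => truncShift.tr (e i) (x i)) t w := by
    intro J t w e x hB he hx
    refine (hB.lt hx (hB.const (c := bits (0 : ℤ)))).bind fun _ _ _ => CostO.ite ?_ (hB.shr hx he)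
    exact (hB.neg hx).bind fun _ _ hy => (hB.shr hy he).bind fun _ _ hq => hB.neg hq
  have hA := entry hA
  exact CostO.mat hk (gpair (hB.comp _) (htr (hB.comp _) (he.comp _) (re hA))
    (htr (hB.comp _) (he.comp _) (im hA)))

theorem truncQuot (hB : μ.Budget t w) (hk : IsO k fun _ => 1) {e : I → ℤ} {Q : ∀ i, GMat (k i)}
    {d : I → GaussianInt} (hd0 : ∀ i, d i ≠ 0)
    (he : IsO (fun i => bits (e i)) w) (he' : IsO (fun i => (e i).toNat) w)
    (hQ : IsO (fun i => bits (Q i)) w) (hd : IsO (fun i => bits (d i)) w) :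
    CostO (fun i => μ.truncQuot (e i) (Q i) (d i)) t w := by
  refine (hB.mul (re hd) (re hd)).bind fun x hx bx => (hB.mul (im hd) (im hd)).bind fun y hy yb =>
    (hB.add bx yb).bind fun D hD bD => (hB.neg (im hd)).bind fun u hu bu => ?_
  have hD0 : ∀ i, 0 < D i := by
    intro i
    rw [hD, val_add, hx, hy, val_mul, val_mul]
    by_contra hcon
    apply hd0 i
    have h1 := mul_self_nonneg (d i).re
    have h2 := mul_self_nonneg (d i).im
    rw [Zsqrtd.ext_iff]
    exact ⟨mul_self_eq_zero.1 (by omega), mul_self_eq_zero.1 (by omega)⟩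
  have hw : IsO (fun i => bits (⟨(d i).re, u i⟩ : GaussianInt)) w := (re hd).add bu
  refine CostO.mat hk ((gmul (hB.comp _) (entry hQ) (hw.comp _)).bind fun v _ hv => ?_)
  have hB' := hB.comp (Sigma.fst : (Σ i, Fin (k i) × Fin (k i)) → I)
  exact hB'.gpair
    ((hB'.shl (re hv) (he.comp _) (he'.comp _)).bind fun X _ hX =>
      hB'.truncDiv (fun _ => hD0 _) hX (bD.comp _))
    ((hB'.shl (im hv) (he.comp _) (he'.comp _)).bind fun X _ hX =>
      hB'.truncDiv (fun _ => hD0 _) hX (bD.comp _))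

theorem ratioBound (hB : μ.Budget t w) {z : I → GaussianInt} {d : I → ℤ} (hd0 : ∀ i, 0 < d i)
    (hz : IsO (fun i => bits (z i)) w) (hd : IsO (fun i => bits (d i)) w) :
    CostO (fun i => μ.ratioBound (z i) (d i)) t w := by
  refine (hB.absVal (re hz)).bind fun x hx bx => (hB.absVal (im hz)).bind fun y hy yb =>
    (hB.add bx yb).bind fun s hs bs => ?_
  refine (hB.div (fun i => ?_) hd0 bs hd).bind fun q _ hq => hB.add hq (hB.const (c := bits (1 : ℤ)))
  rw [hs, val_add, hx, hy]
  exact add_nonneg (abs_nonneg _) (abs_nonneg _)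

end MulAlgo.Budget

/-! ### Values of the exact computations -/

section Products

variable {R S : Type} [Semiring R] [Semiring S] {k : ℕ}

theorem prodDesc_self (F : ℕ → Matrix (Fin k) (Fin k) R) (a : ℕ) : prodDesc F a a = 1 := by
  rw [prodDesc, Nat.sub_self]; rfl

theorem prodDesc_succ (F : ℕ → Matrix (Fin k) (Fin k) R) {a b : ℕ} (h : a ≤ b) :
    prodDesc F a (b + 1) = F b * prodDesc F a b := by
  rw [prodDesc, prodDesc, Nat.succ_sub h, prodDesc.go, Nat.add_sub_cancel' h]

theorem prodDesc_mul (F : ℕ → Matrix (Fin k) (Fin k) R) {a m b : ℕ} (h : a ≤ m) (h' : m ≤ b) :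
    prodDesc F m b * prodDesc F a m = prodDesc F a b := by
  induction b, h' using Nat.le_induction with
  | base => rw [prodDesc_self, one_mul]
  | succ n hn ih => rw [prodDesc_succ _ hn, mul_assoc, ih, prodDesc_succ _ (h.trans hn)]

end Products

namespace MulAlgo

open Run

variable {μ : MulAlgo}

theorem val_gpair (x y : Run ℤ) : (gpair x y).val = ⟨x.val, y.val⟩ := (rfl)

theorem val_gadd (z w : GaussianInt) : (gadd z w).val = z + w := (rfl)

theorem val_gneg (z : GaussianInt) : (gneg z).val = -z := (rfl)

theorem val_gscale (x : ℤ) (z : GaussianInt) : (μ.gscale x z).val = x * z := by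
  rw [gscale, val_gpair, val_mul, val_mul]
  ext <;> simp

theorem val_gmul (z w : GaussianInt) : (μ.gmul z w).val = z * w := by
  rw [gmul, val_gpair]
  simp only [val_bind, val_mul, val_add, val_sub]
  ext
  · simp only [Zsqrtd.re_mul]; ring
  · simp only [Zsqrtd.im_mul]

theorem val_fold {α : Type} [BitSize α] [AddCommMonoid α] {op : α → α → Run α}
    (hop : ∀ x y, (op x y).val = x + y) (z : Run α) : ∀ (n : ℕ) (f : Fin n → Run α),
    (fold z op n f).val = z.val + ∑ i, (f i).val
  | 0, f => by rw [fold]; simp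
  | n + 1, f => by
    rw [fold, val_bind, val_bind, hop, val_fold hop z n, Fin.sum_univ_castSucc, add_assoc]

theorem val_mat {k : ℕ} (f : Fin k → Fin k → Run GaussianInt) (i j : Fin k) :
    (mat f).val i j = (f i j).val := (rfl)

theorem val_matOne (k : ℕ) : (matOne k).val = 1 := by
  ext i j : 1
  rw [matOne, val_mat, val_copy, Matrix.one_apply]

theorem val_matMul {k : ℕ} (A B : GMat k) : (μ.matMul A B).val = A * B := by
  ext i j : 1
  rw [matMul, val_mat, val_fold val_gadd, val_copy, zero_add, Matrix.mul_apply]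
  simp only [val_gmul]

theorem val_pow (x : ℤ) : ∀ k : ℕ, (μ.pow x k).val = x ^ k
  | 0 => by rw [MulAlgo.pow, val_copy, pow_zero]
  | k + 1 => by rw [MulAlgo.pow, val_bind, val_mul, val_pow x k, pow_succ]

variable {E : DiffEq} {ζ : EvalPoint}

theorem val_coeffB (n : ℤ) (j : ℕ) : (μ.coeffB E n j).val = E.b j n := by
  rw [coeffB, val_bind, val_bind, val_add, val_sub, val_fold val_gadd, val_copy, zero_add,
    DiffEq.b, Finset.sum_range]
  refine Finset.sum_congr rfl fun k _ => ?_
  rw [val_bind, val_gscale, val_pow, mul_comm]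

theorem val_evalHatB (n : ℤ) : (μ.evalHatB E ζ n).val = E.hatB ζ n := by
  rw [evalHatB, val_bind]
  have hv : ∀ j, (vec fun j : Fin (E.s + 1) => μ.coeffB E n j).val j = E.b j n :=
    fun j => val_coeffB n j
  ext i j : 1
  rw [val_mat, DiffEq.hatB, Matrix.of_apply]
  simp only [hv]
  split_ifs
  · rw [val_gscale]; simp
  · rfl
  · rfl
  · rw [val_bind, val_gneg, val_gmul]
    congr 3
    rw [Fin.val_ofNat, Nat.mod_eq_of_lt (by omega)]
  · rw [val_gmul]; simp
  · rfl

theorem val_directProd (a : ℕ) : ∀ n : ℕ, (μ.directProd E ζ a n).val = E.hatP ζ a (a + n)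
  | 0 => by rw [directProd, val_matOne, DiffEq.hatP, add_zero, prodDesc_self]
  | n + 1 => by
    rw [directProd]
    simp only [val_bind, val_add, val_matMul, val_evalHatB]
    rw [val_directProd a n, DiffEq.hatP, DiffEq.hatP, ← add_assoc,
      prodDesc_succ _ (Nat.le_add_right _ _)]
    norm_cast

theorem half_sum_cast (a b : ℕ) :
    (Run.shr (Run.add (a : ℤ) (b : ℤ)).val 1).val = (((a + b) / 2 : ℕ) : ℤ) := by
  rw [val_shr, val_add, toNat_one_pow]; omega

theorem val_binSplit {T : ℕ} : ∀ (fuel : ℕ) (a b : ℕ), a ≤ b →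
    (μ.binSplit E ζ T fuel a b).val = E.hatP ζ a b := by
  intro fuel
  induction fuel with
  | zero =>
    intro a b h
    rw [binSplit, val_bind, val_sub, show ((b : ℤ) - a).toNat = b - a by omega, val_directProd,
      Nat.add_sub_cancel' h]
  | succ fuel ih =>
    intro a b h
    rw [binSplit, val_bind, val_bind, val_sub]
    split_ifs
    · rw [val_bind, val_bind, half_sum_cast, val_bind, val_bind, val_matMul, ih _ _ (by omega),
        ih _ _ (by omega)]
      exact prodDesc_mul _ (by omega) (by omega)
    · rw [show ((b : ℤ) - a).toNat = b - a by omega, val_directProd, Nat.add_sub_cancel' h]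

end MulAlgo

/-! ### The recurrence at an ordinary point -/

namespace DiffEq

open Polynomial

variable {E : DiffEq}

theorem poly_eval_zero (k : ℕ) : (E.poly k).eval 0 = E.a k 0 := by
  rw [poly, Finset.sum_range_succ']
  simp [eval_finsetSum]

/-- At an ordinary point the indicial polynomial is `a_r(0) X (X - 1) ⋯ (X - r + 1)`. -/
theorem IsOrdinary.indicial (h : E.IsOrdinary) : E.a E.r 0 ≠ 0 ∧
    ∑ k ∈ Finset.range (E.r + 1), C (E.a k 0) * X ^ k =
      C (E.a E.r 0) * descPochhammer GaussianInt E.r := by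
  obtain ⟨q, hq, h⟩ := h
  have h1 := congrArg (Polynomial.map (evalRingHom (0 : GaussianInt))) h
  simp only [Polynomial.map_sum, Polynomial.map_mul, Polynomial.map_pow, map_C, map_X,
    coe_evalRingHom, poly_eval_zero, descPochhammer_map, eval_mul, eval_pow, eval_X] at h1
  rw [Finset.sum_range_succ (fun i => C (0 ^ (E.r - i) * eval 0 (q i)) *
    descPochhammer GaussianInt i), Finset.sum_eq_zero (s := Finset.range E.r), zero_add, Nat.sub_self,
    pow_zero, one_mul] at h1
  · have h2 := congrArg (fun P : GaussianInt[X] => P.coeff E.r) h1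
    have h3 : (descPochhammer GaussianInt E.r).coeff E.r = 1 := by
      have := (monic_descPochhammer GaussianInt E.r).coeff_natDegree
      rwa [descPochhammer_natDegree] at this
    simp only [finsetSum_coeff, coeff_C_mul, coeff_X_pow, h3, mul_one, mul_ite, mul_zero,
      Finset.sum_ite_eq, Finset.mem_range, Nat.lt_succ_self, if_true] at h2
    rw [← h2] at h1 hq
    exact ⟨hq, h1⟩
  · intro i hi
    have : E.r - i ≠ 0 := by have := Finset.mem_range.1 hi; omega
    rw [zero_pow this, zero_mul, C_0, zero_mul]

theorem b_zero (h : E.IsOrdinary) (n : ℕ) :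
    E.b 0 n = E.a E.r 0 * ((n + E.r).descFactorial E.r : GaussianInt) := by
  have h1 := congrArg (Polynomial.eval (((n + E.r : ℕ)) : GaussianInt)) h.indicial.2
  rw [eval_mul, descPochhammer_eval_eq_descFactorial, eval_C] at h1
  rw [← h1, b, eval_finsetSum]
  refine Finset.sum_congr rfl fun k _ => ?_
  simp

theorem pow_le_descFactorial (n r : ℕ) : (n + 1) ^ r ≤ (n + r).descFactorial r := by
  have := Nat.pow_sub_le_descFactorial (n + r) r
  rwa [show n + r + 1 - r = n + 1 by omega] at this

theorem b_zero_ne_zero (h : E.IsOrdinary) (n : ℕ) : E.b 0 n ≠ 0 := by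
  rw [b_zero h]
  refine mul_ne_zero h.indicial.1 ?_
  have := (Nat.pow_pos (Nat.succ_pos n)).trans_le (pow_le_descFactorial n E.r)
  exact_mod_cast this.ne'

end DiffEq

/-! ### The matrix norm -/

section Norm

variable {k : ℕ}

theorem sum_col_le_normOne (A : Matrix (Fin k) (Fin k) ℂ) (j : Fin k) :
    ∑ i, ‖A i j‖ ≤ normOne A :=
  le_ciSup (f := fun j => ∑ i, ‖A i j‖) (Set.finite_range _).bddAbove j

theorem norm_entry_le_normOne (A : Matrix (Fin k) (Fin k) ℂ) (i j : Fin k) : ‖A i j‖ ≤ normOne A :=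
  (Finset.single_le_sum (f := fun i => ‖A i j‖) (fun _ _ => norm_nonneg _)
    (Finset.mem_univ i)).trans (sum_col_le_normOne A j)

theorem normOne_nonneg (A : Matrix (Fin k) (Fin k) ℂ) : 0 ≤ normOne A :=
  Real.iSup_nonneg fun _ => Finset.sum_nonneg fun _ _ => norm_nonneg _

theorem normOne_le {A : Matrix (Fin k) (Fin k) ℂ} {c : ℝ} (hc : 0 ≤ c)
    (h : ∀ j, ∑ i, ‖A i j‖ ≤ c) : normOne A ≤ c := Real.iSup_le h hc

theorem normOne_mul_le (A B : Matrix (Fin k) (Fin k) ℂ) : normOne (A * B) ≤ normOne A * normOne B := by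
  refine normOne_le (mul_nonneg (normOne_nonneg A) (normOne_nonneg B)) fun j => ?_
  calc ∑ i, ‖(A * B) i j‖ ≤ ∑ i, ∑ l, ‖A i l‖ * ‖B l j‖ := by
        refine Finset.sum_le_sum fun i _ => ?_
        rw [Matrix.mul_apply]
        exact (norm_sum_le _ _).trans (Finset.sum_le_sum fun l _ => norm_mul_le _ _)
    _ = ∑ l, (∑ i, ‖A i l‖) * ‖B l j‖ := by
        rw [Finset.sum_comm]
        simp_rw [Finset.sum_mul]
    _ ≤ ∑ l, normOne A * ‖B l j‖ := Finset.sum_le_sum fun l _ =>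
        mul_le_mul_of_nonneg_right (sum_col_le_normOne A l) (norm_nonneg _)
    _ = normOne A * ∑ l, ‖B l j‖ := by rw [Finset.mul_sum]
    _ ≤ _ := mul_le_mul_of_nonneg_left (sum_col_le_normOne B j) (normOne_nonneg A)

theorem normOne_one_le : normOne (1 : Matrix (Fin k) (Fin k) ℂ) ≤ 1 := by
  refine normOne_le zero_le_one fun j => ?_
  simp [Matrix.one_apply, apply_ite]

theorem normOne_prodDesc_le {F : ℕ → Matrix (Fin k) (Fin k) ℂ} {β : ℝ} (hβ : 0 ≤ β) {a b : ℕ}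
    (hab : a ≤ b) (h : ∀ n, normOne (F n) ≤ β) : normOne (prodDesc F a b) ≤ β ^ (b - a) := by
  induction b, hab using Nat.le_induction with
  | base => rw [prodDesc_self, Nat.sub_self, pow_zero]; exact normOne_one_le
  | succ n hn ih =>
    rw [prodDesc_succ _ hn, Nat.succ_sub hn, pow_succ, mul_comm (β ^ _)]
    exact (normOne_mul_le _ _).trans (mul_le_mul (h n) ih (normOne_nonneg _) hβ)

theorem sign_mul_eq_abs_le (a x : ℝ) (hx : 0 ≤ x) : |(SignType.sign a : ℝ) * x| ≤ x := by
  rw [abs_mul, abs_of_nonneg hx]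
  refine mul_le_of_le_one_left hx ?_
  rcases lt_trichotomy a 0 with h | h | h
  · rw [sign_neg h]; simp
  · rw [h]; simp
  · rw [sign_pos h]; simp

theorem abs_truncReal_le (a ε : ℝ) : |truncReal a ε| ≤ |a| := by
  rw [truncReal, mul_assoc]
  set e := ⌈lg ε⁻¹⌉
  have h2 : (0 : ℝ) < 2 ^ e := by positivity
  have h3 : (0 : ℝ) < 2 ^ (-e) := by positivity
  have h4 : (2 : ℝ) ^ e * 2 ^ (-e) = 1 := by rw [← zpow_add₀ two_ne_zero]; simp
  have h5 : (0 : ℝ) ≤ (⌊(2 : ℝ) ^ e * |a|⌋ : ℝ) := by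
    exact_mod_cast Int.floor_nonneg.2 (by positivity)
  refine (sign_mul_eq_abs_le _ _ (by positivity)).trans ?_
  calc (⌊(2 : ℝ) ^ e * |a|⌋ : ℝ) * 2 ^ (-e) ≤ (2 ^ e * |a|) * 2 ^ (-e) :=
        mul_le_mul_of_nonneg_right (Int.floor_le _) h3.le
    _ = |a| * (2 ^ e * 2 ^ (-e)) := by ring
    _ = |a| := by rw [h4, mul_one]

/-- Truncation toward zero decreases the norm. -/
theorem normOne_truncMat_le (A : Matrix (Fin k) (Fin k) ℂ) (ε : ℝ) :
    normOne (truncMat A ε) ≤ normOne A := by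
  refine normOne_le (normOne_nonneg A) fun j => (Finset.sum_le_sum fun i _ => ?_).trans
    (sum_col_le_normOne A j)
  rw [Complex.norm_def, Complex.norm_def]
  refine Real.sqrt_le_sqrt ?_
  rw [Complex.normSq_apply, Complex.normSq_apply, ← sq, ← sq, ← sq, ← sq]
  exact add_le_add (sq_le_sq.2 (abs_truncReal_le _ _)) (sq_le_sq.2 (abs_truncReal_le _ _))

/-- A truncated quotient of integers. -/
theorem truncReal_eq_tdiv {a ε : ℝ} {e : ℕ} (he : ⌈lg ε⁻¹⌉ = e) {Y D : ℤ} (hD : 0 < D)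
    (ha : 2 ^ e * a = (Y : ℝ) / D) : truncReal a ε = (Y.tdiv D : ℤ) * (2 : ℝ) ^ (-(e : ℤ)) := by
  have hD' : (0 : ℝ) < D := by exact_mod_cast hD
  have h2 : (0 : ℝ) < 2 ^ e := by positivity
  rw [truncReal, he]
  congr 1
  have h3 : (2 : ℝ) ^ (e : ℤ) * |a| = (|Y| : ℤ) / (D : ℤ) := by
    rw [zpow_natCast, ← abs_of_pos h2, ← abs_mul, ha, abs_div, abs_of_pos hD', Int.cast_abs]
  have h4 : ⌊(2 : ℝ) ^ (e : ℤ) * |a|⌋ = |Y| / D := by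
    rw [h3]
    obtain ⟨n, rfl⟩ := Int.eq_ofNat_of_zero_le hD.le
    rw [Int.cast_natCast, Int.floor_div_natCast, Int.floor_intCast]
  have h5 : SignType.sign a = SignType.sign Y := by
    have : SignType.sign ((2 : ℝ) ^ e * a) = SignType.sign ((Y : ℝ) / D) := by rw [ha]
    rw [sign_mul, sign_pos h2, one_mul, div_eq_mul_inv, sign_mul, sign_pos (inv_pos.2 hD'),
      mul_one] at this
    rw [this]
    rcases lt_trichotomy Y 0 with h | h | h
    · rw [sign_neg h, sign_neg (by exact_mod_cast h)]
    · rw [h]; simp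
    · rw [sign_pos h, sign_pos (by exact_mod_cast h)]
  rw [h4, h5]
  rcases lt_trichotomy Y 0 with h | h | h
  · rw [sign_neg h, abs_of_neg h, ← Int.tdiv_eq_ediv_of_nonneg (by omega), Int.neg_tdiv]
    push_cast
    simp
  · rw [h]; simp
  · rw [sign_pos h, abs_of_pos h, Int.tdiv_eq_ediv_of_nonneg h.le]; simp

end Norm

/-! ### The matrices `B(n)` and their products -/

namespace DiffEq

variable {E : DiffEq} {ζ : EvalPoint}

theorem toComplex_b_ne_zero (h : E.IsOrdinary) (n : ℕ) : GaussianInt.toComplex (E.b 0 n) ≠ 0 := by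
  rw [Ne, GaussianInt.toComplex_eq_zero]
  exact b_zero_ne_zero h n

theorem hatB_map (h : E.IsOrdinary) (hden : 0 < ζ.den) (n : ℕ) :
    (E.hatB ζ n).map GaussianInt.toComplex =
      ((ζ.den : ℂ) * GaussianInt.toComplex (E.b 0 n)) • E.B ζ n := by
  have h0 := toComplex_b_ne_zero h n
  have h1 : (ζ.den : ℂ) ≠ 0 := by exact_mod_cast hden.ne'
  ext i j : 1
  rw [Matrix.map_apply, Matrix.smul_apply, hatB, B, Matrix.of_apply, Matrix.of_apply, smul_eq_mul,
    EvalPoint.value]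
  split_ifs
  · simp
  · simp
  · simp
  · rw [map_neg, map_mul]; field_simp
  · rw [map_mul]; field_simp
  · simp

theorem hatP_map (h : E.IsOrdinary) (hden : 0 < ζ.den) {a b : ℕ} (hab : a ≤ b) :
    ∃ c : ℂ, c ≠ 0 ∧ (E.hatP ζ a b).map GaussianInt.toComplex = c • E.P ζ a b := by
  induction b, hab using Nat.le_induction with
  | base =>
    refine ⟨1, one_ne_zero, ?_⟩
    rw [hatP, P, prodDesc_self, prodDesc_self, one_smul]
    exact Matrix.map_one _ (map_zero _) (map_one _)
  | succ n hn ih =>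
    obtain ⟨c, hc, ih⟩ := ih
    refine ⟨(ζ.den : ℂ) * GaussianInt.toComplex (E.b 0 n) * c, ?_, ?_⟩
    · have h1 : (ζ.den : ℂ) ≠ 0 := by exact_mod_cast hden.ne'
      exact mul_ne_zero (mul_ne_zero h1 (toComplex_b_ne_zero h n)) hc
    · rw [hatP, P] at ih ⊢
      rw [prodDesc_succ _ hn, prodDesc_succ _ hn]
      rw [← RingHom.mapMatrix_apply] at ih ⊢
      rw [map_mul, ih, RingHom.mapMatrix_apply, hatB_map h hden, Matrix.smul_mul, Matrix.mul_smul,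
        smul_smul]

theorem P_last (a b : ℕ) (hab : a ≤ b) (i : Fin (E.s + 1)) :
    E.P ζ a b i (Fin.last E.s) = if i = Fin.last E.s then 1 else 0 := by
  induction b, hab using Nat.le_induction generalizing i with
  | base => rw [P, prodDesc_self, Matrix.one_apply]
  | succ n hn ih =>
    rw [P] at ih ⊢
    rw [prodDesc_succ _ hn, Matrix.mul_apply]
    simp only [ih, mul_ite, mul_one, mul_zero, Finset.sum_ite_eq', Finset.mem_univ, if_true]
    rw [B, Matrix.of_apply]
    simp [Fin.ext_iff]

theorem hatP_last_ne_zero (h : E.IsOrdinary) (hden : 0 < ζ.den) {a b : ℕ} (hab : a ≤ b) :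
    E.hatP ζ a b (Fin.last E.s) (Fin.last E.s) ≠ 0 := by
  obtain ⟨c, hc, e⟩ := hatP_map h hden hab
  have := congrFun (congrFun e (Fin.last E.s)) (Fin.last E.s)
  rw [Matrix.map_apply, Matrix.smul_apply, P_last a b hab, if_pos rfl, smul_eq_mul, mul_one] at this
  intro h0
  rw [h0, map_zero] at this
  exact hc this.symm

/-- The last entry of the matrix computed by binary splitting is the common denominator of its
entries. -/
theorem inv_smul_hatP (h : E.IsOrdinary) (hden : 0 < ζ.den) {a b : ℕ} (hab : a ≤ b) :
    (GaussianInt.toComplex (E.hatP ζ a b (Fin.last E.s) (Fin.last E.s)))⁻¹ •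
      (E.hatP ζ a b).map GaussianInt.toComplex = E.P ζ a b := by
  obtain ⟨c, hc, e⟩ := hatP_map h hden hab
  have := congrFun (congrFun e (Fin.last E.s)) (Fin.last E.s)
  rw [Matrix.map_apply, Matrix.smul_apply, P_last a b hab, if_pos rfl, smul_eq_mul, mul_one] at this
  rw [this, e, smul_smul, inv_mul_cancel₀ hc, one_smul]

theorem tildeQ_eq (h : E.IsOrdinary) (hden : 0 < ζ.den) (p N Δ : ℕ) (M : ℝ) (q : ℕ) :
    E.tildeQ ζ p N Δ M q = truncMat (E.P ζ (q * N / Δ) ((q + 1) * N / Δ))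
      (1 / (2 * Δ) * M ^ (-(Δ : ℤ) + 1) * (2 : ℝ) ^ (-(p : ℤ))) := by
  have hab : q * N / Δ ≤ (q + 1) * N / Δ :=
    Nat.div_le_div_right (Nat.mul_le_mul_right _ (Nat.le_succ q))
  rw [tildeQ, ← inv_smul_hatP h hden hab]
  rfl

theorem normOne_tildeP_le (h : E.IsOrdinary) (hden : 0 < ζ.den) {p N Δ : ℕ} {M : ℝ} (hM : 0 ≤ M)
    {q : ℕ} (hP : ∀ m < q, normOne (E.P ζ (m * N / Δ) ((m + 1) * N / Δ)) ≤ M) :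
    normOne (E.tildeP ζ p N Δ M q) ≤ M ^ q := by
  induction q with
  | zero => rw [tildeP, pow_zero]; exact normOne_one_le
  | succ q ih =>
    rw [tildeP, pow_succ']
    refine (normOne_truncMat_le _ _).trans ((normOne_mul_le _ _).trans ?_)
    refine mul_le_mul ?_ (ih fun m hm => hP m (hm.trans (Nat.lt_succ_self q))) (normOne_nonneg _) hM
    rw [tildeQ_eq h hden]
    exact (normOne_truncMat_le _ _).trans (hP q (Nat.lt_succ_self q))

/-- Apart from the entries `1` of the last row, a column of `B(n)` contains at most one entry
`ζ b_j(n) / b_0(n)` (up to sign) and one entry `ζ`. -/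
theorem normOne_B_le (hr : 1 ≤ E.r) (hrs : E.r ≤ E.s) {c R : ℝ} (hc : ‖ζ.value‖ ≤ c) (hR : 0 ≤ R)
    (n : ℕ) (hb : ∀ j, 1 ≤ j → j ≤ E.s →
      ‖GaussianInt.toComplex (E.b j n) / GaussianInt.toComplex (E.b 0 n)‖ ≤ R) :
    normOne (E.B ζ n) ≤ c * (R + 1) + 1 := by
  have hc0 : 0 ≤ c := (norm_nonneg _).trans hc
  refine normOne_le (by positivity) fun j => ?_
  -- each column has at most one entry in each of the rows `s`, `s - 1` and `j - 1`
  calc ∑ i, ‖E.B ζ n i j‖ ≤ ∑ i : Fin (E.s + 1), ((if i = Fin.last E.s then 1 else 0) +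
        ((if (i : ℕ) = E.s - 1 then c * R else 0) + if (j : ℕ) = i + 1 then c else 0)) := by
        refine Finset.sum_le_sum fun i _ => ?_
        have t1 : (0 : ℝ) ≤ if (i : ℕ) = E.s - 1 then c * R else 0 := by split_ifs <;> positivity
        have t2 : (0 : ℝ) ≤ if (j : ℕ) = i + 1 then c else 0 := by split_ifs <;> positivity
        have t3 : (0 : ℝ) ≤ if i = Fin.last E.s then 1 else 0 := by split_ifs <;> norm_num
        have u1 : (i : ℕ) = E.s - 1 → c * R ≤ if (i : ℕ) = E.s - 1 then c * R else 0 :=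
          fun g => (if_pos g).ge
        have u2 : (j : ℕ) = i + 1 → c ≤ if (j : ℕ) = i + 1 then c else 0 := fun g => (if_pos g).ge
        have u3 : (i : ℕ) = E.s → (1 : ℝ) ≤ if i = Fin.last E.s then 1 else 0 :=
          fun g => (if_pos (Fin.ext g)).ge
        generalize (if (i : ℕ) = E.s - 1 then c * R else 0) = x1 at t1 u1 ⊢
        generalize (if (j : ℕ) = i + 1 then c else 0) = x2 at t2 u2 ⊢
        generalize (if i = Fin.last E.s then (1 : ℝ) else 0) = x3 at t3 u3 ⊢
        rw [B, Matrix.of_apply]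
        split_ifs with g1 g2 g3 g4 g5
        · rw [norm_one]; linarith [u3 g1]
        · rw [norm_zero]; positivity
        · rw [norm_zero]; positivity
        · have := hb (E.s - j) (by omega) (by omega)
          rw [norm_mul, norm_neg]
          have := mul_le_mul hc this (norm_nonneg _) hc0
          linarith [u1 g4]
        · linarith [u2 g5]
        · rw [norm_zero]; positivity
    _ = (1 + ((∑ i : Fin (E.s + 1), if (i : ℕ) = E.s - 1 then c * R else 0) +
          ∑ i : Fin (E.s + 1), if (j : ℕ) = i + 1 then c else 0)) := by
        rw [Finset.sum_add_distrib, Finset.sum_add_distrib]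
        simp
    _ ≤ 1 + (c * R + c) := by
        have key : ∀ (p : ℕ → Prop) [DecidablePred p] (x : ℝ), 0 ≤ x →
            (∀ a b, p a → p b → a = b) →
            (∑ i : Fin (E.s + 1), if p i then x else 0) ≤ x := by
          intro p _ x hx hp
          rw [← Finset.sum_filter, Finset.sum_const, nsmul_eq_mul]
          refine mul_le_of_le_one_left hx ?_
          have : (Finset.univ.filter fun i : Fin (E.s + 1) => p i).card ≤ 1 :=
            Finset.card_le_one.2 fun a ha b hb => Fin.ext
              (hp _ _ (Finset.mem_filter.1 ha).2 (Finset.mem_filter.1 hb).2)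
          exact_mod_cast this
        have k1 := key (fun i => i = E.s - 1) (c * R) (by positivity) (fun a b ha hb => by omega)
        have k2 := key (fun i => (j : ℕ) = i + 1) c hc0 (fun a b ha hb => by omega)
        linarith
    _ = _ := by ring

theorem norm_b_le (n : ℕ) {j : ℕ} (hj : j ≤ E.s) {σ : ℝ}
    (hσ : ∑ k ∈ Finset.range (E.r + 1), ‖GaussianInt.toComplex (E.a k j)‖ ≤ σ) (hr : 1 ≤ E.r) :
    ‖GaussianInt.toComplex (E.b j n)‖ ≤ ((E.r + E.s) ^ E.r : ℕ) * σ * ((n + 1) ^ E.r : ℕ) := by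
  have hx : |((n : ℤ) + E.r - j)| ≤ (((E.r + E.s) * (n + 1) : ℕ) : ℤ) := by
    have : E.r + E.s + n ≤ (E.r + E.s) * (n + 1) := by nlinarith
    rw [abs_le]; omega
  have hone : (1 : ℝ) ≤ (((E.r + E.s) * (n + 1) : ℕ) : ℝ) := by
    have : 1 ≤ (E.r + E.s) * (n + 1) := Nat.mul_pos (by omega) (by omega)
    exact_mod_cast this
  rw [b, map_sum]
  calc _ ≤ ∑ k ∈ Finset.range (E.r + 1), ‖GaussianInt.toComplex (E.a k j)‖ *
        (((E.r + E.s) * (n + 1) : ℕ) : ℝ) ^ E.r := by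
        refine (norm_sum_le _ _).trans (Finset.sum_le_sum fun k hk => ?_)
        rw [map_mul, norm_mul]
        refine mul_le_mul_of_nonneg_left ?_ (norm_nonneg _)
        have e : GaussianInt.toComplex ((((n : ℤ) + E.r - j) ^ k : ℤ) : GaussianInt) =
          (((((n : ℤ) + E.r - j) ^ k : ℤ) : ℝ) : ℂ) := by simp
        rw [e, Complex.norm_real, Real.norm_eq_abs, Int.cast_pow, abs_pow]
        have hx' : |(((n : ℤ) + E.r - j : ℤ) : ℝ)| ≤ (((E.r + E.s) * (n + 1) : ℕ) : ℝ) := by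
          exact_mod_cast hx
        calc _ ≤ (((E.r + E.s) * (n + 1) : ℕ) : ℝ) ^ k := pow_le_pow_left₀ (abs_nonneg _) hx' k
          _ ≤ _ := pow_le_pow_right₀ hone (Nat.lt_succ_iff.1 (Finset.mem_range.1 hk))
    _ = (∑ k ∈ Finset.range (E.r + 1), ‖GaussianInt.toComplex (E.a k j)‖) *
        (((E.r + E.s) * (n + 1) : ℕ) : ℝ) ^ E.r := by rw [Finset.sum_mul]
    _ ≤ σ * (((E.r + E.s) * (n + 1) : ℕ) : ℝ) ^ E.r := mul_le_mul_of_nonneg_right hσ (by positivity)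
    _ = _ := by push_cast; rw [mul_pow]; ring

theorem le_norm_b_zero (h : E.IsOrdinary) (n : ℕ) :
    ‖GaussianInt.toComplex (E.a E.r 0)‖ * ((n + 1) ^ E.r : ℕ) ≤ ‖GaussianInt.toComplex (E.b 0 n)‖ := by
  rw [b_zero h, map_mul, norm_mul, map_natCast, Complex.norm_natCast]
  exact mul_le_mul_of_nonneg_left (by exact_mod_cast pow_le_descFactorial n E.r) (norm_nonneg _)

end DiffEq

/-! ### Parameters of the algorithm -/

namespace GaussianInt

theorem norm_le_abs_add_abs (z : GaussianInt) : ‖toComplex z‖ ≤ ((|z.re| + |z.im| : ℤ) : ℝ) := by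
  have := Complex.norm_le_abs_re_add_abs_im (toComplex z)
  rw [← intCast_re, ← intCast_im] at this
  push_cast
  exact this

theorem abs_re_le_norm (z : GaussianInt) : ((|z.re| : ℤ) : ℝ) ≤ ‖toComplex z‖ := by
  have := Complex.abs_re_le_norm (toComplex z)
  rw [← intCast_re] at this
  push_cast
  exact this

theorem abs_im_le_norm (z : GaussianInt) : ((|z.im| : ℤ) : ℝ) ≤ ‖toComplex z‖ := by
  have := Complex.abs_im_le_norm (toComplex z)
  rw [← intCast_im] at this
  push_cast
  exact this

end GaussianInt

/-- A sum of upper bounds is an upper bound for each of its terms. -/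
theorem le_sum_sum_range {m n : ℕ} {f : ℕ → ℕ → ℤ} (hf : ∀ k j, 0 ≤ f k j) {j : ℕ} (hj : j < n) :
    ∑ k ∈ Finset.range m, f k j ≤ ∑ k ∈ Finset.range m, ∑ j ∈ Finset.range n, f k j :=
  Finset.sum_le_sum fun k _ =>
    Finset.single_le_sum (f := fun j => f k j) (fun _ _ => hf _ _) (Finset.mem_range.2 hj)

namespace MulAlgo

open Run

variable {μ : MulAlgo} {E : DiffEq} {ζ : EvalPoint}

theorem val_div {X D : ℤ} (hμ : μ.Regular) (hD : 0 < D) (hX : 0 ≤ X) : (μ.div X D).val = X / D :=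
  (div_val_fits hD hX (hμ.rate (X := 100 * (bits X + bits D)) (by have := one_le_bits X; omega))
    (Nat.le_add_right _ _) (Nat.le_add_left _ _) le_rfl).1

theorem val_truncDiv {X D : ℤ} (hμ : μ.Regular) (hD : 0 < D) : (μ.truncDiv X D).val = X.tdiv D :=
  (truncDiv_val_fits hD (hμ.rate (X := 100 * (bits X + bits D)) (by have := one_le_bits X; omega))
    (Nat.le_add_right _ _) (Nat.le_add_left _ _) le_rfl).1

theorem val_ratioBound (hμ : μ.Regular) (z : GaussianInt) {d : ℤ} (hd : 0 < d) :
    (μ.ratioBound z d).val = (|z.re| + |z.im|) / d + 1 := by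
  rw [ratioBound]
  simp only [val_bind, val_absVal, val_add]
  rw [val_div hμ hd (add_nonneg (abs_nonneg _) (abs_nonneg _))]

theorem ratioBound_nonneg (hμ : μ.Regular) (z : GaussianInt) {d : ℤ} (hd : 0 < d) :
    0 ≤ (μ.ratioBound z d).val := by
  rw [val_ratioBound hμ z hd]
  have := Int.ediv_nonneg (add_nonneg (abs_nonneg z.re) (abs_nonneg z.im)) hd.le
  omega

theorem norm_le_ratioBound (hμ : μ.Regular) (z : GaussianInt) {d : ℤ} (hd : 0 < d) :
    ‖GaussianInt.toComplex z‖ ≤ d * ((μ.ratioBound z d).val : ℝ) := by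
  refine z.norm_le_abs_add_abs.trans ?_
  rw [val_ratioBound hμ z hd]
  have := Int.lt_ediv_add_one_mul_self (|z.re| + |z.im|) hd
  rw [mul_comm]
  exact_mod_cast this.le

theorem ratioBound_le (hμ : μ.Regular) (z : GaussianInt) {d : ℤ} (hd : 0 < d) :
    ((μ.ratioBound z d).val : ℝ) ≤ 2 * ‖GaussianInt.toComplex z‖ / d + 1 := by
  have hd' : (0 : ℝ) < d := by exact_mod_cast hd
  rw [val_ratioBound hμ z hd]
  push_cast
  refine add_le_add_left ?_ 1
  rw [le_div_iff₀ hd']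
  have h1 := Int.ediv_mul_le (|z.re| + |z.im|) hd.ne'
  have h2 : (((|z.re| + |z.im|) / d : ℤ) : ℝ) * d ≤ ((|z.re| + |z.im| : ℤ) : ℝ) := by exact_mod_cast h1
  have h3 := z.abs_re_le_norm
  have h4 := z.abs_im_le_norm
  push_cast at h2 h3 h4 ⊢
  linarith

/-- The value of `evalNormBound`; `d` is the larger of the moduli of the real and imaginary parts
of `a_r(0)`. -/
theorem val_evalNormBound {d : ℤ} (hd : d = max |(E.a E.r 0).re| |(E.a E.r 0).im|) :
    (μ.evalNormBound E ζ).val = (μ.ratioBound ζ.num ζ.den).val * ((((E.r + E.s) ^ E.r : ℕ) : ℤ) *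
      (∑ k ∈ Finset.range (E.r + 1), ∑ j ∈ Finset.range (E.s + 1),
        (μ.ratioBound (E.a k j) d).val) + 1) + 1 := by
  rw [evalNormBound]
  simp only [val_bind, val_absVal, val_lt, val_copy, val_add, val_mul, val_pow, val_fold val_add]
  have hd' : (if decide (|(E.a E.r 0).re| < |(E.a E.r 0).im|) = true then |(E.a E.r 0).im|
      else |(E.a E.r 0).re|) = d := by
    rw [hd]
    simp only [decide_eq_true_eq]
    split_ifs <;> omega
  rw [hd', zero_add, Finset.sum_range]
  simp only [zero_add, Finset.sum_range]
  push_cast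
  rfl

variable {S : ℕ} {A Z δ : ℝ}

theorem max_abs_pos {z : GaussianInt} (hz : z ≠ 0) : 0 < max |z.re| |z.im| := by
  by_contra hcon
  have h1 := abs_nonneg z.re
  have h2 := abs_nonneg z.im
  have h3 := le_max_left |z.re| |z.im|
  have h4 := le_max_right |z.re| |z.im|
  exact hz (Zsqrtd.ext (abs_eq_zero.1 (by omega)) (abs_eq_zero.1 (by omega)))

theorem normOne_B_le_evalNormBound (hμ : μ.Regular) (h : Admissible S A Z δ E ζ) (n : ℕ) :
    normOne (E.B ζ n) ≤ ((μ.evalNormBound E ζ).val : ℝ) := by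
  rw [val_evalNormBound rfl]
  have hz := h.ordinary.indicial.1
  have hd := max_abs_pos hz
  set d := max |(E.a E.r 0).re| |(E.a E.r 0).im| with hdd
  set s := ∑ k ∈ Finset.range (E.r + 1), ∑ j ∈ Finset.range (E.s + 1),
    (μ.ratioBound (E.a k j) d).val with hs
  have hs0 : 0 ≤ s := Finset.sum_nonneg fun k _ => Finset.sum_nonneg fun j _ =>
    ratioBound_nonneg hμ _ hd
  have hs0' : (0 : ℝ) ≤ s := by exact_mod_cast hs0
  have hden : (0 : ℝ) < ζ.den := by exact_mod_cast h.den_pos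
  have hdn : (d : ℝ) ≤ ‖GaussianInt.toComplex (E.a E.r 0)‖ := by
    rw [hdd]
    push_cast
    have h1 := (E.a E.r 0).abs_re_le_norm
    have h2 := (E.a E.r 0).abs_im_le_norm
    push_cast at h1 h2
    exact max_le h1 h2
  have hb0 := norm_pos_iff.2 (DiffEq.toComplex_b_ne_zero h.ordinary n)
  push_cast
  have key := DiffEq.normOne_B_le (E := E) (ζ := ζ) h.one_le_r h.r_le_s
    (c := ((μ.ratioBound ζ.num ζ.den).val : ℝ)) (R := (((E.r + E.s) ^ E.r : ℕ) : ℝ) * s) ?_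
    (by positivity) n ?_
  · push_cast at key
    exact key
  · rw [EvalPoint.value, norm_div, div_le_iff₀ (by simpa using hden.ne')]
    have := norm_le_ratioBound hμ ζ.num h.den_pos
    have e : ‖(ζ.den : ℂ)‖ = ζ.den := by
      rw [Complex.norm_intCast, abs_of_pos hden]
    rwa [e, mul_comm]
  · intro j _ hj
    rw [norm_div, div_le_iff₀ hb0]
    have hσ : ∑ k ∈ Finset.range (E.r + 1), ‖GaussianInt.toComplex (E.a k j)‖ ≤
        ‖GaussianInt.toComplex (E.a E.r 0)‖ * s := by
      calc _ ≤ ∑ k ∈ Finset.range (E.r + 1), (d : ℝ) * ((μ.ratioBound (E.a k j) d).val : ℝ) :=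
            Finset.sum_le_sum fun k _ => norm_le_ratioBound hμ _ hd
        _ = d * ((∑ k ∈ Finset.range (E.r + 1), (μ.ratioBound (E.a k j) d).val : ℤ) : ℝ) := by
            push_cast; rw [Finset.mul_sum]
        _ ≤ d * (s : ℝ) := by
            refine mul_le_mul_of_nonneg_left ?_ (by exact_mod_cast hd.le)
            exact_mod_cast le_sum_sum_range (f := fun k j => (μ.ratioBound (E.a k j) d).val)
              (fun k j => ratioBound_nonneg hμ _ hd) (Nat.lt_succ_of_le hj)
        _ ≤ _ := mul_le_mul_of_nonneg_right hdn hs0'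
    refine (DiffEq.norm_b_le n hj hσ h.one_le_r).trans ?_
    have := mul_le_mul_of_nonneg_left (DiffEq.le_norm_b_zero h.ordinary n)
      (show (0 : ℝ) ≤ (((E.r + E.s) ^ E.r : ℕ) : ℝ) * s by positivity)
    calc _ = (((E.r + E.s) ^ E.r : ℕ) : ℝ) * s *
          (‖GaussianInt.toComplex (E.a E.r 0)‖ * ((n + 1) ^ E.r : ℕ)) := by ring
      _ ≤ _ := this

theorem one_le_evalNormBound (hμ : μ.Regular) (h : Admissible S A Z δ E ζ) :
    1 ≤ (μ.evalNormBound E ζ).val := by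
  rw [val_evalNormBound rfl]
  have hd := max_abs_pos h.ordinary.indicial.1
  have h1 := ratioBound_nonneg hμ ζ.num h.den_pos
  have h2 : 0 ≤ ∑ k ∈ Finset.range (E.r + 1), ∑ j ∈ Finset.range (E.s + 1),
    (μ.ratioBound (E.a k j) (max |(E.a E.r 0).re| |(E.a E.r 0).im|)).val :=
    Finset.sum_nonneg fun k _ => Finset.sum_nonneg fun j _ => ratioBound_nonneg hμ _ hd
  have h3 : (0 : ℤ) ≤ (((E.r + E.s) ^ E.r : ℕ) : ℤ) := Int.natCast_nonneg _
  have := mul_nonneg h1 (add_nonneg (mul_nonneg h3 h2) zero_le_one)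
  linarith

theorem evalNormBound_le (hμ : μ.Regular) (h : Admissible S A Z δ E ζ) :
    ((μ.evalNormBound E ζ).val : ℝ) ≤
      (2 * Z + 1) * (((2 * S) ^ S : ℕ) * ((S + 1) * ((S + 1) * (4 * A + 1))) + 1) + 1 := by
  rw [val_evalNormBound rfl]
  have hz := h.ordinary.indicial.1
  have hd := max_abs_pos hz
  set d := max |(E.a E.r 0).re| |(E.a E.r 0).im| with hdd
  have hd' : (0 : ℝ) < d := by exact_mod_cast hd
  have hden : (0 : ℝ) < ζ.den := by exact_mod_cast h.den_pos
  have hr := h.one_le_r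
  have hrs := h.r_le_s
  have hS := h.s_le
  have hnd : ‖GaussianInt.toComplex (E.a E.r 0)‖ ≤ 2 * d := by
    refine (GaussianInt.norm_le_abs_add_abs _).trans ?_
    have h1 : |(E.a E.r 0).re| ≤ d := le_max_left _ _
    have h2 : |(E.a E.r 0).im| ≤ d := le_max_right _ _
    have : |(E.a E.r 0).re| + |(E.a E.r 0).im| ≤ 2 * d := by omega
    exact_mod_cast this
  have hA : 0 ≤ A := by
    have := h.coeff_le E.r le_rfl 0 (Nat.zero_le _)
    have h0 : 0 < ‖GaussianInt.toComplex (E.a E.r 0)‖ :=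
      norm_pos_iff.2 (by rwa [Ne, GaussianInt.toComplex_eq_zero])
    by_contra hcon
    nlinarith
  have hZ : 0 ≤ Z := (norm_nonneg _).trans h.value_le
  have e1 : ∀ k ∈ Finset.range (E.r + 1), ∀ j ∈ Finset.range (E.s + 1),
      ((μ.ratioBound (E.a k j) d).val : ℝ) ≤ 4 * A + 1 := by
    intro k hk j hj
    refine (ratioBound_le hμ _ hd).trans (add_le_add_left ?_ 1)
    rw [div_le_iff₀ hd']
    have h1 := h.coeff_le k (Nat.lt_succ_iff.1 (Finset.mem_range.1 hk)) j
      (Nat.lt_succ_iff.1 (Finset.mem_range.1 hj))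
    have h2 := mul_le_mul_of_nonneg_left hnd hA
    linarith
  have e2 : ∑ k ∈ Finset.range (E.r + 1), ∑ j ∈ Finset.range (E.s + 1),
      ((μ.ratioBound (E.a k j) d).val : ℝ) ≤ (S + 1) * ((S + 1) * (4 * A + 1)) := by
    calc _ ≤ ∑ k ∈ Finset.range (E.r + 1), ∑ j ∈ Finset.range (E.s + 1), (4 * A + 1) :=
          Finset.sum_le_sum fun k hk => Finset.sum_le_sum fun j hj => e1 k hk j hj
      _ = (E.r + 1) * ((E.s + 1) * (4 * A + 1)) := by
          simp only [Finset.sum_const, Finset.card_range, nsmul_eq_mul]; push_cast; ring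
      _ ≤ _ := by
          have h1 : (E.r : ℝ) ≤ S := by exact_mod_cast hrs.trans hS
          have h2 : (E.s : ℝ) ≤ S := by exact_mod_cast hS
          gcongr
  have e3 : (((E.r + E.s) ^ E.r : ℕ) : ℝ) ≤ ((2 * S) ^ S : ℕ) := by
    exact_mod_cast (Nat.pow_le_pow_left (by omega) _).trans (Nat.pow_le_pow_right (by omega) (by omega))
  have e4 : ((μ.ratioBound ζ.num ζ.den).val : ℝ) ≤ 2 * Z + 1 := by
    refine (ratioBound_le hμ _ h.den_pos).trans (add_le_add_left ?_ 1)
    have h1 := h.value_le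
    rw [EvalPoint.value, norm_div, Complex.norm_intCast, abs_of_pos hden] at h1
    rw [mul_div_assoc]
    linarith
  have e5 : (0 : ℝ) ≤ ((μ.ratioBound ζ.num ζ.den).val : ℝ) := by
    exact_mod_cast ratioBound_nonneg hμ _ h.den_pos
  have e6 : 0 ≤ ∑ k ∈ Finset.range (E.r + 1), ∑ j ∈ Finset.range (E.s + 1),
      ((μ.ratioBound (E.a k j) d).val : ℝ) := Finset.sum_nonneg fun k _ =>
    Finset.sum_nonneg fun j _ => by exact_mod_cast ratioBound_nonneg hμ _ hd
  have e7 : (0 : ℝ) ≤ (((E.r + E.s) ^ E.r : ℕ) : ℝ) := Nat.cast_nonneg _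
  have e8 := mul_le_mul e3 e2 e6 (Nat.cast_nonneg _)
  have e9 := mul_le_mul e4 (add_le_add_left e8 1) (add_nonneg (mul_nonneg e7 e6) zero_le_one)
    (e5.trans e4)
  have e10 := add_le_add_left e9 1
  push_cast at e10 ⊢
  exact e10

end MulAlgo

/-! ### Logarithms -/

theorem size_pred_eq_clog {n : ℕ} (hn : 1 ≤ n) : Nat.size (n - 1) = Nat.clog 2 n := by
  refine eq_of_forall_ge_iff fun m => ?_
  rw [Nat.size_le, Nat.clog_le_iff_le_pow (by norm_num)]
  omega

theorem ceil_lg_natCast (n : ℕ) : ⌈lg n⌉ = (Nat.clog 2 n : ℤ) := by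
  rw [lg, ← Nat.cast_ofNat (R := ℝ) (n := 2), Real.ceil_logb_natCast (Nat.cast_nonneg n),
    Int.clog_natCast]

theorem ceil_half_lg (n : ℕ) : ⌈lg n / 2⌉ = (((Nat.clog 2 n + 1) / 2 : ℕ) : ℤ) := by
  have h := ceil_lg_natCast n
  rw [Int.ceil_eq_iff] at h ⊢
  obtain ⟨h1, h2⟩ := h
  set c := Nat.clog 2 n
  have h3 : c ≤ 2 * ((c + 1) / 2) := by omega
  have h4 : 2 * ((c + 1) / 2) ≤ c + 1 := by omega
  have h3' : (c : ℝ) ≤ 2 * (((c + 1) / 2 : ℕ) : ℝ) := by exact_mod_cast h3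
  have h4' : 2 * (((c + 1) / 2 : ℕ) : ℝ) ≤ c + 1 := by exact_mod_cast h4
  rw [Int.cast_natCast] at h1 h2 ⊢
  constructor <;> linarith

/-- The precision of the truncations, for `M = 2 ^ m`. -/
theorem ceil_lg_precision {k Δ p m n : ℕ} (hk : 1 ≤ k) (hΔ : 1 ≤ Δ) {j : ℤ} (hj : j = -n) :
    ⌈lg ((Real.sqrt 2 * k)⁻¹ * (1 / (2 * Δ) * ((2 : ℝ) ^ m) ^ j * (2 : ℝ) ^ (-(p : ℤ))))⁻¹⌉ =
      ((p + (Nat.clog 2 (8 * (k * Δ) ^ 2) + 1) / 2 + n * m : ℕ) : ℤ) := by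
  have hk' : (0 : ℝ) < k := by exact_mod_cast hk
  have hΔ' : (0 : ℝ) < Δ := by exact_mod_cast hΔ
  have h8 : 1 ≤ 8 * (k * Δ) ^ 2 := Nat.one_le_iff_ne_zero.2 (by positivity)
  have e1 : ((Real.sqrt 2 * k)⁻¹ * (1 / (2 * Δ) * ((2 : ℝ) ^ m) ^ j * (2 : ℝ) ^ (-(p : ℤ))))⁻¹ =
      Real.sqrt ((8 * (k * Δ) ^ 2 : ℕ) : ℝ) * (2 : ℝ) ^ (n * m + p) := by
    have : ((8 * (k * Δ) ^ 2 : ℕ) : ℝ) = 2 * (2 * (k * Δ)) ^ 2 := by push_cast; ring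
    rw [this, Real.sqrt_mul (by norm_num), Real.sqrt_sq (by positivity), hj, zpow_neg, zpow_neg,
      zpow_natCast, zpow_natCast, pow_add, mul_comm n m, pow_mul]
    field_simp
  have e2 : lg (Real.sqrt ((8 * (k * Δ) ^ 2 : ℕ) : ℝ) * (2 : ℝ) ^ (n * m + p)) =
      lg ((8 * (k * Δ) ^ 2 : ℕ) : ℝ) / 2 + ((n * m + p : ℕ) : ℝ) := by
    have h0 : (0 : ℝ) < ((8 * (k * Δ) ^ 2 : ℕ) : ℝ) := by exact_mod_cast h8
    rw [lg, lg, Real.logb_mul (Real.sqrt_pos.2 h0).ne' (by positivity), Real.logb_pow,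
      Real.logb_self_eq_one (by norm_num), mul_one, Real.logb, Real.logb, Real.log_sqrt h0.le]
    ring
  rw [e1, e2, Int.ceil_add_natCast, ceil_half_lg _]
  push_cast
  ring

namespace MulAlgo

open Run

variable {μ : MulAlgo} {E : DiffEq} {ζ : EvalPoint}

theorem numBlocks_bounds {p N : ℕ} (hp : 1 ≤ p) :
    N * (E.h ζ + E.r * Nat.clog 2 N) ≤ E.numBlocks ζ p N * p ∧
    E.numBlocks ζ p N * p < N * (E.h ζ + E.r * Nat.clog 2 N) + p := by
  have hp' : (0 : ℚ) < p := by exact_mod_cast hp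
  have e : (N : ℚ) / p * ((E.h ζ : ℚ) + E.r * (Nat.clog 2 N : ℚ)) =
      ((N * (E.h ζ + E.r * Nat.clog 2 N) : ℕ) : ℚ) / p := by push_cast; ring
  rw [DiffEq.numBlocks, e]
  set Y := N * (E.h ζ + E.r * Nat.clog 2 N)
  have h1 := Nat.le_ceil ((Y : ℚ) / p)
  have h2 := Nat.ceil_lt_add_one (show (0 : ℚ) ≤ (Y : ℚ) / p by positivity)
  rw [div_le_iff₀ hp'] at h1
  rw [div_add_one hp'.ne', lt_div_iff₀ hp'] at h2
  exact ⟨by exact_mod_cast h1, by exact_mod_cast h2⟩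

theorem two_le_h : 2 ≤ E.h ζ := by
  have h1 : 1 ≤ E.h₁ := by
    have h0 : bitSize (E.a 0 0) 1 ≤ E.h₁ := by
      rw [DiffEq.h₁]
      refine le_trans ?_ (Finset.le_sup (f := fun k =>
        (Finset.range (E.s + 1)).sup fun j => bitSize (E.a k j) 1)
        (Finset.mem_range.2 (Nat.succ_pos E.r)))
      exact Finset.le_sup (f := fun j => bitSize (E.a 0 j) 1) (Finset.mem_range.2 (Nat.succ_pos E.s))
    exact le_trans (Nat.le_add_left _ _) h0
  have h2 : 1 ≤ ζ.h₂ := Nat.le_add_left _ _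
  rw [DiffEq.h]; omega

theorem one_le_numBlocks {p N : ℕ} (hp : 1 ≤ p) (hN : 1 ≤ N) : 1 ≤ E.numBlocks ζ p N := by
  have h := (numBlocks_bounds (E := E) (ζ := ζ) (N := N) hp).1
  have h2 := two_le_h (E := E) (ζ := ζ)
  by_contra hcon
  have h0 : E.numBlocks ζ p N = 0 := by omega
  rw [h0, zero_mul] at h
  have : 0 < N * (E.h ζ + E.r * Nat.clog 2 N) := Nat.mul_pos hN (by omega)
  omega

theorem val_bitLen_pred {n : ℕ} (hn : 1 ≤ n) :
    (Run.bitLen ((n : ℤ) - 1)).val = (Nat.clog 2 n : ℕ) := by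
  rw [val_bitLen, ← size_pred_eq_clog hn]
  congr 2
  omega

theorem val_evalNumBlocks (hμ : μ.Regular) {p N : ℕ} (hp : 1 ≤ p) (hN : 1 ≤ N) :
    (μ.evalNumBlocks E ζ p N).val = (E.numBlocks ζ p N : ℕ) := by
  obtain ⟨h1, h2⟩ := numBlocks_bounds (E := E) (ζ := ζ) (N := N) hp
  rw [evalNumBlocks]
  simp only [val_bind, val_sub, val_mul, val_add, val_bitLen_pred hN]
  have hp' : (0 : ℤ) < p := by exact_mod_cast hp
  have e : (N : ℤ) * ((E.h ζ : ℤ) + (E.r : ℤ) * (Nat.clog 2 N : ℕ)) =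
    ((N * (E.h ζ + E.r * Nat.clog 2 N) : ℕ) : ℤ) := by push_cast; ring
  rw [e]
  set Y := N * (E.h ζ + E.r * Nat.clog 2 N)
  rw [val_div hμ hp' (by omega)]
  refine le_antisymm ?_ ?_
  · rw [← Int.lt_add_one_iff, Int.ediv_lt_iff_lt_mul hp', add_mul]
    have : (Y : ℤ) ≤ (E.numBlocks ζ p N : ℤ) * p := by exact_mod_cast h1
    linarith
  · rw [Int.le_ediv_iff_mul_le hp']
    have : (E.numBlocks ζ p N : ℤ) * p < Y + p := by exact_mod_cast h2
    linarith

theorem val_evalLgM (hμ : μ.Regular) {N Δ : ℕ} (hN : 1 ≤ N) (hΔ : 1 ≤ Δ) :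
    (μ.evalLgM E ζ N Δ).val =
      ((Nat.size (μ.evalNormBound E ζ).val.natAbs * ((N + Δ - 1) / Δ) : ℕ) : ℤ) := by
  rw [evalLgM]
  simp only [val_bind, val_sub, val_mul, val_add, val_bitLen]
  have hΔ' : (0 : ℤ) < Δ := by exact_mod_cast hΔ
  have e : (N : ℤ) + Δ - 1 = ((N + Δ - 1 : ℕ) : ℤ) := by omega
  rw [e, val_div hμ hΔ' (by omega)]
  push_cast
  rfl

theorem val_evalGuard {Δ : ℕ} (hΔ : 1 ≤ Δ) :
    (μ.evalGuard E Δ).val = (((Nat.clog 2 (8 * ((E.s + 1) * Δ) ^ 2) + 1) / 2 : ℕ) : ℤ) := by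
  rw [evalGuard]
  simp only [val_bind, val_sub, val_mul, val_add, val_shl, val_shr]
  have h8 : 1 ≤ 8 * ((E.s + 1) * Δ) ^ 2 := Nat.one_le_iff_ne_zero.2 (by positivity)
  have e : ((E.s : ℤ) + 1) * Δ * (((E.s : ℤ) + 1) * Δ) * 2 ^ (3 : ℤ).toNat - 1 =
      ((8 * ((E.s + 1) * Δ) ^ 2 : ℕ) : ℤ) - 1 := by
    rw [show (3 : ℤ).toNat = 3 from rfl]
    push_cast
    ring
  rw [e, val_bitLen_pred h8, toNat_one_pow]
  omega

end MulAlgo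

/-! ### Correctness of the main loop -/

/-- Truncation of the quotients of Gaussian integers by a positive integer. -/
theorem truncMat_eq_tdiv {k : ℕ} {A : Matrix (Fin k) (Fin k) ℂ} {ε : ℝ} {e : ℕ}
    (he : ⌈lg ((Real.sqrt 2 * k)⁻¹ * ε)⁻¹⌉ = e) {D : ℤ} (hD : 0 < D) {Y : GMat k}
    (h : (2 ^ e : ℂ) • A = (D : ℂ)⁻¹ • Y.map GaussianInt.toComplex) {Z : GMat k}
    (hZ : ∀ i j, Z i j = ⟨(Y i j).re.tdiv D, (Y i j).im.tdiv D⟩) :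
    Z.map GaussianInt.toComplex = (2 ^ e : ℂ) • truncMat A ε := by
  have h2 : (2 : ℝ) ^ e * (2 : ℝ) ^ (-(e : ℤ)) = 1 := by
    rw [zpow_neg, zpow_natCast, mul_inv_cancel₀ (by positivity)]
  have hpow : ((2 : ℂ) ^ e) = (((2 : ℝ) ^ e : ℝ) : ℂ) := by push_cast; rfl
  ext i j : 1
  have hij : (2 ^ e : ℂ) * A i j = (D : ℂ)⁻¹ * GaussianInt.toComplex (Y i j) :=
    congrFun (congrFun h i) j
  have hDc : (D : ℂ)⁻¹ = (((D : ℝ)⁻¹ : ℝ) : ℂ) := by push_cast; rfl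
  rw [hpow, hDc] at hij
  have hre : (2 : ℝ) ^ e * (A i j).re = ((Y i j).re : ℝ) / D := by
    have := congrArg Complex.re hij
    rw [Complex.re_ofReal_mul, Complex.re_ofReal_mul, ← GaussianInt.intCast_re] at this
    rw [this, div_eq_inv_mul]
  have him : (2 : ℝ) ^ e * (A i j).im = ((Y i j).im : ℝ) / D := by
    have := congrArg Complex.im hij
    rw [Complex.im_ofReal_mul, Complex.im_ofReal_mul, ← GaussianInt.intCast_im] at this
    rw [this, div_eq_inv_mul]
  rw [Matrix.map_apply, Matrix.smul_apply, smul_eq_mul, hZ, truncMat, Matrix.of_apply, hpow,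
    truncReal_eq_tdiv he hD hre, truncReal_eq_tdiv he hD him, GaussianInt.toComplex_def₂]
  apply Complex.ext
  · rw [Complex.re_ofReal_mul]
    change _ = (2 : ℝ) ^ e * (_ * 2 ^ (-(e : ℤ)))
    rw [mul_left_comm, h2, mul_one]
  · rw [Complex.im_ofReal_mul]
    change _ = (2 : ℝ) ^ e * (_ * 2 ^ (-(e : ℤ)))
    rw [mul_left_comm, h2, mul_one]

namespace MulAlgo

open Run

variable {μ : MulAlgo} {E : DiffEq} {ζ : EvalPoint} {k : ℕ}

theorem tdiv_two_pow_of_neg {x : ℤ} (hx : x < 0) (e : ℕ) : -(-x / 2 ^ e) = x.tdiv (2 ^ e) := by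
  rw [← Int.tdiv_eq_ediv_of_nonneg (by omega), Int.neg_tdiv, neg_neg]

theorem val_truncShift_tr (e x : ℤ) : (truncShift.tr e x).val = x.tdiv (2 ^ e.toNat) := by
  rw [truncShift.tr, val_bind, val_lt]
  by_cases h : x < 0
  · rw [if_pos (decide_eq_true h)]
    simp only [val_bind, val_neg, val_shr]
    exact tdiv_two_pow_of_neg h _
  · rw [if_neg (by rw [decide_eq_true_iff]; exact h), val_shr, Int.tdiv_eq_ediv_of_nonneg (by omega)]

theorem val_truncShift (e : ℤ) (A : GMat k) (i j : Fin k) : (truncShift e A).val i j =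
    ⟨(A i j).re.tdiv (2 ^ e.toNat), (A i j).im.tdiv (2 ^ e.toNat)⟩ := by
  rw [truncShift, val_mat, val_gpair, val_truncShift_tr, val_truncShift_tr]

theorem norm_pos_of_ne_zero {w : GaussianInt} (hw : w ≠ 0) : 0 < w.re * w.re + w.im * w.im := by
  by_contra hcon
  have h1 := mul_self_nonneg w.re
  have h2 := mul_self_nonneg w.im
  exact hw (Zsqrtd.ext (mul_self_eq_zero.1 (by omega)) (mul_self_eq_zero.1 (by omega)))

theorem val_truncQuot (hμ : μ.Regular) (e : ℤ) (Q : GMat k) {w : GaussianInt} (hw : w ≠ 0)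
    (i j : Fin k) : (μ.truncQuot e Q w).val i j =
      ⟨((Q i j * star w) * (2 ^ e.toNat : ℤ)).re.tdiv (w.re * w.re + w.im * w.im),
        ((Q i j * star w) * (2 ^ e.toNat : ℤ)).im.tdiv (w.re * w.re + w.im * w.im)⟩ := by
  rw [truncQuot]
  simp only [val_bind, val_mul, val_add, val_neg]
  rw [val_mat]
  simp only [val_bind, val_gpair, val_gmul, val_shl]
  rw [val_truncDiv hμ (norm_pos_of_ne_zero hw), val_truncDiv hμ (norm_pos_of_ne_zero hw)]
  have h : (⟨w.re, -w.im⟩ : GaussianInt) = star w := rfl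
  rw [h]
  generalize Q i j * star w = u
  congr 2
  · rw [Zsqrtd.re_mul, Zsqrtd.re_intCast, Zsqrtd.im_intCast]; ring
  · rw [Zsqrtd.im_mul, Zsqrtd.re_intCast, Zsqrtd.im_intCast]; ring

/-- The truncated quotient of a matrix by one of its entries. -/
theorem map_val_truncQuot (hμ : μ.Regular) {e : ℕ} {ε : ℝ}
    (he : ⌈lg ((Real.sqrt 2 * k)⁻¹ * ε)⁻¹⌉ = e) (Q : GMat k) {w : GaussianInt} (hw : w ≠ 0) :
    (μ.truncQuot e Q w).val.map GaussianInt.toComplex =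
      (2 ^ e : ℂ) • truncMat ((GaussianInt.toComplex w)⁻¹ • Q.map GaussianInt.toComplex) ε := by
  refine truncMat_eq_tdiv he (norm_pos_of_ne_zero hw)
    (Y := Matrix.of fun i j => (Q i j * star w) * (2 ^ (e : ℤ).toNat : ℤ)) ?_
    (fun i j => val_truncQuot hμ e Q hw i j)
  ext i j : 1
  have hw' : GaussianInt.toComplex w ≠ 0 := by rwa [Ne, GaussianInt.toComplex_eq_zero]
  have hD : ((w.re * w.re + w.im * w.im : ℤ) : ℂ) =
      GaussianInt.toComplex w * GaussianInt.toComplex (star w) := by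
    rw [← map_mul]
    have : w * star w = ((w.re * w.re + w.im * w.im : ℤ) : GaussianInt) := by
      ext
      · simp
      · simp; ring
    rw [this, map_intCast]
  have hs : GaussianInt.toComplex (star w) ≠ 0 := by
    intro h0
    rw [h0, mul_zero] at hD
    have := norm_pos_of_ne_zero hw
    exact this.ne' (by exact_mod_cast hD)
  rw [hD, Int.toNat_natCast]
  simp only [Matrix.smul_apply, Matrix.map_apply, Matrix.of_apply, smul_eq_mul, map_mul, map_intCast]
  push_cast
  field_simp

/-- The state of the main loop before the iteration `q`: the matrix `P̃^(q)`, multiplied by a power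
of `2`. Here `M = 2 ^ L`, and `e₀` is the precision of the result. The identity matrix `P̃^(0)` is stored with
the exponent `0`. -/
structure LoopState (E : DiffEq) (ζ : EvalPoint) (p N Δ L e₀ q : ℕ) (st : GMat (E.s + 1) × ℤ) :
    Prop where
  exp : st.2 = ((if q = 0 then 0 else e₀ + (Δ - q) * L : ℕ) : ℤ)
  map : st.1.map GaussianInt.toComplex =
    (2 ^ (if q = 0 then 0 else e₀ + (Δ - q) * L) : ℂ) • E.tildeP ζ p N Δ (2 ^ L) q

theorem val_mainStep (hμ : μ.Regular) {T N Δ L e₀ eQ q : ℕ} (hΔ : 1 ≤ Δ)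
    (st : GMat (E.s + 1) × ℤ) : (μ.mainStep E ζ T N Δ L e₀ eQ q st).val =
      (let Q := E.hatP ζ (q * N / Δ) ((q + 1) * N / Δ)
       let e' := (e₀ : ℤ) + ((Δ : ℤ) - (q + 1)) * L
       ((truncShift (eQ + st.2 - e')
          ((μ.truncQuot eQ Q (Q (Fin.last E.s) (Fin.last E.s))).val * st.1)).val, e')) := by
  have hΔ' : (0 : ℤ) < Δ := by exact_mod_cast hΔ
  have e1 : (μ.div ((q : ℤ) * N) Δ).val = ((q * N / Δ : ℕ) : ℤ) := by
    rw [val_div hμ hΔ' (by positivity)]; push_cast; rfl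
  have e2 : (μ.div (((q : ℤ) + 1) * N) Δ).val = (((q + 1) * N / Δ : ℕ) : ℤ) := by
    rw [val_div hμ hΔ' (by positivity)]; push_cast; rfl
  have hab : q * N / Δ ≤ (q + 1) * N / Δ :=
    Nat.div_le_div_right (Nat.mul_le_mul_right _ (Nat.le_succ q))
  rw [mainStep]
  simp only [val_bind, val_mul, val_add, val_sub, val_matMul, val_copy]
  rw [e1, e2, val_binSplit _ _ _ hab]

theorem LoopState.step (hμ : μ.Regular) (ho : E.IsOrdinary) (hden : 0 < ζ.den)
    {T p N Δ L e₀ q : ℕ} (hΔ : 1 ≤ Δ) (hq : q < Δ)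
    (he₀ : e₀ = p + (Nat.clog 2 (8 * ((E.s + 1) * Δ) ^ 2) + 1) / 2)
    {st : GMat (E.s + 1) × ℤ} (h : LoopState E ζ p N Δ L e₀ q st) :
    LoopState E ζ p N Δ L e₀ (q + 1)
      (μ.mainStep E ζ T N Δ L e₀ ((e₀ + (Δ - 1) * L : ℕ) : ℤ) q st).val := by
  obtain ⟨f, hf⟩ : ∃ f, f = if q = 0 then 0 else e₀ + (Δ - q) * L := ⟨_, rfl⟩
  have h1 := h.exp
  have h2 := h.map
  rw [← hf] at h1 h2
  have hab : q * N / Δ ≤ (q + 1) * N / Δ :=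
    Nat.div_le_div_right (Nat.mul_le_mul_right _ (Nat.le_succ q))
  set eQ := e₀ + (Δ - 1) * L with heQ
  set e' := e₀ + (Δ - (q + 1)) * L with he'
  have hexp : (e₀ : ℤ) + ((Δ : ℤ) - (q + 1)) * L = (e' : ℤ) := by
    rw [he']
    push_cast [Nat.cast_sub (show q + 1 ≤ Δ by omega)]
    ring
  have hle : e' ≤ eQ := by
    rw [he', heQ]
    exact Nat.add_le_add_left (Nat.mul_le_mul_right _ (by omega)) _
  have hg : (eQ : ℤ) + st.2 - e' = ((eQ + f - e' : ℕ) : ℤ) := by rw [h1]; omega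
  rw [val_mainStep hμ hΔ]
  dsimp only
  rw [hexp, hg]
  refine ⟨by rw [if_neg (Nat.succ_ne_zero q)], ?_⟩
  rw [if_neg (Nat.succ_ne_zero q)]
  set Q := E.hatP ζ (q * N / Δ) ((q + 1) * N / Δ) with hQ
  have hQ0 : Q (Fin.last E.s) (Fin.last E.s) ≠ 0 := DiffEq.hatP_last_ne_zero ho hden hab
  have c1 := ceil_lg_precision (k := E.s + 1) (Δ := Δ) (p := p) (m := L) (n := Δ - 1)
    (Nat.le_add_left _ _) hΔ (j := -(Δ : ℤ) + 1) (by omega)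
  have c2 := ceil_lg_precision (k := E.s + 1) (Δ := Δ) (p := p) (m := L) (n := Δ - (q + 1))
    (Nat.le_add_left _ _) hΔ (j := -(Δ : ℤ) + q + 1) (by omega)
  rw [← he₀] at c1 c2
  have t1 := map_val_truncQuot hμ c1 Q hQ0
  rw [DiffEq.tildeP]
  refine truncMat_eq_tdiv c2 (D := 2 ^ (eQ + f - e'))
    (Y := (μ.truncQuot eQ Q (Q (Fin.last E.s) (Fin.last E.s))).val * st.1) (by positivity) ?_
    (fun i j => val_truncShift _ _ i j)
  rw [← RingHom.mapMatrix_apply, map_mul, RingHom.mapMatrix_apply, RingHom.mapMatrix_apply, h2, t1,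
    Matrix.smul_mul, Matrix.mul_smul, smul_smul, smul_smul]
  have hpow : ((2 ^ (eQ + f - e') : ℤ) : ℂ)⁻¹ * (2 : ℂ) ^ eQ * 2 ^ f = 2 ^ e' := by
    rw [mul_assoc, ← pow_add]
    push_cast
    rw [inv_mul_eq_iff_eq_mul₀ (pow_ne_zero _ two_ne_zero), ← pow_add]
    congr 1
    omega
  rw [← he']
  exact congrArg (· • (E.tildeQ ζ p N Δ (2 ^ L) q * E.tildeP ζ p N Δ (2 ^ L) q)) hpow.symm

/-- Bounds for a loop with an invariant `Inv`: `b` bounds the sizes of the states, `c` that of the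
counters, `t` and `s` the time and the memory of an iteration. -/
theorem loop_bounds {α : Type} [BitSize α] {lim : ℤ} {body : ℤ → α → Run α} {Inv : ℕ → α → Prop}
    {t s b c : ℕ} {n : ℕ} (hb : ∀ q st, q ≤ n → Inv q st → bits st ≤ b)
    (hc : ∀ q, q < n → bits (q : ℤ) + bits lim ≤ c)
    (hbody : ∀ q st, q < n → Inv q st → Inv (q + 1) (body q st).val ∧ (body q st).time ≤ t ∧
      (body q st).peak ≤ s) :
    ∀ (m q : ℕ) (st : α), q + m = n → Inv q st → Inv n (Run.loop lim body m q st).val ∧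
      (Run.loop lim body m q st).time ≤ m * (t + 2 * c) ∧
      (Run.loop lim body m q st).peak ≤ c + b + s := by
  intro m
  induction m with
  | zero =>
    intro q st hq h
    obtain rfl : q = n := by omega
    exact ⟨h, Nat.zero_le _, (hb q st le_rfl h).trans (by omega)⟩
  | succ m ih =>
    intro q st hq h
    obtain ⟨h1, h2, h3⟩ := hbody q st (by omega) h
    obtain ⟨i1, i2, i3⟩ := ih (q + 1) _ (by omega) h1
    have h4 := hc q (by omega)
    have h5 := hb q st (by omega) h
    rw [Nat.cast_succ] at i1 i2 i3
    rw [Run.loop]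
    refine ⟨i1, ?_, max_le ?_ i3⟩
    · rw [add_mul, one_mul]
      dsimp only
      omega
    · omega

end MulAlgo

/-! ### Costs of the steps of binary splitting -/

theorem MulAlgo.Regular.M_two_pow_mul_le {μ : MulAlgo} {D : ℕ}
    (hD : ∀ n, 1 ≤ n → μ.M (2 * n) ≤ D * μ.M n) {n : ℕ} (hn : 1 ≤ n) :
    ∀ j : ℕ, μ.M (2 ^ j * n) ≤ D ^ j * μ.M n
  | 0 => by simp
  | j + 1 => by
    have h := hD (2 ^ j * n) (Nat.mul_pos (by positivity) hn)
    have ih := M_two_pow_mul_le hD hn j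
    rw [pow_succ', mul_assoc]
    refine h.trans ((Nat.mul_le_mul_left D ih).trans_eq ?_)
    ring

/-- For integers of size `O(p)` the cost of the multiplications is proportional to the size, with
the factor `M(p) / p`. Sizes beyond `p` need the doubling condition on `M`. -/
theorem MulAlgo.Regular.budget {I : Type} {μ : MulAlgo} (hμ : μ.Regular) {p w : I → ℕ}
    (hp : ∀ i, 1 ≤ p i) (hw : ∀ i, 1 ≤ w i) (hwp : IsO w p) :
    μ.Budget (fun i => (μ.M (p i) / p i + 1) * w i) w := by
  refine ⟨hμ, hw, IsO.of_le fun i => Nat.le_mul_of_pos_left _ (Nat.succ_pos _), fun c => ?_⟩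
  obtain ⟨c', hc'⟩ := hwp
  obtain ⟨D, hD⟩ := hμ.doubling
  set j := c * c'
  refine ⟨D ^ j * c, fun i m h1 h2 => ?_⟩
  have hmX : m ≤ 2 ^ j * p i := by
    calc m ≤ c * w i := h2
      _ ≤ c * (c' * p i) := Nat.mul_le_mul_left _ (hc' i)
      _ = j * p i := by rw [← mul_assoc]
      _ ≤ _ := Nat.mul_le_mul_right _ Nat.lt_two_pow_self.le
  have h3 := hμ.mul_le_mul h1 hmX
  have h4 := MulAlgo.Regular.M_two_pow_mul_le hD (hp i) j
  have h5 : μ.M (p i) < (μ.M (p i) / p i + 1) * p i := by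
    rw [add_mul, one_mul]; exact Nat.lt_div_mul_add (hp i)
  set φ := μ.M (p i) / p i + 1
  have h6 : μ.M m ≤ D ^ j * φ * m := by
    have hX : 0 < 2 ^ j * p i := Nat.mul_pos (by positivity) (hp i)
    refine Nat.le_of_mul_le_mul_right ?_ hX
    calc μ.M m * (2 ^ j * p i) ≤ D ^ j * μ.M (p i) * m := h3.trans (Nat.mul_le_mul_right _ h4)
      _ ≤ D ^ j * (φ * p i) * m := Nat.mul_le_mul_right _ (Nat.mul_le_mul_left _ h5.le)
      _ = D ^ j * φ * m * p i := by ring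
      _ ≤ D ^ j * φ * m * (2 ^ j * p i) :=
        Nat.mul_le_mul_left _ (Nat.le_mul_of_pos_left _ (by positivity))
  calc μ.M m ≤ D ^ j * φ * m := h6
    _ ≤ D ^ j * φ * (c * w i) := Nat.mul_le_mul_left _ h2
    _ = _ := by ring

/-- The orders of the equations are bounded, and the coefficients and the evaluation points have size
`O(w)`. -/
structure SmallData {I : Type} (E : I → DiffEq) (ζ : I → EvalPoint) (w : I → ℕ) : Prop where
  r : IsO (fun i => (E i).r) fun _ => 1
  s : IsO (fun i => (E i).s) fun _ => 1
  a : ∃ c, ∀ i, ∀ k ≤ (E i).r, ∀ j ≤ (E i).s, bits ((E i).a k j) ≤ c * w i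
  num : IsO (fun i => bits (ζ i).num) w
  den : IsO (fun i => bits (ζ i).den) w

namespace SmallData

variable {I J : Type} {E : I → DiffEq} {ζ : I → EvalPoint} {w : I → ℕ}

theorem comp (h : SmallData E ζ w) (π : J → I) :
    SmallData (fun j => E (π j)) (fun j => ζ (π j)) fun j => w (π j) :=
  ⟨h.r.comp π, h.s.comp π, h.a.imp fun _ hc _ => hc _, h.num.comp π, h.den.comp π⟩

theorem mono {w' : I → ℕ} (h : SmallData E ζ w) (hw : IsO w w') : SmallData E ζ w' := by
  refine ⟨h.r, h.s, ?_, h.num.trans hw, h.den.trans hw⟩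
  obtain ⟨c, hc⟩ := h.a
  obtain ⟨d, hd⟩ := hw
  refine ⟨c * d, fun i k hk j hj => (hc i k hk j hj).trans ?_⟩
  rw [mul_assoc]
  exact Nat.mul_le_mul_left _ (hd i)

theorem coeff (h : SmallData E ζ w) {π : J → I} {k j : J → ℕ} (hk : ∀ x, k x ≤ (E (π x)).r)
    (hj : ∀ x, j x ≤ (E (π x)).s) : IsO (fun x => bits ((E (π x)).a (k x) (j x))) fun x => w (π x) := by
  obtain ⟨c, hc⟩ := h.a
  exact ⟨c, fun x => hc _ _ (hk x) _ (hj x)⟩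

theorem succ_s (h : SmallData E ζ w) : IsO (fun i => (E i).s + 1) fun _ => 1 :=
  h.s.add (IsO.refl _)

theorem succ_r (h : SmallData E ζ w) : IsO (fun i => (E i).r + 1) fun _ => 1 :=
  h.r.add (IsO.refl _)

theorem bits_nat {n g : I → ℕ} (h : IsO n g) (hg : ∀ i, 1 ≤ g i) :
    IsO (fun i => bits (n i : ℤ)) g :=
  IsO.of_le_of (fun i => bits_natCast_le (n i)) (h.add (IsO.const hg))

theorem bits_r (h : SmallData E ζ w) (hw : ∀ i, 1 ≤ w i) : IsO (fun i => bits ((E i).r : ℤ)) w :=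
  bits_nat (h.r.of_bounded hw) hw

theorem bits_s (h : SmallData E ζ w) (hw : ∀ i, 1 ≤ w i) : IsO (fun i => bits ((E i).s : ℤ)) w :=
  bits_nat (h.s.of_bounded hw) hw

end SmallData

namespace MulAlgo.Budget

open Run

variable {I : Type} {μ : MulAlgo} {t w : I → ℕ} {E : I → DiffEq} {ζ : I → EvalPoint}

theorem coeffB (hB : μ.Budget t w) (hE : SmallData E ζ w) {n : I → ℤ} {j : I → ℕ}
    (hj : ∀ i, j i ≤ (E i).s) (hn : IsO (fun i => bits (n i)) w) :
    CostO (fun i => μ.coeffB (E i) (n i) (j i)) t w := by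
  have hj' : IsO (fun i => bits (j i : ℤ)) w :=
    SmallData.bits_nat ((IsO.of_le_of hj hE.s).of_bounded hB.one_le) hB.one_le
  refine (hB.add hn (hE.bits_r hB.one_le)).bind fun v _ hv => (hB.sub hv hj').bind fun x _ hx => ?_
  have hB' := hB.comp (Sigma.fst : (Σ i, Fin ((E i).r + 1)) → I)
  refine hB.fold_gadd hE.succ_r ((hB'.pow (hx.comp _) ?_).bind fun y _ hy => hB'.gscale hy ?_)
  · exact IsO.of_le_of (fun x => x.2.2.le) (hE.succ_r.comp Sigma.fst)
  · exact hE.coeff (π := Sigma.fst) (fun x => Nat.lt_succ_iff.1 x.2.2) (fun x => hj x.1)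

theorem evalHatB (hB : μ.Budget t w) (hE : SmallData E ζ w) {n : I → ℤ}
    (hn : IsO (fun i => bits (n i)) w) :
    CostO (fun i => μ.evalHatB (E i) (ζ i) (n i)) t w := by
  refine (CostO.vec hE.succ_s (coeffB (hB.comp _) (hE.comp _) (fun x => Nat.lt_succ_iff.1 x.2.2)
    (hn.comp _))).bind fun b _ hb => ?_
  have hB' := hB.comp (Sigma.fst : (Σ i, Fin ((E i).s + 1) × Fin ((E i).s + 1)) → I)
  have hb' : ∀ f : ∀ x : (Σ i, Fin ((E i).s + 1) × Fin ((E i).s + 1)), Fin ((E x.1).s + 1),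
      IsO (fun x : (Σ i, Fin ((E i).s + 1) × Fin ((E i).s + 1)) => bits (b x.1 (f x)))
        fun x => w x.1 := fun f => IsO.of_le_of (fun x => bits_coord_le _ _) (hb.comp Sigma.fst)
  have h0 : CostO (fun _ : (Σ i, Fin ((E i).s + 1) × Fin ((E i).s + 1)) =>
      Run.copy (0 : GaussianInt)) (fun x => t x.1) fun x => w x.1 := hB'.copy hB'.const
  refine CostO.mat hE.succ_s (CostO.ite (CostO.ite (hB'.gscale (hE.den.comp _) (hb' _)) h0)
    (CostO.ite h0 (CostO.ite ?_ (CostO.ite (hB'.gmul (hE.num.comp _) (hb' _)) h0))))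
  exact (hB'.gmul (hE.num.comp _) (hb' _)).bind fun v _ hv => hB'.gneg hv

/-- The number `n` of factors has to be bounded. -/
theorem directProd (hB : μ.Budget t w) (hE : SmallData E ζ w) {a : I → ℤ}
    (ha : IsO (fun i => bits (a i)) w) {n : I → ℕ} (hn : IsO n fun _ => 1) :
    CostO (fun i => μ.directProd (E i) (ζ i) (a i) (n i)) t w := by
  refine CostO.of_bounded_param (R := fun i n => μ.directProd (E i) (ζ i) (a i) n) (fun n => ?_) hn
  induction n with
  | zero => exact hB.matOne hE.succ_s
  | succ n ih =>
    exact ih.bind fun P _ hP => (hB.add ha hB.const).bind fun v _ hv =>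
      (hB.evalHatB hE hv).bind fun F _ hF => hB.matMul hE.succ_s hF hP

end MulAlgo.Budget

/-! ### Sizes of the products -/

namespace GaussianInt

/-- The `1`-norm of a Gaussian integer. -/
def l1 (z : GaussianInt) : ℕ := z.re.natAbs + z.im.natAbs

theorem l1_add_le (z w : GaussianInt) : l1 (z + w) ≤ l1 z + l1 w := by
  have h1 := Int.natAbs_add_le z.re w.re
  have h2 := Int.natAbs_add_le z.im w.im
  rw [l1, l1, l1, Zsqrtd.re_add, Zsqrtd.im_add]; omega

theorem l1_mul_le (z w : GaussianInt) : l1 (z * w) ≤ l1 z * l1 w := by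
  have h1 := Int.natAbs_add_le (z.re * w.re) (-1 * z.im * w.im)
  have h2 := Int.natAbs_add_le (z.re * w.im) (z.im * w.re)
  rw [l1, l1, l1, Zsqrtd.re_mul, Zsqrtd.im_mul]
  simp only [Int.natAbs_mul, Int.natAbs_neg, Int.natAbs_one, one_mul] at h1 h2 ⊢
  linarith

theorem l1_sum_le {ι : Type} (s : Finset ι) (f : ι → GaussianInt) :
    l1 (∑ i ∈ s, f i) ≤ ∑ i ∈ s, l1 (f i) := by
  classical
  induction s using Finset.induction_on with
  | empty => simp [l1]
  | insert a s ha ih =>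
    rw [Finset.sum_insert ha, Finset.sum_insert ha]
    exact (l1_add_le _ _).trans (Nat.add_le_add_left ih _)

theorem bits_le_of_l1_lt {z : GaussianInt} {n : ℕ} (h : l1 z ≤ 2 ^ n) : bits z ≤ 2 * n + 4 := by
  have h1 : bits z.re ≤ n + 1 + 1 := by
    rw [bits_le_succ_iff, pow_succ]
    have : 0 < 2 ^ n := by positivity
    rw [l1] at h; omega
  have h2 : bits z.im ≤ n + 1 + 1 := by
    rw [bits_le_succ_iff, pow_succ]
    have : 0 < 2 ^ n := by positivity
    rw [l1] at h; omega
  rw [bits_gaussianInt]; omega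

theorem l1_le_two_pow_bits (z : GaussianInt) : l1 z ≤ 2 ^ bits z := by
  have h1 := (natAbs_lt_two_pow z.re).le
  have h2 := (natAbs_lt_two_pow z.im).le
  have b1 := one_le_bits z.re
  have b2 := one_le_bits z.im
  have h3 := Nat.pow_le_pow_right (n := 2) (by norm_num)
    (show bits z.re - 1 ≤ bits z.re + bits z.im - 1 by omega)
  have h4 := Nat.pow_le_pow_right (n := 2) (by norm_num)
    (show bits z.im - 1 ≤ bits z.re + bits z.im - 1 by omega)
  have h5 : 2 ^ bits z = 2 ^ (bits z.re + bits z.im - 1) * 2 := by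
    rw [← pow_succ, bits_gaussianInt]; congr 1
  rw [l1, h5]; omega

end GaussianInt

open GaussianInt (l1)

/-- The norm `l1` is submultiplicative, and each of the `b - a` factors contributes a sum of `k` terms
bounded by `G`. -/
theorem l1_prodDesc_le {k G : ℕ} {F : ℕ → GMat k} {a b : ℕ} (hab : a ≤ b)
    (hF : ∀ n, n < b → ∀ i j, l1 (F n i j) ≤ G) (i j : Fin k) :
    l1 (prodDesc F a b i j) ≤ (k * G) ^ (b - a) := by
  induction b, hab using Nat.le_induction generalizing i j with
  | base =>
    rw [prodDesc_self, Nat.sub_self, pow_zero, Matrix.one_apply]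
    split_ifs <;> decide
  | succ n hn ih =>
    have ih := fun i j => ih (fun m hm => hF m (by omega)) i j
    rw [prodDesc_succ _ hn, Nat.succ_sub hn, pow_succ', Matrix.mul_apply]
    refine (GaussianInt.l1_sum_le _ _).trans ?_
    calc ∑ l, l1 (F n i l * prodDesc F a n l j) ≤ ∑ _l : Fin k, G * (k * G) ^ (n - a) :=
          Finset.sum_le_sum fun l _ => (GaussianInt.l1_mul_le _ _).trans
            (Nat.mul_le_mul (hF n (Nat.lt_succ_self n) i l) (ih l j))
      _ = _ := by simp [mul_assoc]

theorem bits_gMat_le {k n : ℕ} {A : GMat k} (h : ∀ i j, bits (A i j) ≤ n) : bits A ≤ k * (k * n) := by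
  rw [bits_gMat]
  calc _ ≤ ∑ _i : Fin k, ∑ _j : Fin k, n :=
        Finset.sum_le_sum fun i _ => Finset.sum_le_sum fun j _ => h i j
    _ = _ := by simp

theorem bits_prodDesc_le {k g : ℕ} {F : ℕ → GMat k} {a b : ℕ} (hab : a ≤ b)
    (hF : ∀ n, n < b → bits (F n) ≤ g) :
    bits (prodDesc F a b) ≤ k * (k * (2 * ((k + g) * (b - a)) + 4)) := by
  refine bits_gMat_le fun i j => GaussianInt.bits_le_of_l1_lt ?_
  refine (l1_prodDesc_le (G := 2 ^ g) hab (fun n hn i j => (GaussianInt.l1_le_two_pow_bits _).trans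
    (Nat.pow_le_pow_right (by norm_num) ((bits_entry_le _ i j).trans (hF n hn)))) i j).trans ?_
  rw [pow_mul]
  refine Nat.pow_le_pow_left ?_ _
  rw [pow_add]
  exact Nat.mul_le_mul_right _ Nat.lt_two_pow_self.le

/-! ### Instances of the problem -/

/-- An equation, a point, a precision and a truncation order that satisfy the assumptions of the
theorem for the constants `S`, `A`, `Z`, `δ` and a common bound `κ` for `h / p` and `N / p`. -/
structure Inst (S : ℕ) (A Z δ : ℝ) (κ : ℕ) where
  E : DiffEq
  ζ : EvalPoint
  p : ℕ
  N : ℕ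
  adm : Admissible S A Z δ E ζ
  two_le : 2 ≤ p
  one_le : 1 ≤ N
  h_le : E.h ζ ≤ κ * p
  N_le : N ≤ κ * p

theorem bits_le_clog (x : ℤ) : bits x ≤ Nat.clog 2 x.natAbs + 2 := by
  rw [bits_le_succ_iff, pow_succ]
  have := Nat.le_pow_clog (b := 2) (by norm_num) x.natAbs
  have : 0 < 2 ^ Nat.clog 2 x.natAbs := by positivity
  omega

theorem clog_le_self (n : ℕ) : Nat.clog 2 n ≤ n := by
  rw [Nat.clog_le_iff_le_pow (by norm_num)]
  exact Nat.lt_two_pow_self.le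

theorem clog_mul_le (m n : ℕ) : Nat.clog 2 (m * n) ≤ Nat.clog 2 m + Nat.clog 2 n := by
  rw [Nat.clog_le_iff_le_pow (by norm_num), pow_add]
  exact Nat.mul_le_mul (Nat.le_pow_clog (by norm_num) m) (Nat.le_pow_clog (by norm_num) n)

namespace Inst

variable {S : ℕ} {A Z δ : ℝ} {κ : ℕ}

/-- The size `h + r ⌈lg N⌉` of the matrices `B̂(n)`, up to a constant. -/
def H (i : Inst S A Z δ κ) : ℕ := i.E.h i.ζ + i.E.r * Nat.clog 2 i.N

/-- The number of blocks. -/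
def Δ (i : Inst S A Z δ κ) : ℕ := i.E.numBlocks i.ζ i.p i.N

theorem one_le_p (i : Inst S A Z δ κ) : 1 ≤ i.p := by have := i.two_le; omega

theorem h_le_H (i : Inst S A Z δ κ) : i.E.h i.ζ ≤ i.H := Nat.le_add_right _ _

theorem one_le_H (i : Inst S A Z δ κ) : 1 ≤ i.H := by
  have := MulAlgo.two_le_h (E := i.E) (ζ := i.ζ)
  have := i.h_le_H
  omega

theorem clog_le_H (i : Inst S A Z δ κ) : Nat.clog 2 i.N ≤ i.H :=
  (Nat.le_mul_of_pos_left _ i.adm.one_le_r).trans (Nat.le_add_left _ _)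

theorem one_le_Δ (i : Inst S A Z δ κ) : 1 ≤ i.Δ := MulAlgo.one_le_numBlocks i.one_le_p i.one_le

theorem r_le (i : Inst S A Z δ κ) : i.E.r ≤ S := i.adm.r_le_s.trans i.adm.s_le

theorem isO_N : IsO (fun i : Inst S A Z δ κ => i.N) fun i => i.p := ⟨κ, fun i => i.N_le⟩

theorem isO_h : IsO (fun i : Inst S A Z δ κ => i.E.h i.ζ) fun i => i.p := ⟨κ, fun i => i.h_le⟩

theorem isO_r : IsO (fun i : Inst S A Z δ κ => i.E.r) fun _ => 1 :=
  ⟨S, fun i => by rw [mul_one]; exact i.r_le⟩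

theorem isO_H : IsO (fun i : Inst S A Z δ κ => i.H) fun i => i.p :=
  isO_h.add (isO_r.bounded_mul (IsO.of_le_of (fun i => clog_le_self i.N) isO_N))

theorem Δ_mul_p_lt (i : Inst S A Z δ κ) : i.Δ * i.p < i.N * i.H + i.p :=
  (MulAlgo.numBlocks_bounds i.one_le_p).2

theorem le_Δ_mul_p (i : Inst S A Z δ κ) : i.N * i.H ≤ i.Δ * i.p :=
  (MulAlgo.numBlocks_bounds i.one_le_p).1

theorem Δ_le (i : Inst S A Z δ κ) : i.Δ ≤ κ * i.H + 1 := by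
  refine Nat.le_of_mul_le_mul_right (i.Δ_mul_p_lt.le.trans ?_) i.one_le_p
  have := Nat.mul_le_mul_right i.H i.N_le
  calc i.N * i.H + i.p ≤ κ * i.p * i.H + i.p := by omega
    _ = _ := by ring

theorem isO_Δ : IsO (fun i : Inst S A Z δ κ => i.Δ) fun i => i.H :=
  IsO.of_le_of Δ_le (((IsO.refl _).const_mul κ).add (IsO.const one_le_H))

theorem bits_coeff_le (i : Inst S A Z δ κ) {k j : ℕ} (hk : k ≤ i.E.r) (hj : j ≤ i.E.s) :
    bits (i.E.a k j) ≤ 4 * i.H := by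
  have h1 : bitSize (i.E.a k j) 1 ≤ i.E.h₁ := by
    rw [DiffEq.h₁]
    refine le_trans ?_ (Finset.le_sup (f := fun k =>
      (Finset.range (i.E.s + 1)).sup fun j => bitSize (i.E.a k j) 1)
      (Finset.mem_range.2 (Nat.lt_succ_of_le hk)))
    exact Finset.le_sup (f := fun j => bitSize (i.E.a k j) 1)
      (Finset.mem_range.2 (Nat.lt_succ_of_le hj))
  have h2 := i.h_le_H
  have h3 := bits_le_clog (i.E.a k j).re
  have h4 := bits_le_clog (i.E.a k j).im
  rw [bitSize] at h1
  rw [DiffEq.h] at h2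
  rw [bits_gaussianInt]
  omega

theorem bits_num_den_le (i : Inst S A Z δ κ) : bits i.ζ.num ≤ 4 * i.H ∧ bits i.ζ.den ≤ 4 * i.H := by
  have h1 : i.ζ.h₂ = Nat.clog 2 i.ζ.den.natAbs + Nat.clog 2 i.ζ.num.re.natAbs +
    Nat.clog 2 i.ζ.num.im.natAbs + 1 := rfl
  have h2 := i.h_le_H
  have h3 := bits_le_clog i.ζ.num.re
  have h4 := bits_le_clog i.ζ.num.im
  have h5 := bits_le_clog i.ζ.den
  rw [DiffEq.h] at h2
  rw [bits_gaussianInt]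
  omega

theorem smallData : SmallData (fun i : Inst S A Z δ κ => i.E) (fun i => i.ζ) fun i => i.H where
  r := isO_r
  s := ⟨S, fun i => by rw [mul_one]; exact i.adm.s_le⟩
  a := ⟨4, fun i _ hk _ hj => i.bits_coeff_le hk hj⟩
  num := ⟨4, fun i => i.bits_num_den_le.1⟩
  den := ⟨4, fun i => i.bits_num_den_le.2⟩

theorem bits_le_of_le_N (i : Inst S A Z δ κ) {n : ℕ} (hn : n ≤ i.N) : bits (n : ℤ) ≤ 3 * i.H := by
  have h1 := bits_le_clog n
  rw [Int.natAbs_natCast] at h1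
  have h2 := Nat.clog_mono_right 2 hn
  have h3 := i.clog_le_H
  have h4 := i.one_le_H
  omega

/-- The cost per bit of a multiplication of integers of `p` bits. -/
def φ (μ : MulAlgo) (i : Inst S A Z δ κ) : ℕ := μ.M i.p / i.p + 1

/-- A range `a ≤ n < b` of indices of the matrices `B(n)`. -/
structure Range (S : ℕ) (A Z δ : ℝ) (κ : ℕ) where
  i : Inst S A Z δ κ
  a : ℕ
  b : ℕ
  le : a ≤ b
  le_N : b ≤ i.N

variable {μ : MulAlgo}

theorem budget_H (hμ : μ.Regular) {J : Type} (π : J → Inst S A Z δ κ) :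
    μ.Budget (fun x => (π x).φ μ * (π x).H) fun x => (π x).H :=
  hμ.budget (fun x => (π x).one_le_p) (fun x => (π x).one_le_H) (isO_H.comp π)

theorem budget_p (hμ : μ.Regular) {J : Type} (π : J → Inst S A Z δ κ) :
    μ.Budget (fun x => (π x).φ μ * (π x).p) fun x => (π x).p :=
  hμ.budget (fun x => (π x).one_le_p) (fun x => (π x).one_le_p) (IsO.refl _)

/-- The size of the products of the matrices `B̂(n)`. -/
theorem isO_bits_hatP (hμ : μ.Regular) :
    IsO (fun x : Range S A Z δ κ => bits (x.i.E.hatP x.i.ζ x.a x.b))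
      fun x => x.i.H * (x.b - x.a + 1) := by
  have hB := budget_H (S := S) (A := A) (Z := Z) (δ := δ) (κ := κ) hμ
    (fun x : Σ i : Inst S A Z δ κ, Fin i.N => x.1)
  have h := (hB.evalHatB (smallData.comp _) (n := fun x => ((x.2 : ℕ) : ℤ))
    ⟨3, fun x => x.1.bits_le_of_le_N x.2.2.le⟩).bits
  simp only [MulAlgo.val_evalHatB] at h
  obtain ⟨c, hc⟩ := h
  refine ⟨(S + 1) * ((S + 1) * (2 * (S + 1 + c) + 4)), fun x => ?_⟩
  have h1 := bits_prodDesc_le (F := fun n : ℕ => x.i.E.hatB x.i.ζ n) x.le (g := c * x.i.H)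
    (fun n hn => hc ⟨x.i, ⟨n, hn.trans_le x.le_N⟩⟩)
  have hs : x.i.E.s + 1 ≤ S + 1 := Nat.succ_le_succ x.i.adm.s_le
  have hH := x.i.one_le_H
  set d := x.b - x.a
  set H := x.i.H
  calc _ ≤ (S + 1) * ((S + 1) * (2 * ((S + 1 + c * H) * d) + 4)) := by
        refine h1.trans ?_
        gcongr
    _ ≤ (S + 1) * ((S + 1) * ((2 * (S + 1 + c) + 4) * (H * (d + 1)))) := by
        gcongr
        have e1 : (S + 1 + c * H) * d ≤ (S + 1 + c) * (H * (d + 1)) := by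
          calc (S + 1 + c * H) * d ≤ ((S + 1) * H + c * H) * (d + 1) := by
                refine Nat.mul_le_mul (Nat.add_le_add_right (Nat.le_mul_of_pos_right _ hH) _) (by omega)
            _ = _ := by ring
        have e2 : 1 ≤ H * (d + 1) := Nat.mul_pos hH (by omega)
        have e3 : (2 * (S + 1 + c) + 4) * (H * (d + 1)) =
          2 * ((S + 1 + c) * (H * (d + 1))) + 4 * (H * (d + 1)) := by ring
        omega
    _ = _ := by ring

end Inst

/-! ### Cost of binary splitting -/

namespace MulAlgo

open Run

variable {μ : MulAlgo} {E : DiffEq} {ζ : EvalPoint} {T : ℕ}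

theorem bind_congr {α β : Type} [BitSize α] {c : Run α} {f g : α → Run β} (h : f c.val = g c.val) :
    c.bind f = c.bind g := by
  rw [Run.bind, Run.bind, h]

theorem binSplit_leaf (fuel : ℕ) {a b : ℕ} (h : b - a ≤ T) :
    μ.binSplit E ζ T (fuel + 1) a b = (sub b a).bind fun d => (lt T d).bind fun _ =>
      μ.directProd E ζ a d.toNat := by
  rw [binSplit]
  refine bind_congr (bind_congr (if_neg ?_))
  rw [val_lt, val_sub, decide_eq_true_iff]
  omega

theorem binSplit_node (fuel : ℕ) {a b : ℕ} (h : T < b - a) :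
    μ.binSplit E ζ T (fuel + 1) a b = (sub b a).bind fun d => (lt T d).bind fun _ =>
      (add a b).bind fun t => (shr t 1).bind fun _ =>
      (μ.binSplit E ζ T fuel ((a + b) / 2 : ℕ) b).bind fun R =>
      (μ.binSplit E ζ T fuel a ((a + b) / 2 : ℕ)).bind fun L => μ.matMul R L := by
  rw [binSplit]
  refine bind_congr (bind_congr ((if_pos ?_).trans (bind_congr (bind_congr ?_))))
  · rw [val_lt, val_sub, decide_eq_true_iff]
    omega
  · rw [half_sum_cast]

/-- Replacing the two recursive calls by copies of their results changes the costs by those of the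
calls. -/
theorem binSplit_node_le (fuel : ℕ) {a b : ℕ} (h : T < b - a) {O : Run (GMat (E.s + 1))}
    (hO : O = (sub b a).bind fun d => (lt T d).bind fun _ => (add a b).bind fun t =>
      (shr t 1).bind fun _ => (copy (E.hatP ζ ((a + b) / 2) b)).bind fun R =>
      (copy (E.hatP ζ a ((a + b) / 2))).bind fun L => μ.matMul R L) :
    (μ.binSplit E ζ T (fuel + 1) a b).time ≤ O.time +
      ((μ.binSplit E ζ T fuel ((a + b) / 2 : ℕ) b).time +
        (μ.binSplit E ζ T fuel a ((a + b) / 2 : ℕ)).time) ∧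
    (μ.binSplit E ζ T (fuel + 1) a b).peak ≤ O.peak +
      max (μ.binSplit E ζ T fuel ((a + b) / 2 : ℕ) b).peak
        (μ.binSplit E ζ T fuel a ((a + b) / 2 : ℕ)).peak := by
  have hR := val_binSplit (μ := μ) (E := E) (ζ := ζ) (T := T) fuel ((a + b) / 2) b (by omega)
  have hL := val_binSplit (μ := μ) (E := E) (ζ := ζ) (T := T) fuel a ((a + b) / 2) (by omega)
  rw [binSplit_node fuel h, hO]
  revert hR hL
  generalize μ.binSplit E ζ T fuel ((a + b) / 2 : ℕ) b = R
  generalize μ.binSplit E ζ T fuel a ((a + b) / 2 : ℕ) = L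
  generalize E.hatP ζ ((a + b) / 2) b = R'
  generalize E.hatP ζ a ((a + b) / 2) = L'
  rintro rfl rfl
  simp only [Run.bind, Run.copy]
  constructor <;> omega

end MulAlgo

namespace Inst.Range

open MulAlgo Run

variable {S : ℕ} {A Z δ : ℝ} {κ : ℕ} {μ : MulAlgo} {T : ℕ}

theorem bits_index (x : Range S A Z δ κ) :
    bits (x.a : ℤ) ≤ 3 * x.i.H ∧ bits (x.b : ℤ) ≤ 3 * x.i.H :=
  ⟨x.i.bits_le_of_le_N (x.le.trans x.le_N), x.i.bits_le_of_le_N x.le_N⟩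

/-- The leaves of the recursion tree, with at most `T` factors. -/
theorem exists_leaf_bound (hμ : μ.Regular) (T : ℕ) : ∃ K, ∀ (x : Range S A Z δ κ) (fuel : ℕ),
    x.b - x.a ≤ T →
      (μ.binSplit x.i.E x.i.ζ T fuel x.a x.b).time ≤ K * (x.i.φ μ * x.i.H) ∧
      (μ.binSplit x.i.E x.i.ζ T fuel x.a x.b).peak ≤ K * x.i.H := by
  let J := {x : Range S A Z δ κ // x.b - x.a ≤ T}
  have hB := budget_H (S := S) (A := A) (Z := Z) (δ := δ) (κ := κ) hμ (fun x : J => x.1.i)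
  have ha : IsO (fun x : J => bits (x.1.a : ℤ)) fun x => x.1.i.H := ⟨3, fun x => x.1.bits_index.1⟩
  have hb : IsO (fun x : J => bits (x.1.b : ℤ)) fun x => x.1.i.H := ⟨3, fun x => x.1.bits_index.2⟩
  have hD : ∀ d : J → ℤ, (∀ x, d x = (sub (x.1.b : ℤ) x.1.a).val) →
      CostO (fun x : J => μ.directProd x.1.i.E x.1.i.ζ x.1.a (d x).toNat)
        (fun x => x.1.i.φ μ * x.1.i.H) fun x => x.1.i.H := by
    refine fun d hd => hB.directProd (smallData.comp fun x : J => x.1.i) ha ⟨T, fun x => ?_⟩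
    have := x.2
    dsimp only
    rw [hd, val_sub, mul_one]; omega
  have h0 : CostO (fun x : J => μ.binSplit x.1.i.E x.1.i.ζ T 0 x.1.a x.1.b)
      (fun x => x.1.i.φ μ * x.1.i.H) fun x => x.1.i.H := by
    simp only [binSplit]
    exact (hB.sub hb ha).bind fun d hd _ => hD d hd
  have h1 : CostO (fun x : J => (sub (x.1.b : ℤ) x.1.a).bind fun d => (lt T d).bind fun _ =>
      μ.directProd x.1.i.E x.1.i.ζ x.1.a d.toNat)
      (fun x => x.1.i.φ μ * x.1.i.H) fun x => x.1.i.H :=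
    (hB.sub hb ha).bind fun d hd bd => (hB.lt (hB.const (c := bits (T : ℤ))) bd).bind fun _ _ _ =>
      hD d hd
  obtain ⟨t0, ht0⟩ := h0.time
  obtain ⟨t1, ht1⟩ := h1.time
  obtain ⟨s0, hs0⟩ := h0.peak
  obtain ⟨s1, hs1⟩ := h1.peak
  refine ⟨t0 + t1 + s0 + s1, fun x fuel hx => ?_⟩
  rcases fuel with _ | fuel
  · exact ⟨(ht0 ⟨x, hx⟩).trans (Nat.mul_le_mul_right _ (by omega)),
      (hs0 ⟨x, hx⟩).trans (Nat.mul_le_mul_right _ (by omega))⟩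
  · rw [binSplit_leaf fuel hx]
    exact ⟨(ht1 ⟨x, hx⟩).trans (Nat.mul_le_mul_right _ (by omega)),
      (hs1 ⟨x, hx⟩).trans (Nat.mul_le_mul_right _ (by omega))⟩

/-- A node of the recursion tree with `d = b - a` factors costs, besides the recursive calls, the
multiplication of two matrices of size `O(H d)`. -/
theorem exists_node_bound (hμ : μ.Regular) (T c : ℕ) : ∃ K, ∀ (x : Range S A Z δ κ) (fuel : ℕ),
    T < x.b - x.a → 2 ≤ x.b - x.a → x.i.H * (x.b - x.a) ≤ c * x.i.p →
      (μ.binSplit x.i.E x.i.ζ T (fuel + 1) x.a x.b).time ≤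
        K * (x.i.φ μ * (x.i.H * (x.b - x.a))) +
        ((μ.binSplit x.i.E x.i.ζ T fuel ((x.a + x.b) / 2 : ℕ) x.b).time +
          (μ.binSplit x.i.E x.i.ζ T fuel x.a ((x.a + x.b) / 2 : ℕ)).time) ∧
      (μ.binSplit x.i.E x.i.ζ T (fuel + 1) x.a x.b).peak ≤ K * (x.i.H * (x.b - x.a)) +
        max (μ.binSplit x.i.E x.i.ζ T fuel ((x.a + x.b) / 2 : ℕ) x.b).peak
          (μ.binSplit x.i.E x.i.ζ T fuel x.a ((x.a + x.b) / 2 : ℕ)).peak := by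
  let J := {x : Range S A Z δ κ // 2 ≤ x.b - x.a ∧ x.i.H * (x.b - x.a) ≤ c * x.i.p}
  have hJ : ∀ x : J, 2 ≤ x.1.b - x.1.a := fun x => x.2.1
  have hB := hμ.budget (p := fun x : J => x.1.i.p) (w := fun x : J => x.1.i.H * (x.1.b - x.1.a))
    (fun x => x.1.i.one_le_p)
    (fun x => Nat.mul_pos x.1.i.one_le_H (by have := hJ x; omega)) ⟨c, fun x => x.2.2⟩
  have hHw : IsO (fun x : J => x.1.i.H) fun x => x.1.i.H * (x.1.b - x.1.a) :=
    IsO.of_le fun x => Nat.le_mul_of_pos_right _ (by have := hJ x; omega)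
  have ha : IsO (fun x : J => bits (x.1.a : ℤ)) fun x => x.1.i.H * (x.1.b - x.1.a) :=
    IsO.trans ⟨3, fun x => x.1.bits_index.1⟩ hHw
  have hb : IsO (fun x : J => bits (x.1.b : ℤ)) fun x => x.1.i.H * (x.1.b - x.1.a) :=
    IsO.trans ⟨3, fun x => x.1.bits_index.2⟩ hHw
  have hR : IsO (fun x : J => bits (x.1.i.E.hatP x.1.i.ζ ((x.1.a + x.1.b) / 2) x.1.b))
      fun x => x.1.i.H * (x.1.b - x.1.a) := by
    refine ((isO_bits_hatP hμ).comp fun x : J => (⟨x.1.i, (x.1.a + x.1.b) / 2, x.1.b,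
      by have := x.1.le; omega, x.1.le_N⟩ : Range S A Z δ κ)).trans (IsO.of_le fun x => ?_)
    exact Nat.mul_le_mul_left _ (by have := hJ x; dsimp only; omega)
  have hL : IsO (fun x : J => bits (x.1.i.E.hatP x.1.i.ζ x.1.a ((x.1.a + x.1.b) / 2)))
      fun x => x.1.i.H * (x.1.b - x.1.a) := by
    refine ((isO_bits_hatP hμ).comp fun x : J => (⟨x.1.i, x.1.a, (x.1.a + x.1.b) / 2,
      by have := x.1.le; omega,
      by have := x.1.le; have := x.1.le_N; omega⟩ : Range S A Z δ κ)).trans (IsO.of_le fun x => ?_)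
    exact Nat.mul_le_mul_left _ (by have := hJ x; dsimp only; omega)
  have hs : IsO (fun x : J => x.1.i.E.s + 1) fun _ => 1 :=
    (smallData.comp fun x : J => x.1.i).succ_s
  have hO : CostO (fun x : J => (sub (x.1.b : ℤ) x.1.a).bind fun d => (lt T d).bind fun _ =>
      (add (x.1.a : ℤ) x.1.b).bind fun t => (shr t 1).bind fun _ =>
      (copy (x.1.i.E.hatP x.1.i.ζ ((x.1.a + x.1.b) / 2) x.1.b)).bind fun R =>
      (copy (x.1.i.E.hatP x.1.i.ζ x.1.a ((x.1.a + x.1.b) / 2))).bind fun L => μ.matMul R L)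
      (fun x => (μ.M x.1.i.p / x.1.i.p + 1) * (x.1.i.H * (x.1.b - x.1.a)))
      fun x => x.1.i.H * (x.1.b - x.1.a) :=
    (hB.sub hb ha).bind fun d _ bd => (hB.lt (hB.const (c := bits (T : ℤ))) bd).bind
      fun _ _ _ => (hB.add ha hb).bind fun t _ bt =>
      (hB.shr bt (hB.const (c := bits (1 : ℤ)))).bind fun _ _ _ =>
      (hB.copy hR).bind fun R _ bR => (hB.copy hL).bind fun L _ bL => hB.matMul hs bR bL
  obtain ⟨t, ht⟩ := hO.time
  obtain ⟨s, hs⟩ := hO.peak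
  refine ⟨t + s, fun x fuel h1 h2 h3 => ?_⟩
  have h4 := ht ⟨x, h2, h3⟩
  have h5 := hs ⟨x, h2, h3⟩
  obtain ⟨h6, h7⟩ := binSplit_node_le (μ := μ) (E := x.i.E) (ζ := x.i.ζ) fuel h1 rfl
  refine ⟨h6.trans (Nat.add_le_add_right (h4.trans ?_) _),
    h7.trans (Nat.add_le_add_right (h5.trans ?_) _)⟩
  · exact Nat.mul_le_mul_right _ (Nat.le_add_right _ _)
  · exact Nat.mul_le_mul_right _ (Nat.le_add_left _ _)

/-- Summing the costs of the nodes over the `O(lg d)` levels of the recursion tree, where `d = b - a`.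
The memory for the recursive calls is reused, hence has no factor `lg d`. -/
theorem exists_binSplit_bound (hμ : μ.Regular) (hT : 1 ≤ T) (c : ℕ) : ∃ K, ∀ (fuel : ℕ)
    (x : Range S A Z δ κ), 1 ≤ x.b - x.a → x.b - x.a ≤ fuel → x.i.H * (x.b - x.a) ≤ c * x.i.p →
      (μ.binSplit x.i.E x.i.ζ T fuel x.a x.b).time ≤
        K * (x.i.φ μ * x.i.H) * ((x.b - x.a) * (Nat.clog 2 (x.b - x.a) + 1)) ∧
      (μ.binSplit x.i.E x.i.ζ T fuel x.a x.b).peak ≤ K * x.i.H * (4 * (x.b - x.a)) := by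
  obtain ⟨K₁, h₁⟩ := exists_leaf_bound (S := S) (A := A) (Z := Z) (δ := δ) (κ := κ) hμ T
  obtain ⟨K₂, h₂⟩ := exists_node_bound (S := S) (A := A) (Z := Z) (δ := δ) (κ := κ) hμ T c
  refine ⟨K₁ + K₂, fun fuel => ?_⟩
  induction fuel with
  | zero => intro x h1 h2; omega
  | succ fuel ih =>
    intro x h1 h2 h3
    by_cases hx : x.b - x.a ≤ T
    · obtain ⟨g1, g2⟩ := h₁ x (fuel + 1) hx
      refine ⟨g1.trans ?_, g2.trans ?_⟩
      · refine (Nat.mul_le_mul_right _ (Nat.le_add_right K₁ K₂)).trans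
          (Nat.le_mul_of_pos_right _ (Nat.mul_pos h1 (Nat.succ_pos _)))
      · refine (Nat.mul_le_mul_right _ (Nat.le_add_right K₁ K₂)).trans
          (Nat.le_mul_of_pos_right _ (by omega))
    · have hle := x.le
      have hleN := x.le_N
      obtain ⟨g1, g2⟩ := h₂ x fuel (by omega) (by omega) h3
      set m := (x.a + x.b) / 2 with hm
      have c1 : x.i.H * (x.b - m) ≤ c * x.i.p := (Nat.mul_le_mul_left _ (by omega)).trans h3
      have c2 : x.i.H * (m - x.a) ≤ c * x.i.p := (Nat.mul_le_mul_left _ (by omega)).trans h3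
      obtain ⟨r1, r2⟩ := ih ⟨x.i, m, x.b, by omega, hleN⟩ (by dsimp only; omega)
        (by dsimp only; omega) c1
      obtain ⟨l1, l2⟩ := ih ⟨x.i, x.a, m, by omega, by omega⟩ (by dsimp only; omega)
        (by dsimp only; omega) c2
      dsimp only at r1 r2 l1 l2
      have hd1 : x.b - m = (x.b - x.a + 1) / 2 := by omega
      have hd2 : m - x.a ≤ x.b - m := by omega
      have hd3 : (x.b - m) + (m - x.a) = x.b - x.a := by omega
      -- the larger half has `⌈d / 2⌉` factors, which decreases `⌈lg d⌉` by exactly `1`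
      have hlog : Nat.clog 2 (x.b - x.a) = Nat.clog 2 (x.b - m) + 1 := by
        rw [Nat.clog_of_two_le (by norm_num) (by omega), hd1]; rfl
      have hlog2 : Nat.clog 2 (m - x.a) ≤ Nat.clog 2 (x.b - m) := Nat.clog_mono_right 2 hd2
      -- for `d ≥ 2` factors the larger half has at most `3 d / 4`, so that the bound `4 d` for the
      -- memory leaves `d` for the node itself
      have hdm : 4 * (x.b - m) ≤ 3 * (x.b - x.a) := by omega
      have hdm2 : 4 * (m - x.a) ≤ 3 * (x.b - x.a) := by omega
      rw [hlog]
      revert g1 g2 r1 r2 l1 l2 hlog2 hd3 hdm hdm2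
      generalize x.b - x.a = d
      generalize x.b - m = d₁
      generalize m - x.a = d₂
      generalize μ.binSplit x.i.E x.i.ζ T (fuel + 1) x.a x.b = B
      generalize μ.binSplit x.i.E x.i.ζ T fuel m x.b = R
      generalize μ.binSplit x.i.E x.i.ζ T fuel x.a m = L
      generalize x.i.H = H
      generalize x.i.φ μ = φ
      generalize Nat.clog 2 d₁ = l₁
      generalize Nat.clog 2 d₂ = l₂
      rintro g1 g2 r1 r2 l1 l2 rfl hlog2 hdm hdm2
      refine ⟨?_, ?_⟩
      · have e1 : K₂ * (φ * (H * (d₁ + d₂))) ≤ (K₁ + K₂) * (φ * H) * (d₁ + d₂) := by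
          calc _ = K₂ * (φ * H) * (d₁ + d₂) := by ring
            _ ≤ _ := Nat.mul_le_mul_right _ (Nat.mul_le_mul_right _ (Nat.le_add_left _ _))
        have e2 : (K₁ + K₂) * (φ * H) * (d₂ * (l₂ + 1)) ≤ (K₁ + K₂) * (φ * H) * (d₂ * (l₁ + 1)) :=
          Nat.mul_le_mul_left _ (Nat.mul_le_mul_left _ (by omega))
        calc _ ≤ _ := g1
          _ ≤ (K₁ + K₂) * (φ * H) * (d₁ + d₂) + ((K₁ + K₂) * (φ * H) * (d₁ * (l₁ + 1)) +
              (K₁ + K₂) * (φ * H) * (d₂ * (l₁ + 1))) :=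
            add_le_add e1 (add_le_add r1 (l1.trans e2))
          _ = _ := by ring
      · have e1 : K₂ * (H * (d₁ + d₂)) ≤ (K₁ + K₂) * H * (d₁ + d₂) := by
          rw [mul_assoc]
          exact Nat.mul_le_mul_right _ (Nat.le_add_left _ _)
        have e2 : max R.peak L.peak ≤ (K₁ + K₂) * H * (3 * (d₁ + d₂)) :=
          max_le (r2.trans (Nat.mul_le_mul_left _ hdm)) (l2.trans (Nat.mul_le_mul_left _ hdm2))
        calc _ ≤ _ := g2
          _ ≤ (K₁ + K₂) * H * (d₁ + d₂) + (K₁ + K₂) * H * (3 * (d₁ + d₂)) := add_le_add e1 e2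
          _ = _ := by ring

end Inst.Range

namespace Inst

open MulAlgo Run

variable {S : ℕ} {A Z δ : ℝ} {κ : ℕ} {μ : MulAlgo} {T : ℕ}

theorem one_le_clog_p (i : Inst S A Z δ κ) : 1 ≤ Nat.clog 2 i.p :=
  Nat.clog_pos (by norm_num) i.two_le

theorem isO_clog_N : IsO (fun i : Inst S A Z δ κ => Nat.clog 2 i.N + 1) fun i => Nat.clog 2 i.p := by
  refine IsO.add (IsO.of_le_of (fun i => (Nat.clog_mono_right 2 i.N_le).trans (clog_mul_le κ i.p))
    (IsO.add (IsO.const one_le_clog_p) (IsO.refl _))) (IsO.const one_le_clog_p)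

/-- The time `(M(p) / p + 1) p ⌈lg p⌉` for an iteration of the main loop, up to a constant. -/
def blockTime (μ : MulAlgo) (i : Inst S A Z δ κ) : ℕ := i.φ μ * i.p * Nat.clog 2 i.p

theorem budget_block (hμ : μ.Regular) {J : Type} (π : J → Inst S A Z δ κ) :
    μ.Budget (fun x => (π x).blockTime μ) fun x => (π x).p :=
  (budget_p hμ π).mono (IsO.of_le fun _ => Nat.le_mul_of_pos_right _ (one_le_clog_p _))

theorem costO_binSplit (hμ : μ.Regular) (hT : 1 ≤ T) {J : Type} (x : J → Range S A Z δ κ) {c : ℕ}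
    (hc : ∀ j, (x j).i.H * ((x j).b - (x j).a) ≤ c * (x j).i.p) :
    CostO (fun j => μ.binSplit (x j).i.E (x j).i.ζ T ((x j).b - (x j).a) (x j).a (x j).b)
      (fun j => (x j).i.blockTime μ) fun j => (x j).i.p := by
  have hsize : IsO (fun j => (x j).i.H * ((x j).b - (x j).a + 1)) fun j => (x j).i.p := by
    obtain ⟨d, hd⟩ := isO_H (S := S) (A := A) (Z := Z) (δ := δ) (κ := κ)
    refine ⟨c + d, fun j => ?_⟩
    dsimp only
    rw [mul_add, mul_one, add_mul]
    exact add_le_add (hc j) (hd _)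
  obtain ⟨K₁, h₁⟩ := Range.exists_leaf_bound (S := S) (A := A) (Z := Z) (δ := δ) (κ := κ) hμ T
  obtain ⟨K₂, h₂⟩ := Range.exists_binSplit_bound (S := S) (A := A) (Z := Z) (δ := δ) (κ := κ) hμ hT c
  refine ⟨?_, ?_, ?_⟩
  · simp only [val_binSplit _ _ _ (Range.le _)]
    exact ((isO_bits_hatP hμ).comp x).trans hsize
  · refine IsO.of_le_of (g := fun j => (K₁ + K₂) * ((x j).i.φ μ *
      ((x j).i.H * ((x j).b - (x j).a + 1)) * (Nat.clog 2 (x j).i.N + 1))) (fun j => ?_)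
      (IsO.const_mul _ (IsO.mul (IsO.mul (IsO.refl _) hsize) (isO_clog_N.comp fun j => (x j).i)))
    have hlog : Nat.clog 2 ((x j).b - (x j).a) ≤ Nat.clog 2 (x j).i.N :=
      Nat.clog_mono_right 2 (by have := (x j).le_N; omega)
    by_cases h0 : 1 ≤ (x j).b - (x j).a
    · refine (h₂ _ (x j) h0 le_rfl (hc j)).1.trans ?_
      calc _ ≤ (K₁ + K₂) * ((x j).i.φ μ * (x j).i.H) *
            (((x j).b - (x j).a + 1) * (Nat.clog 2 (x j).i.N + 1)) := by gcongr <;> omega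
        _ = _ := by ring
    · refine (h₁ (x j) _ (by omega)).1.trans ?_
      rw [mul_assoc, mul_assoc, ← mul_assoc ((x j).i.φ μ)]
      refine Nat.mul_le_mul (Nat.le_add_right _ _) (Nat.le_mul_of_pos_right _ ?_)
      exact Nat.mul_pos (Nat.succ_pos _) (Nat.succ_pos _)
  · refine IsO.of_le_of (g := fun j => (4 * (K₁ + K₂)) *
      ((x j).i.H * ((x j).b - (x j).a + 1))) (fun j => ?_) (IsO.const_mul _ hsize)
    by_cases h0 : 1 ≤ (x j).b - (x j).a
    · refine (h₂ _ (x j) h0 le_rfl (hc j)).2.trans ?_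
      calc _ ≤ (K₁ + K₂) * (x j).i.H * (4 * ((x j).b - (x j).a + 1)) := by gcongr <;> omega
        _ = _ := by ring
    · refine (h₁ (x j) _ (by omega)).2.trans ?_
      exact Nat.mul_le_mul (by omega) (Nat.le_mul_of_pos_right _ (Nat.succ_pos _))

end Inst

/-! ### The blocks of the main loop -/

namespace Inst

open MulAlgo Run

variable {S : ℕ} {A Z δ : ℝ} {κ : ℕ} {μ : MulAlgo} {T : ℕ}

/-- A bound for the lengths of the blocks. -/
def blockLen (i : Inst S A Z δ κ) : ℕ := (i.N + i.Δ - 1) / i.Δ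

/-- The exponent `m` such that `2 ^ m` bounds the norms of the matrices `B(n)`. -/
def lgB (μ : MulAlgo) (i : Inst S A Z δ κ) : ℕ := Nat.size (μ.evalNormBound i.E i.ζ).val.natAbs

/-- The binary logarithm of `M`. -/
def lgM (μ : MulAlgo) (i : Inst S A Z δ κ) : ℕ := i.lgB μ * i.blockLen

/-- The number of fractional binary digits of the result. -/
def prec (i : Inst S A Z δ κ) : ℕ := i.p + (Nat.clog 2 (8 * ((i.E.s + 1) * i.Δ) ^ 2) + 1) / 2

theorem N_le_blockLen_mul (i : Inst S A Z δ κ) : i.N ≤ i.blockLen * i.Δ := by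
  have h := Nat.lt_div_mul_add i.one_le_Δ (a := i.N + i.Δ - 1)
  have := i.one_le_Δ
  rw [blockLen]; omega

theorem blockLen_mul_lt (i : Inst S A Z δ κ) : i.blockLen * i.Δ < i.N + i.Δ := by
  have h := Nat.div_mul_le_self (i.N + i.Δ - 1) i.Δ
  have := i.one_le_Δ
  rw [blockLen]; omega

theorem one_le_blockLen (i : Inst S A Z δ κ) : 1 ≤ i.blockLen := by
  have h1 := i.N_le_blockLen_mul
  have h2 := i.one_le
  by_contra hcon
  rw [show i.blockLen = 0 by omega, zero_mul] at h1
  omega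

/-- The range of indices of a block. -/
def block (i : Inst S A Z δ κ) (q : ℕ) (hq : q < i.Δ) : Range S A Z δ κ where
  i := i
  a := q * i.N / i.Δ
  b := (q + 1) * i.N / i.Δ
  le := Nat.div_le_div_right (Nat.mul_le_mul_right _ (Nat.le_succ q))
  le_N := Nat.div_le_of_le_mul (Nat.mul_le_mul_right _ hq)

theorem block_length_le (i : Inst S A Z δ κ) (q : ℕ) :
    (q + 1) * i.N / i.Δ - q * i.N / i.Δ ≤ i.blockLen := by
  have h : (q + 1) * i.N / i.Δ ≤ q * i.N / i.Δ + i.blockLen := by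
    rw [← Nat.add_mul_div_right _ _ i.one_le_Δ]
    refine Nat.div_le_div_right ?_
    rw [add_mul, one_mul]
    exact Nat.add_le_add_left i.N_le_blockLen_mul _
  omega

/-- The number `Δ` of blocks is such that the matrices `Q̂` have size `O(p)`. -/
theorem isO_H_mul_blockLen : IsO (fun i : Inst S A Z δ κ => i.H * i.blockLen) fun i => i.p := by
  obtain ⟨c, hc⟩ := isO_H (S := S) (A := A) (Z := Z) (δ := δ) (κ := κ)
  refine ⟨1 + c, fun i => ?_⟩
  have h1 : i.H * (i.blockLen - 1) ≤ i.p := by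
    refine Nat.le_of_mul_le_mul_right ?_ i.one_le_Δ
    have h2 : (i.blockLen - 1) * i.Δ ≤ i.N := by
      rw [Nat.sub_mul, one_mul]
      have := i.blockLen_mul_lt
      omega
    calc i.H * (i.blockLen - 1) * i.Δ = i.H * ((i.blockLen - 1) * i.Δ) := mul_assoc _ _ _
      _ ≤ i.H * i.N := Nat.mul_le_mul_left _ h2
      _ = i.N * i.H := mul_comm _ _
      _ ≤ i.Δ * i.p := i.le_Δ_mul_p
      _ = _ := mul_comm _ _
  have h3 : i.blockLen = i.blockLen - 1 + 1 := by have := i.one_le_blockLen; omega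
  have h4 := hc i
  dsimp only at h4 ⊢
  rw [h3, mul_add, mul_one, add_mul, one_mul]
  exact add_le_add h1 h4

theorem isO_Δ_p : IsO (fun i : Inst S A Z δ κ => i.Δ) fun i => i.p := isO_Δ.trans isO_H

theorem isO_lgB (hμ : μ.Regular) : IsO (fun i : Inst S A Z δ κ => i.lgB μ) fun _ => 1 := by
  refine ⟨Nat.size ⌈(2 * Z + 1) * (((2 * S) ^ S : ℕ) * ((S + 1) * ((S + 1) * (4 * A + 1))) + 1) + 1⌉₊,
    fun i => ?_⟩
  dsimp only
  rw [mul_one]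
  refine Nat.size_le_size ?_
  have h1 := evalNormBound_le hμ i.adm
  have h2 := one_le_evalNormBound hμ i.adm
  refine Nat.cast_le (α := ℝ).1 (le_trans ?_ (Nat.le_ceil _))
  rw [Nat.cast_natAbs, abs_of_nonneg (by omega)]
  exact h1

/-- `Δ lg M = O(N + Δ)`, as `lg M` is a bounded multiple of `⌈N / Δ⌉`. -/
theorem isO_Δ_mul_lgM (hμ : μ.Regular) :
    IsO (fun i : Inst S A Z δ κ => i.Δ * i.lgM μ) fun i => i.p := by
  refine IsO.of_le_of (fun i => ?_) ((isO_lgB hμ).bounded_mul (isO_N.add isO_Δ_p))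
  calc i.Δ * i.lgM μ = i.lgB μ * (i.blockLen * i.Δ) := by rw [lgM]; ring
    _ ≤ _ := Nat.mul_le_mul_left _ i.blockLen_mul_lt.le

theorem isO_lgM (hμ : μ.Regular) : IsO (fun i : Inst S A Z δ κ => i.lgM μ) fun i => i.p :=
  IsO.of_le_of (fun i => Nat.le_mul_of_pos_left _ i.one_le_Δ) (isO_Δ_mul_lgM hμ)

theorem isO_prec : IsO (fun i : Inst S A Z δ κ => i.prec) fun i => i.p := by
  have hx : IsO (fun i : Inst S A Z δ κ => (i.E.s + 1) * i.Δ) fun i => i.p :=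
    smallData.succ_s.bounded_mul isO_Δ_p
  refine IsO.of_le_of (fun i => ?_) ((IsO.refl _).add ((hx.add hx).add
    (IsO.const (c := 4) one_le_p)))
  have h1 := clog_mul_le 8 (((i.E.s + 1) * i.Δ) ^ 2)
  have h2 := clog_mul_le ((i.E.s + 1) * i.Δ) ((i.E.s + 1) * i.Δ)
  have h3 := clog_le_self ((i.E.s + 1) * i.Δ)
  have h4 : Nat.clog 2 8 = 3 := by
    rw [show 8 = 2 ^ 3 by norm_num, Nat.clog_pow 2 3 (by norm_num)]
  rw [pow_two] at h1
  rw [prec, pow_two]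
  omega

/-- `M` bounds the norms of the products of the matrices of the blocks, with the margin `2 ^ (-p)`. -/
theorem normOne_block_le (hμ : μ.Regular) (i : Inst S A Z δ κ) (q : ℕ) :
    normOne (i.E.P i.ζ (q * i.N / i.Δ) ((q + 1) * i.N / i.Δ)) + (2 : ℝ) ^ (-(i.p : ℤ)) ≤
      2 ^ i.lgM μ := by
  set β := (μ.evalNormBound i.E i.ζ).val.natAbs with hβ
  have h1 := one_le_evalNormBound hμ i.adm
  have h2 : ((μ.evalNormBound i.E i.ζ).val : ℝ) = β := by
    rw [hβ, Nat.cast_natAbs, abs_of_nonneg (by omega)]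
  have hβ1 : (1 : ℝ) ≤ β := by rw [← h2]; exact_mod_cast h1
  have h3 : normOne (i.E.P i.ζ (q * i.N / i.Δ) ((q + 1) * i.N / i.Δ)) ≤ (β : ℝ) ^ i.blockLen := by
    refine (normOne_prodDesc_le (β := β) (by positivity)
      (Nat.div_le_div_right (Nat.mul_le_mul_right _ (Nat.le_succ q))) fun n => ?_).trans
      (pow_le_pow_right₀ hβ1 (i.block_length_le q))
    rw [← h2]
    exact normOne_B_le_evalNormBound hμ i.adm n
  have h4 : (2 : ℝ) ^ (-(i.p : ℤ)) ≤ 1 := zpow_le_one_of_nonpos₀ (by norm_num) (by omega)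
  -- integers: `β ^ l < (2 ^ m) ^ l` leaves a margin of `1`
  have h5 : β ^ i.blockLen + 1 ≤ 2 ^ i.lgM μ := by
    rw [lgM, pow_mul]
    exact Nat.pow_lt_pow_left (Nat.lt_size_self β) (by have := i.one_le_blockLen; omega)
  have h6 : (β : ℝ) ^ i.blockLen + 1 ≤ 2 ^ i.lgM μ := by exact_mod_cast h5
  linarith

/-! ### Cost of the main loop -/

/-- The states of the main loop before the iteration `q`. -/
abbrev State (μ : MulAlgo) (i : Inst S A Z δ κ) (q : ℕ) (st : GMat (i.E.s + 1) × ℤ) : Prop :=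
  LoopState i.E i.ζ i.p i.N i.Δ (i.lgM μ) i.prec q st

/-- The entries of `P̃^(q)` are at most `M ^ q`, and the number of fractional digits decreases by `lg M`
with each iteration: their sum stays below `e₀ + Δ lg M`. -/
theorem bits_state_le (hμ : μ.Regular) (i : Inst S A Z δ κ) {q : ℕ} (hq : q ≤ i.Δ)
    {st : GMat (i.E.s + 1) × ℤ} (h : i.State μ q st) :
    bits st ≤ (i.E.s + 1) * ((i.E.s + 1) * (2 * (i.prec + i.Δ * i.lgM μ) + 4)) +
      (i.prec + i.Δ * i.lgM μ + 1) := by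
  set f := if q = 0 then 0 else i.prec + (i.Δ - q) * i.lgM μ with hf
  have hfle : f + i.lgM μ * q ≤ i.prec + i.Δ * i.lgM μ := by
    rw [hf]
    split_ifs with h0
    · rw [h0, mul_zero]; exact Nat.zero_le _
    · refine le_of_eq ?_
      rw [add_assoc, mul_comm _ q, ← add_mul, Nat.sub_add_cancel hq]
  set n := i.prec + i.Δ * i.lgM μ with hn
  have hP : normOne (i.E.tildeP i.ζ i.p i.N i.Δ (2 ^ i.lgM μ) q) ≤ (2 ^ i.lgM μ) ^ q := by
    refine DiffEq.normOne_tildeP_le i.adm.ordinary i.adm.den_pos (by positivity) fun m _ => ?_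
    have h1 := normOne_block_le hμ i m
    have h2 : (0 : ℝ) < (2 : ℝ) ^ (-(i.p : ℤ)) := by positivity
    linarith
  have hentry : ∀ a b, ‖GaussianInt.toComplex (st.1 a b)‖ ≤ (2 : ℝ) ^ n := by
    intro a b
    have h1 : GaussianInt.toComplex (st.1 a b) =
        (2 : ℂ) ^ f * i.E.tildeP i.ζ i.p i.N i.Δ (2 ^ i.lgM μ) q a b := congrFun (congrFun h.map a) b
    rw [h1, norm_mul, norm_pow, Complex.norm_ofNat]
    calc (2 : ℝ) ^ f * ‖i.E.tildeP i.ζ i.p i.N i.Δ (2 ^ i.lgM μ) q a b‖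
        ≤ (2 : ℝ) ^ f * (2 ^ i.lgM μ) ^ q :=
          mul_le_mul_of_nonneg_left ((norm_entry_le_normOne _ _ _).trans hP) (by positivity)
      _ = 2 ^ (f + i.lgM μ * q) := by rw [pow_add, pow_mul]
      _ ≤ 2 ^ n := pow_le_pow_right₀ (by norm_num) hfle
  have hb : ∀ x : ℤ, ((|x| : ℤ) : ℝ) ≤ 2 ^ n → bits x ≤ n + 2 := by
    intro x hx
    have h1 : x.natAbs ≤ 2 ^ n := by
      refine Nat.cast_le (α := ℝ).1 ?_
      rw [Nat.cast_natAbs]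
      exact_mod_cast hx
    have h2 : 0 < 2 ^ n := by positivity
    rw [bits_le_succ_iff, pow_succ]
    omega
  rw [bits_pair]
  refine add_le_add (bits_gMat_le fun a b => ?_) ?_
  · have h1 := hb _ ((GaussianInt.abs_re_le_norm _).trans (hentry a b))
    have h2 := hb _ ((GaussianInt.abs_im_le_norm _).trans (hentry a b))
    rw [bits_gaussianInt]
    omega
  · rw [h.exp]
    refine (bits_natCast_le _).trans ?_
    rw [← hf]
    omega

theorem isO_stateBound (hμ : μ.Regular) : IsO (fun i : Inst S A Z δ κ =>
    (i.E.s + 1) * ((i.E.s + 1) * (2 * (i.prec + i.Δ * i.lgM μ) + 4)) +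
      (i.prec + i.Δ * i.lgM μ + 1)) fun i => i.p := by
  have h1 : IsO (fun i : Inst S A Z δ κ => i.prec + i.Δ * i.lgM μ) fun i => i.p :=
    isO_prec.add (isO_Δ_mul_lgM hμ)
  have h2 := IsO.const (c := 4) (one_le_p (S := S) (A := A) (Z := Z) (δ := δ) (κ := κ))
  have h3 := IsO.const (c := 1) (one_le_p (S := S) (A := A) (Z := Z) (δ := δ) (κ := κ))
  exact (smallData.succ_s.bounded_mul (smallData.succ_s.bounded_mul ((h1.const_mul 2).add h2))).add
    (h1.add h3)

/-- An iteration of the main loop. -/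
structure Step (μ : MulAlgo) (S : ℕ) (A Z δ : ℝ) (κ : ℕ) where
  i : Inst S A Z δ κ
  q : ℕ
  st : GMat (i.E.s + 1) × ℤ
  lt : q < i.Δ
  state : i.State μ q st

theorem costO_mainStep (hμ : μ.Regular) (hT : 1 ≤ T) :
    CostO (fun x : Step μ S A Z δ κ => μ.mainStep x.i.E x.i.ζ T x.i.N x.i.Δ (x.i.lgM μ) x.i.prec
      ((x.i.prec + (x.i.Δ - 1) * x.i.lgM μ : ℕ) : ℤ) x.q x.st)
      (fun x => x.i.blockTime μ) fun x => x.i.p := by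
  have hB := budget_block hμ (fun x : Step μ S A Z δ κ => x.i)
  have h1 := hB.one_le
  have hs : IsO (fun x : Step μ S A Z δ κ => x.i.E.s + 1) fun _ => 1 :=
    (smallData.comp fun x : Step μ S A Z δ κ => x.i).succ_s
  have bq : IsO (fun x : Step μ S A Z δ κ => bits (x.q : ℤ)) fun x => x.i.p :=
    SmallData.bits_nat (IsO.of_le_of (fun x => x.lt.le) (isO_Δ_p.comp _)) h1
  have bN : IsO (fun x : Step μ S A Z δ κ => bits (x.i.N : ℤ)) fun x => x.i.p :=
    SmallData.bits_nat (isO_N.comp _) h1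
  have bΔ : IsO (fun x : Step μ S A Z δ κ => bits (x.i.Δ : ℤ)) fun x => x.i.p :=
    SmallData.bits_nat (isO_Δ_p.comp _) h1
  have bL : IsO (fun x : Step μ S A Z δ κ => bits (x.i.lgM μ : ℤ)) fun x => x.i.p :=
    SmallData.bits_nat ((isO_lgM hμ).comp _) h1
  have be₀ : IsO (fun x : Step μ S A Z δ κ => bits (x.i.prec : ℤ)) fun x => x.i.p :=
    SmallData.bits_nat (isO_prec.comp _) h1
  have heQ : IsO (fun x : Step μ S A Z δ κ => x.i.prec + (x.i.Δ - 1) * x.i.lgM μ) fun x => x.i.p :=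
    IsO.of_le_of (fun x => Nat.add_le_add_left (Nat.mul_le_mul_right _ (Nat.sub_le _ _)) _)
      ((isO_prec.add (isO_Δ_mul_lgM hμ)).comp _)
  have beQ := SmallData.bits_nat heQ h1
  have bst : IsO (fun x : Step μ S A Z δ κ => bits x.st.1 + bits x.st.2) fun x => x.i.p :=
    IsO.of_le_of (fun x => bits_state_le hμ x.i x.lt.le x.state) ((isO_stateBound hμ).comp _)
  have bst1 : IsO (fun x : Step μ S A Z δ κ => bits x.st.1) fun x => x.i.p :=
    IsO.of_le_of (fun x => Nat.le_add_right _ _) bst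
  have bst2 : IsO (fun x : Step μ S A Z δ κ => bits x.st.2) fun x => x.i.p :=
    IsO.of_le_of (fun x => Nat.le_add_left _ _) bst
  have hΔ0 : ∀ x : Step μ S A Z δ κ, (0 : ℤ) < x.i.Δ := fun x => by
    exact_mod_cast x.i.one_le_Δ
  refine (hB.mul bq bN).bind fun v₁ e₁ b₁ => ?_
  refine (hB.div (fun x => ?_) hΔ0 b₁ bΔ).bind fun a ea ba => ?_
  · rw [e₁, val_mul]; positivity
  refine (hB.add bq (hB.const (c := bits (1 : ℤ)))).bind fun q' eq' bq' => ?_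
  refine (hB.mul bq' bN).bind fun v₂ e₂ b₂ => ?_
  have hv₂ : ∀ x : Step μ S A Z δ κ, v₂ x = (((x.q + 1) * x.i.N : ℕ) : ℤ) := fun x => by
    rw [e₂, val_mul, eq', val_add]; push_cast; rfl
  refine (hB.div (fun x => ?_) hΔ0 b₂ bΔ).bind fun b eb bb => ?_
  · rw [hv₂]; positivity
  have ha' : a = fun x => ((x.q * x.i.N / x.i.Δ : ℕ) : ℤ) := funext fun x => by
    rw [ea, e₁, val_mul, val_div hμ (hΔ0 x) (by positivity)]; push_cast; rfl
  have hb' : b = fun x => (((x.q + 1) * x.i.N / x.i.Δ : ℕ) : ℤ) := funext fun x => by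
    rw [eb, hv₂, val_div hμ (hΔ0 x) (by positivity)]; push_cast; rfl
  subst ha' hb'
  have hlen : ∀ x : Step μ S A Z δ κ, ((((x.q + 1) * x.i.N / x.i.Δ : ℕ) : ℤ) -
      ((x.q * x.i.N / x.i.Δ : ℕ) : ℤ)).toNat = (x.q + 1) * x.i.N / x.i.Δ - x.q * x.i.N / x.i.Δ :=
    fun x => by omega
  simp only [hlen]
  obtain ⟨c, hc⟩ := isO_H_mul_blockLen (S := S) (A := A) (Z := Z) (δ := δ) (κ := κ)
  have hbs := costO_binSplit hμ hT (fun x : Step μ S A Z δ κ => x.i.block x.q x.lt) (c := c)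
    fun x => (Nat.mul_le_mul_left _ (x.i.block_length_le x.q)).trans (hc x.i)
  refine CostO.bind hbs fun Q eQ bQ => ?_
  have hQ : ∀ x : Step μ S A Z δ κ, Q x (Fin.last _) (Fin.last _) ≠ 0 := fun x => by
    have h2 : Q x = x.i.E.hatP x.i.ζ (x.q * x.i.N / x.i.Δ) ((x.q + 1) * x.i.N / x.i.Δ) :=
      (eQ x).trans (val_binSplit _ _ _ (x.i.block x.q x.lt).le)
    rw [h2]
    exact DiffEq.hatP_last_ne_zero x.i.adm.ordinary x.i.adm.den_pos (x.i.block x.q x.lt).le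
  refine CostO.bind (hB.truncQuot hs hQ beQ (by simpa only [Int.toNat_natCast] using heQ) bQ
    (IsO.of_le_of (fun x => bits_entry_le (Q x) _ _) bQ)) fun Q' _ bQ' => ?_
  refine (hB.matMul hs bQ' bst1).bind fun V _ bV => ?_
  refine (hB.sub bΔ bq').bind fun t _ bt => (hB.mul bt bL).bind fun t' _ bt' =>
    (hB.add be₀ bt').bind fun e' _ be' => (hB.add beQ bst2).bind fun f _ bf =>
    (hB.sub bf be').bind fun g _ bg => (hB.truncShift hs bg bV).bind fun V' _ bV' => ?_
  exact hB.copy (x := fun x => (V' x, e' x)) (bV'.add be')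

end Inst

/-! ### Cost of the whole algorithm -/

namespace MulAlgo.Budget

open Run

variable {I : Type} {μ : MulAlgo} {t w : I → ℕ} {E : I → DiffEq} {ζ : I → EvalPoint}

theorem evalNumBlocks (hB : μ.Budget t w) (hE : SmallData E ζ w) {p N : I → ℕ} (hp : ∀ i, 1 ≤ p i)
    (bp : IsO (fun i => bits (p i : ℤ)) w) (bN : IsO (fun i => bits (N i : ℤ)) w)
    (bh : IsO (fun i => bits ((E i).h (ζ i) : ℤ)) w) :
    CostO (fun i => μ.evalNumBlocks (E i) (ζ i) (p i) (N i)) t w := by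
  have b1 := hB.const (c := bits (1 : ℤ))
  refine (hB.sub bN b1).bind fun x hx bx => (hB.bitLen bx).bind fun L hL bL =>
    (hB.mul (hE.bits_r hB.one_le) bL).bind fun y hy bY => (hB.add bh bY).bind fun z hz bz =>
    (hB.mul bN bz).bind fun v hv bv => (hB.add bv bp).bind fun v₁ hv₁ bv₁ =>
    (hB.sub bv₁ b1).bind fun v₂ hv₂ bv₂ => hB.div (fun i => ?_) (fun i => ?_) bv₂ bp
  · rw [hv₂, val_sub, hv₁, val_add, hv, val_mul, hz, val_add, hy, val_mul, hL, val_bitLen]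
    have h1 : (1 : ℤ) ≤ p i := by exact_mod_cast hp i
    have h2 : (0 : ℤ) ≤ (N i : ℤ) * (((E i).h (ζ i) : ℤ) + ((E i).r : ℤ) *
      (Nat.size (x i).natAbs : ℤ)) := by positivity
    omega
  · exact_mod_cast hp i

theorem evalNormBound (hB : μ.Budget t w) (hE : SmallData E ζ w)
    (ha : ∀ i, (E i).a (E i).r 0 ≠ 0) (hden : ∀ i, 0 < (ζ i).den) :
    CostO (fun i => μ.evalNormBound (E i) (ζ i)) t w := by
  have b1 := hB.const (c := bits (1 : ℤ))
  have bz : IsO (fun i => bits ((E i).a (E i).r 0)) w :=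
    hE.coeff (π := id) (fun _ => le_rfl) fun _ => Nat.zero_le _
  refine (hB.absVal (re bz)).bind fun x hx bx => (hB.absVal (im bz)).bind fun y hy bY =>
    (hB.lt bx bY).bind fun c hc _ => ?_
  have bd : IsO (fun i => bits (if c i then y i else x i)) w :=
    IsO.of_le_of (fun i => by split_ifs <;> omega) (bx.add bY)
  refine (hB.copy bd).bind fun d hd bd => ?_
  have hd0 : ∀ i, 0 < d i := by
    intro i
    have h1 := max_abs_pos (ha i)
    rw [hd, val_copy]
    have hx := hx i
    have hy := hy i
    have hc := hc i
    rw [val_absVal] at hx hy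
    rw [val_lt] at hc
    rw [← hx, ← hy] at h1
    split_ifs with h
    · rw [h] at hc
      have := of_decide_eq_true hc.symm
      omega
    · rw [Bool.not_eq_true] at h
      rw [h] at hc
      have := of_decide_eq_false hc.symm
      omega
  refine CostO.bind (hB.fold_add hE.succ_r (fold_add (hB.comp _) (hE.succ_s.comp _)
    (ratioBound ((hB.comp _).comp _) (fun x => hd0 _) ?_ ((bd.comp _).comp _)))) fun v _ bv => ?_
  · exact hE.coeff (π := fun x : (Σ x : (Σ i, Fin ((E i).r + 1)), Fin ((E x.1).s + 1)) => x.1.1)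
      (fun x => Nat.lt_succ_iff.1 x.1.2.2) (fun x => Nat.lt_succ_iff.1 x.2.2)
  refine (hB.add (hE.bits_r hB.one_le) (hE.bits_s hB.one_le)).bind fun u _ bu =>
    (hB.pow bu hE.r).bind fun u' _ bu' => (hB.mul bu' bv).bind fun v₁ _ bv₁ =>
    (hB.add bv₁ b1).bind fun v₂ _ bv₂ => (hB.ratioBound hden hE.num hE.den).bind fun z _ bz =>
    (hB.mul bz bv₂).bind fun v₃ _ bv₃ => hB.add bv₃ b1

theorem evalLgM (hB : μ.Budget t w) (hE : SmallData E ζ w)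
    (ha : ∀ i, (E i).a (E i).r 0 ≠ 0) (hden : ∀ i, 0 < (ζ i).den) {N : I → ℕ} {Δ : I → ℤ}
    (hΔ : ∀ i, 0 < Δ i) (bN : IsO (fun i => bits (N i : ℤ)) w)
    (bΔ : IsO (fun i => bits (Δ i)) w) :
    CostO (fun i => μ.evalLgM (E i) (ζ i) (N i) (Δ i)) t w := by
  refine (hB.evalNormBound hE ha hden).bind fun β _ bβ => (hB.bitLen bβ).bind fun m _ bm =>
    (hB.add bN bΔ).bind fun x hx bx => (hB.sub bx (hB.const (c := bits (1 : ℤ)))).bind fun x' hx' bx' =>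
    (hB.div (fun i => ?_) hΔ bx' bΔ).bind fun l _ bl => hB.mul bm bl
  have := hΔ i
  rw [hx', val_sub, hx, val_add]
  omega

theorem evalGuard (hB : μ.Budget t w) (hE : SmallData E ζ w) {Δ : I → ℤ}
    (bΔ : IsO (fun i => bits (Δ i)) w) : CostO (fun i => μ.evalGuard (E i) (Δ i)) t w := by
  have b1 := hB.const (c := bits (1 : ℤ))
  refine (hB.add (hE.bits_s hB.one_le) b1).bind fun k _ bk => (hB.mul bk bΔ).bind fun x _ bx =>
    (hB.mul bx bx).bind fun y _ bY =>
    (hB.shl bY (hB.const (c := bits (3 : ℤ))) (hB.const (c := (3 : ℤ).toNat))).bind fun z _ bz =>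
    (hB.sub bz b1).bind fun z' _ bz' => (hB.bitLen bz').bind fun e _ be =>
    (hB.add be b1).bind fun e' _ be' => hB.shr be' b1

end MulAlgo.Budget

namespace Inst

open MulAlgo Run

variable {S : ℕ} {A Z δ : ℝ} {κ : ℕ} {μ : MulAlgo} {T : ℕ}

/-- The main loop, run with the parameters that the algorithm computes. -/
def mainLoop (μ : MulAlgo) (T : ℕ) (i : Inst S A Z δ κ) : Run (GMat (i.E.s + 1) × ℤ) :=
  loop (i.Δ : ℤ) (μ.mainStep i.E i.ζ T i.N i.Δ (i.lgM μ) i.prec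
    ((i.prec + (i.Δ - 1) * i.lgM μ : ℕ) : ℤ)) i.Δ 0 (1, 0)

theorem state_zero (i : Inst S A Z δ κ) : i.State μ 0 (1, 0) where
  exp := rfl
  map := by
    rw [if_pos rfl, pow_zero, one_smul, DiffEq.tildeP]
    exact Matrix.map_one _ (map_zero _) (map_one _)

theorem exists_mainLoop_bounds (hμ : μ.Regular) (hT : 1 ≤ T) : ∃ K, ∀ i : Inst S A Z δ κ,
    i.State μ i.Δ (i.mainLoop μ T).val ∧ (i.mainLoop μ T).time ≤ K * (i.Δ * i.blockTime μ) ∧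
      (i.mainLoop μ T).peak ≤ K * i.p := by
  have hstep := costO_mainStep (S := S) (A := A) (Z := Z) (δ := δ) (κ := κ) hμ hT
  obtain ⟨t, ht⟩ := hstep.time
  obtain ⟨s, hs⟩ := hstep.peak
  obtain ⟨b, hb⟩ := isO_stateBound (S := S) (A := A) (Z := Z) (δ := δ) (κ := κ) hμ
  obtain ⟨c, hc⟩ := isO_Δ_p (S := S) (A := A) (Z := Z) (δ := δ) (κ := κ)
  obtain ⟨d, hd⟩ := (budget_block (S := S) (A := A) (Z := Z) (δ := δ) (κ := κ) hμ id).linear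
  refine ⟨t + 2 * (2 * (c + 1) * d) + (2 * (c + 1) + b + s), fun i => ?_⟩
  have hp := i.one_le_p
  have hΔ := hc i
  have h := loop_bounds (n := i.Δ) (lim := i.Δ) (Inv := fun q st => i.State μ q st)
    (body := μ.mainStep i.E i.ζ T i.N i.Δ (i.lgM μ) i.prec
      ((i.prec + (i.Δ - 1) * i.lgM μ : ℕ) : ℤ))
    (t := t * i.blockTime μ) (s := s * i.p) (b := b * i.p) (c := 2 * (c + 1) * i.p)
    (fun q st hq h => (bits_state_le hμ i hq h).trans (hb i))
    (fun q hq => ?_)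
    (fun q st hq h => ⟨LoopState.step hμ i.adm.ordinary i.adm.den_pos i.one_le_Δ hq rfl h,
      ht ⟨i, q, st, hq, h⟩, hs ⟨i, q, st, hq, h⟩⟩) i.Δ 0 (1, 0) (Nat.zero_add _) i.state_zero
  · obtain ⟨h1, h2, h3⟩ := h
    rw [Nat.cast_zero] at h1 h2 h3
    refine ⟨h1, h2.trans ?_, h3.trans ?_⟩
    · have h4 : 2 * (c + 1) * i.p ≤ 2 * (c + 1) * (d * i.blockTime μ) := Nat.mul_le_mul_left _ (hd i)
      calc i.Δ * (t * i.blockTime μ + 2 * (2 * (c + 1) * i.p))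
          ≤ i.Δ * (t * i.blockTime μ + 2 * (2 * (c + 1) * (d * i.blockTime μ))) := by gcongr
        _ = (t + 2 * (2 * (c + 1) * d)) * (i.Δ * i.blockTime μ) := by ring
        _ ≤ _ := Nat.mul_le_mul_right _ (Nat.le_add_right _ _)
    · calc 2 * (c + 1) * i.p + b * i.p + s * i.p = (2 * (c + 1) + b + s) * i.p := by ring
        _ ≤ _ := Nat.mul_le_mul_right _ (Nat.le_add_left _ _)
  · have h1 := bits_natCast_le q
    have h2 := bits_natCast_le i.Δ
    dsimp only at hΔ
    have h3 : 2 * (c + 1) * i.p = 2 * (c * i.p) + 2 * i.p := by ring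
    omega

theorem costO_mainLoop (hμ : μ.Regular) (hT : 1 ≤ T) : CostO (fun i : Inst S A Z δ κ =>
    i.mainLoop μ T) (fun i => i.Δ * i.blockTime μ) fun i => i.p := by
  obtain ⟨K, hK⟩ := exists_mainLoop_bounds (S := S) (A := A) (Z := Z) (δ := δ) (κ := κ) hμ hT
  refine ⟨?_, ⟨K, fun i => (hK i).2.1⟩, ⟨K, fun i => (hK i).2.2⟩⟩
  exact IsO.of_le_of (fun i => bits_state_le hμ i le_rfl (hK i).1) (isO_stateBound hμ)

theorem val_evalParams (hμ : μ.Regular) (i : Inst S A Z δ κ) :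
    (μ.evalNumBlocks i.E i.ζ i.p i.N).val = (i.Δ : ℕ) ∧
    (μ.evalLgM i.E i.ζ i.N i.Δ).val = (i.lgM μ : ℕ) ∧
    (i.p : ℤ) + (μ.evalGuard i.E i.Δ).val = (i.prec : ℕ) := by
  refine ⟨val_evalNumBlocks hμ i.one_le_p i.one_le, val_evalLgM hμ i.one_le i.one_le_Δ, ?_⟩
  rw [val_evalGuard i.one_le_Δ, prec, Nat.cast_add]

theorem cast_prec_add (i : Inst S A Z δ κ) : (i.prec : ℤ) + ((i.Δ : ℤ) - 1) * (i.lgM μ : ℕ) =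
    ((i.prec + (i.Δ - 1) * i.lgM μ : ℕ) : ℤ) := by
  push_cast [Nat.cast_sub i.one_le_Δ]
  ring

theorem val_truncBinSplit (hμ : μ.Regular) (i : Inst S A Z δ κ) :
    (μ.truncBinSplit i.E i.ζ T i.p i.N).val = (i.mainLoop μ T).val := by
  obtain ⟨h1, h2, h3⟩ := val_evalParams hμ i
  rw [truncBinSplit]
  simp only [val_bind, val_add, val_sub, val_mul, val_matOne]
  rw [h1, h2, h3, cast_prec_add, Int.toNat_natCast, mainLoop]

theorem state_truncBinSplit (hμ : μ.Regular) (hT : 1 ≤ T) (i : Inst S A Z δ κ) :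
    i.State μ i.Δ (μ.truncBinSplit i.E i.ζ T i.p i.N).val := by
  rw [val_truncBinSplit hμ]
  obtain ⟨K, hK⟩ := exists_mainLoop_bounds (S := S) (A := A) (Z := Z) (δ := δ) (κ := κ) hμ hT
  exact (hK i).1

theorem costO_truncBinSplit (hμ : μ.Regular) (hT : 1 ≤ T) : CostO (fun i : Inst S A Z δ κ =>
    μ.truncBinSplit i.E i.ζ T i.p i.N) (fun i => i.Δ * i.blockTime μ) fun i => i.p := by
  have hB : μ.Budget (fun i : Inst S A Z δ κ => i.Δ * i.blockTime μ) fun i => i.p :=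
    (budget_block hμ fun i : Inst S A Z δ κ => i).mono
      (IsO.of_le fun i => Nat.le_mul_of_pos_left _ i.one_le_Δ)
  have hE := (smallData (S := S) (A := A) (Z := Z) (δ := δ) (κ := κ)).mono isO_H
  have h1 := hB.one_le
  have b1 := hB.const (c := bits (1 : ℤ))
  have bp : IsO (fun i : Inst S A Z δ κ => bits (i.p : ℤ)) fun i => i.p :=
    SmallData.bits_nat (IsO.refl _) h1
  have bN : IsO (fun i : Inst S A Z δ κ => bits (i.N : ℤ)) fun i => i.p :=
    SmallData.bits_nat isO_N h1
  have bh : IsO (fun i : Inst S A Z δ κ => bits (i.E.h i.ζ : ℤ)) fun i => i.p :=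
    SmallData.bits_nat isO_h h1
  refine (hB.evalNumBlocks hE one_le_p bp bN bh).bind fun Δ hΔ bΔ => ?_
  have hΔ' : Δ = fun i => (i.Δ : ℤ) := funext fun i => (hΔ i).trans (val_evalParams hμ i).1
  subst hΔ'
  refine (hB.evalLgM hE (fun i => i.adm.ordinary.indicial.1) (fun i => i.adm.den_pos)
    (fun i => by exact_mod_cast i.one_le_Δ) bN bΔ).bind fun L hL bL => ?_
  have hL' : L = fun i => (i.lgM μ : ℤ) := funext fun i => (hL i).trans (val_evalParams hμ i).2.1
  subst hL'
  refine (hB.evalGuard hE bΔ).bind fun c hc bc => (hB.add bp bc).bind fun e₀ he₀ be₀ => ?_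
  have he₀' : e₀ = fun i => (i.prec : ℤ) := funext fun i => by
    rw [he₀, val_add, hc, (val_evalParams hμ i).2.2]
  subst he₀'
  refine (hB.sub bΔ b1).bind fun x hx bx => (hB.mul bx bL).bind fun y hy bY =>
    (hB.add be₀ bY).bind fun eQ heQ _ => ?_
  have heQ' : eQ = fun i => ((i.prec + (i.Δ - 1) * i.lgM μ : ℕ) : ℤ) := funext fun i => by
    rw [heQ, val_add, hy, val_mul, hx, val_sub, cast_prec_add]
  subst heQ'
  refine (hB.matOne hE.succ_s).bind fun P hP _ => ?_
  have hP' : P = fun _ => 1 := funext fun i => (hP i).trans (val_matOne _)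
  subst hP'
  exact costO_mainLoop hμ hT

end Inst

/-! ### The bounds in terms of `h + r lg p` -/

namespace Inst

open MulAlgo

variable {S : ℕ} {A Z δ : ℝ} {κ : ℕ} {μ : MulAlgo} {T : ℕ}

theorem isO_inputBits :
    IsO (fun i : Inst S A Z δ κ => inputBits i.E i.ζ i.p i.N) fun i => i.p := by
  have h1 := one_le_p (S := S) (A := A) (Z := Z) (δ := δ) (κ := κ)
  have hE := (smallData (S := S) (A := A) (Z := Z) (δ := δ) (κ := κ)).mono isO_H
  have ha : IsO (fun i : Inst S A Z δ κ => ∑ k ∈ Finset.range (i.E.r + 1),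
      ∑ j ∈ Finset.range (i.E.s + 1), bits (i.E.a k j)) fun i => i.p := by
    refine IsO.of_le_of (fun i => ?_) (hE.succ_r.bounded_mul
      (hE.succ_s.bounded_mul (isO_H.const_mul 4)))
    calc _ ≤ ∑ _k ∈ Finset.range (i.E.r + 1), ∑ _j ∈ Finset.range (i.E.s + 1), 4 * i.H :=
          Finset.sum_le_sum fun k hk => Finset.sum_le_sum fun j hj => i.bits_coeff_le
            (Nat.lt_succ_iff.1 (Finset.mem_range.1 hk)) (Nat.lt_succ_iff.1 (Finset.mem_range.1 hj))
      _ = _ := by simp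
  exact ((((((ha.add hE.num).add hE.den).add (hE.bits_r h1)).add (hE.bits_s h1)).add
    (SmallData.bits_nat isO_h h1)).add (SmallData.bits_nat (IsO.refl _) h1)).add
    (SmallData.bits_nat isO_N h1)

theorem one_le_lg {p : ℕ} (hp : 2 ≤ p) : 1 ≤ lg p := by
  rw [lg, Real.le_logb_iff_rpow_le (by norm_num) (by positivity), Real.rpow_one]
  exact_mod_cast hp

theorem clog_p_le (i : Inst S A Z δ κ) : (Nat.clog 2 i.p : ℝ) ≤ 2 * lg i.p := by
  have h1 := ceil_lg_natCast i.p
  have h2 := Int.ceil_lt_add_one (lg i.p)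
  rw [h1, Int.cast_natCast] at h2
  have := one_le_lg i.two_le
  linarith

/-- `⌈lg N⌉ = O(lg p)`, as `N = O(p)`. -/
theorem exists_H_le : ∃ c : ℝ, 0 ≤ c ∧ ∀ i : Inst S A Z δ κ,
    (i.H : ℝ) ≤ c * (i.E.h i.ζ + i.E.r * lg i.p) := by
  obtain ⟨c, hc⟩ := isO_clog_N (S := S) (A := A) (Z := Z) (δ := δ) (κ := κ)
  refine ⟨1 + 2 * c, by positivity, fun i => ?_⟩
  have h1 : (Nat.clog 2 i.N : ℝ) ≤ c * (2 * lg i.p) := by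
    have h2 : Nat.clog 2 i.N ≤ c * Nat.clog 2 i.p := (Nat.le_succ _).trans (hc i)
    have h3 : (Nat.clog 2 i.N : ℝ) ≤ c * Nat.clog 2 i.p := by exact_mod_cast h2
    exact h3.trans (mul_le_mul_of_nonneg_left i.clog_p_le (Nat.cast_nonneg _))
  have hl := one_le_lg i.two_le
  have h4 : (i.E.r : ℝ) * Nat.clog 2 i.N ≤ i.E.r * (c * (2 * lg i.p)) :=
    mul_le_mul_of_nonneg_left h1 (Nat.cast_nonneg _)
  have h5 : (0 : ℝ) ≤ 2 * c * i.E.h i.ζ := by positivity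
  have h6 : (0 : ℝ) ≤ i.E.r * lg i.p := by positivity
  rw [H]
  push_cast
  linarith

/-- As `H = O(p)` and `1 ≤ N`. -/
theorem exists_Δ_le_N : ∃ c : ℕ, ∀ i : Inst S A Z δ κ, i.Δ ≤ c * i.N := by
  obtain ⟨c, hc⟩ := isO_H (S := S) (A := A) (Z := Z) (δ := δ) (κ := κ)
  refine ⟨c, fun i => Nat.le_of_lt_succ (Nat.lt_of_mul_lt_mul_right (a := i.p)
    (i.Δ_mul_p_lt.trans_le ?_))⟩
  have := Nat.mul_le_mul_left i.N (hc i)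
  calc i.N * i.H + i.p ≤ i.N * (c * i.p) + i.p := Nat.add_le_add_right this _
    _ = _ := by rw [Nat.succ_eq_add_one]; ring

/-- The bound `M` is at most exponential in the average length of the blocks. -/
theorem exists_two_pow_lgM_le (hμ : μ.Regular) : ∃ C : ℝ, 0 < C ∧ ∀ i : Inst S A Z δ κ,
    (2 : ℝ) ^ i.lgM μ ≤ C ^ ((i.N : ℝ) / i.Δ) := by
  obtain ⟨m, hm⟩ := isO_lgB (S := S) (A := A) (Z := Z) (δ := δ) (κ := κ) hμ
  obtain ⟨c, hc⟩ := exists_Δ_le_N (S := S) (A := A) (Z := Z) (δ := δ) (κ := κ)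
  refine ⟨2 ^ (m * (1 + c)), by positivity, fun i => ?_⟩
  have hΔ : (0 : ℝ) < i.Δ := by exact_mod_cast i.one_le_Δ
  have h1 : (i.blockLen : ℝ) ≤ (1 + c) * (i.N / i.Δ) := by
    rw [← mul_div_assoc, le_div_iff₀ hΔ]
    have h2 := i.blockLen_mul_lt
    have h3 := hc i
    have h4 : i.blockLen * i.Δ ≤ (1 + c) * i.N := by rw [add_mul, one_mul]; omega
    exact_mod_cast h4
  have h5 : (i.lgB μ : ℝ) ≤ m := by
    have := hm i
    rw [mul_one] at this
    exact_mod_cast this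
  rw [← Real.rpow_natCast, ← Real.rpow_natCast, ← Real.rpow_mul (by norm_num)]
  refine Real.rpow_le_rpow_of_exponent_le (by norm_num) ?_
  rw [lgM]
  push_cast
  rw [mul_assoc]
  exact mul_le_mul h5 h1 (Nat.cast_nonneg _) (Nat.cast_nonneg _)

/-- The result of the algorithm represents the matrix `P̃^(Δ)`. -/
theorem output_eq (hμ : μ.Regular) (hT : 1 ≤ T) (i : Inst S A Z δ κ) :
    (2 : ℂ) ^ (-(μ.truncBinSplit i.E i.ζ T i.p i.N).val.2) •
      (μ.truncBinSplit i.E i.ζ T i.p i.N).val.1.map GaussianInt.toComplex =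
        i.E.tildeP i.ζ i.p i.N i.Δ (2 ^ i.lgM μ) i.Δ := by
  have h := state_truncBinSplit hμ hT i
  rw [h.exp, h.map, zpow_neg, zpow_natCast, smul_smul, inv_mul_cancel₀ (pow_ne_zero _ two_ne_zero),
    one_smul]

theorem exists_time_le (hμ : μ.Regular) (hT : 1 ≤ T) : ∃ c : ℝ, 0 ≤ c ∧ ∀ i : Inst S A Z δ κ,
    ((μ.truncBinSplit i.E i.ζ T i.p i.N).time : ℝ) ≤ c * (μ.M i.p * (i.Δ * lg i.p)) := by
  obtain ⟨c, hc⟩ := (costO_truncBinSplit (S := S) (A := A) (Z := Z) (δ := δ) (κ := κ) hμ hT).time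
  refine ⟨4 * c, by positivity, fun i => ?_⟩
  have h1 := hμ.rate_mul_le i.one_le_p
  have h2 : (μ.truncBinSplit i.E i.ζ T i.p i.N).time ≤
      c * (i.Δ * (2 * μ.M i.p * Nat.clog 2 i.p)) :=
    (hc i).trans (Nat.mul_le_mul_left _ (Nat.mul_le_mul_left _ (Nat.mul_le_mul_right _ h1)))
  have h3 : ((μ.truncBinSplit i.E i.ζ T i.p i.N).time : ℝ) ≤
      c * (i.Δ * (2 * μ.M i.p * Nat.clog 2 i.p)) := by exact_mod_cast h2
  calc _ ≤ _ := h3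
    _ ≤ (c : ℝ) * (i.Δ * (2 * μ.M i.p * (2 * lg i.p))) := by
      gcongr
      exact i.clog_p_le
    _ = _ := by ring

theorem exists_Δ_le : ∃ c : ℝ, 0 ≤ c ∧ ∀ i : Inst S A Z δ κ,
    (i.Δ : ℝ) ≤ c * (i.E.h i.ζ + i.E.r * lg i.p) := by
  obtain ⟨c, hc⟩ := isO_Δ (S := S) (A := A) (Z := Z) (δ := δ) (κ := κ)
  obtain ⟨d, hd, hH⟩ := exists_H_le (S := S) (A := A) (Z := Z) (δ := δ) (κ := κ)
  refine ⟨c * d, by positivity, fun i => ?_⟩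
  have h1 : (i.Δ : ℝ) ≤ c * i.H := by exact_mod_cast hc i
  rw [mul_assoc]
  exact h1.trans (mul_le_mul_of_nonneg_left (hH i) (Nat.cast_nonneg _))

/-- When `N = O(p / lg p)`, a factor `lg p` is saved. -/
theorem exists_Δ_mul_lg_le (κ' : ℝ) (hκ' : 0 ≤ κ') : ∃ c : ℝ, 0 ≤ c ∧ ∀ i : Inst S A Z δ κ,
    (i.N : ℝ) ≤ κ' * (i.p / lg i.p) →
    (i.Δ : ℝ) * lg i.p ≤ c * (i.E.h i.ζ + i.E.r * lg i.p) := by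
  obtain ⟨d, hd, hH⟩ := exists_H_le (S := S) (A := A) (Z := Z) (δ := δ) (κ := κ)
  refine ⟨κ' * d + 1, by positivity, fun i hN => ?_⟩
  have hl := one_le_lg i.two_le
  have hp : (0 : ℝ) < i.p := by exact_mod_cast i.one_le_p
  have hr : (1 : ℝ) ≤ i.E.r := by exact_mod_cast i.adm.one_le_r
  have h1 : (i.Δ : ℝ) * i.p ≤ i.N * i.H + i.p := by exact_mod_cast i.Δ_mul_p_lt.le
  rw [← mul_div_assoc, le_div_iff₀ (by linarith)] at hN
  have h2 : (i.Δ : ℝ) * lg i.p ≤ κ' * i.H + lg i.p := by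
    refine le_of_mul_le_mul_right ?_ hp
    have h3 := mul_le_mul_of_nonneg_left h1 (show 0 ≤ lg i.p by linarith)
    have h4 := mul_le_mul_of_nonneg_right hN (Nat.cast_nonneg (α := ℝ) i.H)
    linarith
  have h5 := mul_le_mul_of_nonneg_left (hH i) hκ'
  have h6 : lg i.p ≤ i.E.r * lg i.p := le_mul_of_one_le_left (by linarith) hr
  have h7 : (0 : ℝ) ≤ i.E.h i.ζ := Nat.cast_nonneg _
  linarith

end Inst

theorem proposition3 (μ : MulAlgo) (hμ : μ.Regular) (T : ℕ) (hT : 1 ≤ T)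
    (S : ℕ) (A Z δ κh κN : ℝ) (hδ : 0 < δ) :
    ∃ C K : ℝ, 0 < C ∧ ∀ (E : DiffEq) (ζ : EvalPoint), Admissible S A Z δ E ζ →
      ∀ p N : ℕ, 2 ≤ p → 1 ≤ N → (E.h ζ : ℝ) ≤ κh * p →
        (E.ρ < ⊤ → (N : ℝ) ≤ κN * p) → (E.ρ = ⊤ → (N : ℝ) ≤ κN * (p / lg p)) →
          -- the run is a run of the algorithm, for a suitable choice of the bound `M`
          (∃ M : ℝ,
            (∀ q < E.numBlocks ζ p N,
              normOne (E.P ζ (q * N / E.numBlocks ζ p N) ((q + 1) * N / E.numBlocks ζ p N)) +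
                (2 : ℝ) ^ (-(p : ℤ)) ≤ M) ∧
            M ≤ C ^ ((N : ℝ) / E.numBlocks ζ p N) ∧
            (2 : ℂ) ^ (-(μ.truncBinSplit E ζ T p N).val.2) •
                (μ.truncBinSplit E ζ T p N).val.1.map GaussianInt.toComplex =
              E.tildeP ζ p N (E.numBlocks ζ p N) M (E.numBlocks ζ p N)) ∧
          -- running time
          (E.ρ < ⊤ → ((μ.truncBinSplit E ζ T p N).time : ℝ) ≤
            K * (μ.M p * (E.h ζ + E.r * lg p) * lg p)) ∧
          (E.ρ = ⊤ → ((μ.truncBinSplit E ζ T p N).time : ℝ) ≤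
            K * (μ.M p * (E.h ζ + E.r * lg p))) ∧
          -- memory
          ((inputBits E ζ p N + (μ.truncBinSplit E ζ T p N).peak : ℕ) : ℝ) ≤ K * p := by
  -- as `lg p ≥ 1`, the hypothesis on `N` for `ρ = ∞` implies the one for `ρ < ∞`
  set κ : ℕ := ⌈max κh κN⌉₊
  have hκ : max κh κN ≤ κ := Nat.le_ceil _
  have hκh : κh ≤ κ := (le_max_left _ _).trans hκ
  have hκN : κN ≤ κ := (le_max_right _ _).trans hκ
  obtain ⟨C, hC, hM⟩ := Inst.exists_two_pow_lgM_le (S := S) (A := A) (Z := Z) (δ := δ) (κ := κ) hμ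
  obtain ⟨t, ht, htime⟩ := Inst.exists_time_le (S := S) (A := A) (Z := Z) (δ := δ) (κ := κ) hμ hT
  obtain ⟨d, hd, hΔ⟩ := Inst.exists_Δ_le (S := S) (A := A) (Z := Z) (δ := δ) (κ := κ)
  obtain ⟨d', hd', hΔ'⟩ := Inst.exists_Δ_mul_lg_le (S := S) (A := A) (Z := Z) (δ := δ) (κ := κ) κ
    (Nat.cast_nonneg _)
  obtain ⟨w, hw⟩ := Inst.isO_inputBits.add
    (Inst.costO_truncBinSplit (S := S) (A := A) (Z := Z) (δ := δ) (κ := κ) hμ hT).peak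
  refine ⟨C, t * d + t * d' + w, hC, fun E ζ hadm p N hp hN hh hfin hinf => ?_⟩
  have hl := Inst.one_le_lg hp
  have hp0 : (0 : ℝ) ≤ p := Nat.cast_nonneg _
  have hdiv : (p : ℝ) / lg p ≤ p := div_le_self hp0 hl
  have hdiv0 : (0 : ℝ) ≤ p / lg p := div_nonneg hp0 (by linarith)
  have hN' : E.ρ = ⊤ → (N : ℝ) ≤ κ * (p / lg p) := fun h =>
    (hinf h).trans (mul_le_mul_of_nonneg_right hκN hdiv0)
  have hNp : (N : ℝ) ≤ κ * p := by
    rcases eq_or_ne E.ρ ⊤ with h | h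
    · exact (hN' h).trans (mul_le_mul_of_nonneg_left hdiv (Nat.cast_nonneg _))
    · exact (hfin (lt_top_iff_ne_top.2 h)).trans (mul_le_mul_of_nonneg_right hκN hp0)
  have hhp : (E.h ζ : ℝ) ≤ κ * p := hh.trans (mul_le_mul_of_nonneg_right hκh hp0)
  let i : Inst S A Z δ κ := ⟨E, ζ, p, N, hadm, hp, hN, by exact_mod_cast hhp, by exact_mod_cast hNp⟩
  have hM0 : (0 : ℝ) ≤ μ.M p := Nat.cast_nonneg _
  have hX : (0 : ℝ) ≤ E.h ζ + E.r * lg p :=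
    add_nonneg (Nat.cast_nonneg _) (mul_nonneg (Nat.cast_nonneg _) (by linarith))
  refine ⟨⟨2 ^ i.lgM μ, fun q _ => i.normOne_block_le hμ q, hM i, i.output_eq hμ hT⟩,
    fun _ => ?_, fun h => ?_, ?_⟩
  · calc _ ≤ t * (μ.M p * (i.Δ * lg p)) := htime i
      _ ≤ t * (μ.M p * (d * (E.h ζ + E.r * lg p) * lg p)) := by
        gcongr
        exact hΔ i
      _ = t * d * (μ.M p * (E.h ζ + E.r * lg p) * lg p) := by ring
      _ ≤ _ := by
        refine mul_le_mul_of_nonneg_right ?_ (mul_nonneg (mul_nonneg hM0 hX) (by linarith))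
        have : 0 ≤ t * d' := mul_nonneg ht hd'
        have : (0 : ℝ) ≤ w := Nat.cast_nonneg _
        linarith
  · calc _ ≤ t * (μ.M p * (i.Δ * lg p)) := htime i
      _ ≤ t * (μ.M p * (d' * (E.h ζ + E.r * lg p))) := by
        refine mul_le_mul_of_nonneg_left (mul_le_mul_of_nonneg_left ?_ hM0) ht
        exact hΔ' i (hN' h)
      _ = t * d' * (μ.M p * (E.h ζ + E.r * lg p)) := by ring
      _ ≤ _ := by
        refine mul_le_mul_of_nonneg_right ?_ (mul_nonneg hM0 hX)
        have : 0 ≤ t * d := mul_nonneg ht hd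
        have : (0 : ℝ) ≤ w := Nat.cast_nonneg _
        linarith
  · have h1 : ((inputBits E ζ p N + (μ.truncBinSplit E ζ T p N).peak : ℕ) : ℝ) ≤ w * p := by
      exact_mod_cast hw i
    refine h1.trans (mul_le_mul_of_nonneg_right ?_ hp0)
    have : 0 ≤ t * d := mul_nonneg ht hd
    have : 0 ≤ t * d' := mul_nonneg ht hd'
    linarith
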